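/- **Setting.** Let $H,K,\Xi$ be real separable Hilbert spaces and let $e^{tA}$, $t\ge 0$, be a strongly continuous semigroup on $H$. Let $G\in\mathcal L(\Xi,H)$ be such that, for every $t\ge0$, the operator $Q_t=\int_0^t e^{sA}GG^*e^{sA^*}ds$ is trace class. Let $\overline H$ be a real Banach space with $H\subseteq\overline H$, the inclusion being continuous and dense, such that $e^{tA}$ extends to a strongly continuous semigroup $\overline{e^{tA}}$ on $\overline H$. Let $C\in\mathcal L(K,\overline H)$ and $P\in\mathcal L(H)$, and assume that for each $t>0$ the operator $Pe^{tA}$ extends to a bounded operator $\overline{Pe^{tA}}:\overline H\to H$. Assume that for every $T>0$ there are $C_T>0$ and $\theta\in[0,1/2)$ with $|\overline{Pe^{tA}}\bar x|_H\le C_Tt^{-\theta}|\bar x|_{\overline H}$ for all $t\in(0,T]$, $\bar x\in\overline H$. For a positive trace class operator $S$ on a separable Hilbert space, $\mathcal N(0,S)$ is the centred Gaussian measure with covariance $S$. An inverse of a non-injective operator denotes its pseudoinverse. For $h\in(\ker S)^\perp$, $\langle h,S^{-1/2}z\rangle$ denotes the measurable linear functional on $\mathcal N(0,S)$, i.e.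 the $L^2(\mathcal N(0,S))$-limit of $z\mapsto\langle u_n,z\rangle$ for $S^{1/2}u_n\to h$. A function $\varphi:\overline H\to\mathbb R$ is $C$-Fréchet differentiable at $\bar x$, with derivative $\nabla^C\varphi(\bar x)\in K^*\simeq K$, if $\frac1\alpha(\varphi(\bar x+\alpha Ck)-\varphi(\bar x))\to\langle\nabla^C\varphi(\bar x),k\rangle$ as $\alpha\to0$, uniformly for $|k|\le1$. *Paths.* Put $y_{\bar x}(t)=\overline{Pe^{tA}}\bar x$ for $t>0$, and let $\mathcal C=\{y_{\bar x}:\bar x\in\overline H\}\subset C((0,\infty);H)$ with the topology of uniform convergence on compact sets. Let $\Upsilon_s:\overline H\to L^2_s:=L^2(0,s;H)$, $\Upsilon_s\bar x=y_{\bar x}|_{(0,s]}$; the adjoint $\Upsilon_s^*:L^2_s\to H$ is that of $\Upsilon_s|_H$. *Function classes.* For a Hilbert space $Z$, $\mathcal S_{\eta,prog}((0,T]\times\overline H;Z)$ is the set of $f:(0,T]\times\overline H\to Z$ of the form $f(t,\bar x)=\hat f(t,y_{\bar x})$, where $\hat f:(0,T]\times\mathcal C\to Z$ is Borel, $t^\eta\hat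 f$ is bounded, and $\hat f(t,y)$ depends on $y$ only through the stopped path $y(\cdot\wedge t)$. Such an $\hat f(s,\cdot)$ is evaluated on $\operatorname{Im}\Upsilon_s\subset L^2_s$ in the obvious way, and set to $0$ on the rest of $L^2_s$. The space $C^{0,1,C}_\gamma([0,T]\times\overline H)$ consists of the real functions $g$ that are continuous and bounded on $[0,T]\times H$ and on $(0,T]\times\overline H$, with $g(t,\cdot)$ $C$-Fréchet differentiable on $\overline H$ with continuous bounded derivative for each $t\in(0,T]$, and with $t^\gamma\nabla^Cg$ continuous and bounded on $(0,T]\times\overline H$. Finally, $\mathcal S^{1,P}_{\gamma,prog}((0,T]\times\overline H)$ is the set of $g\in \mathcal S_{0,prog}((0,T]\times\overline H;\mathbb R)\cap C^{0,1,C}_\gamma([0,T]\times\overline H)$ with $t^\gamma\nabla^Cg\in\mathcal S_{0,prog}((0,T]\times\overline H;K)$. Let $R_t[\varphi](\bar x)=\int_H\varphi(z+\overline{e^{tA}}\bar x)\,\mathcal N(0,Q_t)(dz)$. **(A)** Let $T_1>0$, $\kappa>0$, $\gamma\in(0,1)$ be such that, for all $0<s<t\le T_1$ and $k\in K$, $$\Upsilon_s\overline{e^{(t-s)A}}Ck\in\operatorname{Im}(\Upsilon_sQ_{t-s}\Upsilon_s^*)^{1/2},\qquad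 |\widehat\Lambda_s(t-s)k|_{L^2_s}\le\kappa(t-s)^{-\gamma}|k|,$$ where $\widehat\Lambda_s(t-s)k:=(\Upsilon_sQ_{t-s}\Upsilon_s^*)^{-1/2}\Upsilon_s\overline{e^{(t-s)A}}Ck$. Let $T\in(0,T_1]$, $\eta\in[0,1)$ and $f\in\mathcal S_{\eta,prog}((0,T]\times\overline H;\mathbb R)$. Then for every $t\in[0,T]$, $\bar x\in\overline H$ the convolution $$g(t,\bar x)=\int_0^tR_{t-s}[f(s,\cdot)](\bar x)\,ds$$ is well defined (both integrals converge absolutely) and $g(t,\cdot)$ is $C$-Fréchet differentiable at $\bar x$; $\nabla^Cg\in\mathcal S_{\gamma,prog}((0,T]\times\overline H;K)$; and, with absolutely convergent inner and outer integrals, $$\langle\nabla^Cg(t,\bar x),k\rangle=\int_0^t\int_{L^2_s}\hat f\big(s,z_1+\Upsilon_s\overline{e^{(t-s)A}}\bar x\big)\big\langle\widehat\Lambda_s(t-s)k,(\Upsilon_sQ_{t-s}\Upsilon_s^*)^{-1/2}z_1\big\rangle\,\mathcal N(0,\Upsilon_sQ_{t-s}\Upsilon_s^*)(dz_1)\,ds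 .$$ Moreover, for all $t\in(0,T]$, $\bar x\in\overline H$, $k\in K$, writing $\|t^\eta f\|_\infty=\sup_{(0,T]\times\overline H}|t^\eta f|$ and $B$ for the Euler beta function, $$|\langle\nabla^Cg(t,\bar x),k\rangle|\le\|t^\eta f\|_\infty|k|\int_0^t\kappa s^{-\eta}(t-s)^{-\gamma}ds=\|t^\eta f\|_\infty|k|\,\kappa\,B(1-\eta,1-\gamma)\,t^{1-\eta-\gamma}\le\|t^\eta f\|_\infty|k|\,\kappa\,B(1-\eta,1-\gamma)\,T^{1-\eta}\,t^{-\gamma}.$$ If $\hat f$ is continuous, then $g$ is continuous on $[0,T]\times\overline H$, $\nabla^Cg$ is continuous on $(0,T]\times\overline H$, and $g\in\mathcal S^{1,P}_{\gamma,prog}((0,T]\times\overline H)$. **(B)** Let $T>0$, $\kappa_1>0$, $\gamma\in(0,1)$ be such that $\operatorname{Im}\overline{Pe^{tA}}C\subseteq\operatorname{Im}(PQ_tP^*)^{1/2}$ for all $t>0$ and $\|(PQ_tP^*)^{-1/2}\overline{Pe^{tA}}C\|_{\mathcal L(K,H)}\le\kappa_1(t^{-\gamma}\vee1)$ for $t\in(0,T]$.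 Assume also $\operatorname{Im}\overline{Pe^{tA}}\subseteq\operatorname{Im}P$ for all $t>0$ (automatic if $\operatorname{Im}P$ is closed). Let $\eta\in[0,1)$ and let $f:(0,T]\times H\to\mathbb R$ be such that $t^\eta f(t,x)=\psi(t,Px)$ with $\psi:(0,T]\times\operatorname{Im}P\to\mathbb R$ bounded and continuous. Write $f(s,x)=\bar f(s,Px)$ and $$g(t,\bar x)=\int_0^t\int_H\bar f\big(s,Pz+\overline{Pe^{(t-s)A}}\bar x\big)\,\mathcal N(0,Q_{t-s})(dz)\,ds .$$ Then for all $t\in[0,T]$ and $\bar x\in\overline H$ the value $g(t,\bar x)$ is well defined (both integrals converge absolutely) and $g(t,\cdot)$ is $C$-Fréchet differentiable at $\bar x$; $g$ is continuous on $[0,T]\times\overline H$, $\nabla^Cg$ is continuous on $(0,T]\times\overline H$, and $g\in\mathcal S^{1,P}_{\gamma,prog}((0,T]\times\overline H)$. -/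

import Mathlib

open MeasureTheory Set Filter Topology
open scoped InnerProductSpace RealInnerProductSpace

noncomputable section

/-! ### Operators on real Hilbert spaces -/

section Operators

variable {E F : Type*} [NormedAddCommGroup E] [InnerProductSpace ℝ E] [CompleteSpace E]
  [NormedAddCommGroup F] [InnerProductSpace ℝ F] [CompleteSpace F]

open Classical in
/-- The positive square root `S^{1/2}` of a positive bounded operator `S`: the (unique) positive
operator whose square is `S`. The value is irrelevant when `S` is not positive. -/
def posSqrt (S : E →L[ℝ] E) : E →L[ℝ] E :=
  if h : ∃ R : E →L[ℝ] E, R.IsPositive ∧ R ∘L R = S then h.choose else 0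

open Classical in
/-- The pseudoinverse `R⁻¹ y` of a bounded operator: for `y ∈ Im R` the unique preimage of `y`
lying in `(ker R)ᗮ`. The value is irrelevant when `y ∉ Im R`. -/
def pinv (R : E →L[ℝ] F) (y : F) : E :=
  if h : ∃ x : E, x ∈ (LinearMap.ker (R : E →ₗ[ℝ] F))ᗮ ∧ R x = y then h.choose else 0

/-- Finiteness of the trace of a positive operator: the diagonal sum along an orthonormal
(Hilbert) basis converges. Only used for positive operators, for which this
does not depend on the basis and means that the operator is trace class. -/
def HasFiniteTrace (S : E →L[ℝ] E) : Prop :=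
  ∃ (w : Set E) (b : HilbertBasis w ℝ E), Summable fun i => ⟪S (b i), b i⟫_ℝ

/-- `μ` is the centred Gaussian measure `N(0, S)`: the probability measure with characteristic
function `x ↦ exp (-⟨S x, x⟩ / 2)`. -/
def IsCentredGaussian [MeasurableSpace E] (S : E →L[ℝ] E) (μ : Measure E) : Prop :=
  IsProbabilityMeasure μ ∧
    ∀ x : E, charFun μ x = Complex.exp (-((⟪S x, x⟫_ℝ : ℝ) : ℂ) / 2)

open Classical in
/-- The centred Gaussian measure `N(0, S)`, for `S` positive and trace class (then it exists and is
unique on a separable space; the value is irrelevant otherwise). -/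
def gaussian [MeasurableSpace E] (S : E →L[ℝ] E) : Measure E :=
  if h : ∃ μ : Measure E, IsCentredGaussian S μ then h.choose else 0

/-- `w` is a version of the measurable linear functional `z ↦ ⟨h, S^{-1/2} z⟩` on the
probability space `(E, N(0, S))`. For `h = S^{1/2} u` it is `z ↦ ⟨u, z⟩`, and for
`h ∈ (ker S)ᗮ`, the closure of `Im S^{1/2}`, it is the limit in `L²(N(0, S))` of
`z ↦ ⟨uₙ, z⟩` for any `uₙ` with `S^{1/2} uₙ → h`. -/
def IsGaussianFunctional [MeasurableSpace E] (S : E →L[ℝ] E) (h : E) (w : E → ℝ) : Prop :=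
  MemLp w 2 (gaussian S) ∧
    ∃ u : ℕ → E, Tendsto (fun n => posSqrt S (u n)) atTop (𝓝 h) ∧
      Tendsto (fun n => eLpNorm (fun z => ⟪u n, z⟫_ℝ - w z) 2 (gaussian S)) atTop (𝓝 0)

open Classical in
/-- The functional `z ↦ ⟨h, S^{-1/2} z⟩` on `(E, N(0, S))`, for `h ∈ (ker S)ᗮ`
(determined up to null sets). -/
def gaussianFunctional [MeasurableSpace E] (S : E →L[ℝ] E) (h : E) : E → ℝ :=
  if hw : ∃ w : E → ℝ, IsGaussianFunctional S h w then hw.choose else 0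

end Operators

/-! ### Derivatives along a bounded operator `C : K → X` -/

section CDerivative

variable {X K Z : Type*} [NormedAddCommGroup X] [NormedSpace ℝ X]
  [NormedAddCommGroup Z] [NormedSpace ℝ Z]

/-- `L` is the `C`-Fréchet derivative of `φ` at `x`: it is the `C`-Gâteaux derivative, and the
limit of the difference quotients is uniform for `k` in the unit ball. -/
def HasCFrechetDerivAt [NormedAddCommGroup K] [NormedSpace ℝ K]
    (C : K →L[ℝ] X) (φ : X → Z) (L : K →L[ℝ] Z) (x : X) : Prop :=
  (∀ k : K, Tendsto (fun a : ℝ => a⁻¹ • (φ (x + a • C k) - φ x)) (𝓝[≠] 0) (𝓝 (L k))) ∧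
    TendstoUniformlyOn (fun (a : ℝ) (k : K) => a⁻¹ • (φ (x + a • C k) - φ x)) (fun k => L k)
      (𝓝[≠] 0) (Metric.closedBall 0 1)

/-- `C`-Fréchet differentiability at a point. -/
def CFrechetDifferentiableAt [NormedAddCommGroup K] [NormedSpace ℝ K]
    (C : K →L[ℝ] X) (φ : X → Z) (x : X) : Prop :=
  ∃ L : K →L[ℝ] Z, HasCFrechetDerivAt C φ L x

open Classical in
/-- The `C`-Fréchet derivative `∇^C φ(x) ∈ L(K, Z)` (zero if `φ` is not differentiable). -/
def cDeriv [NormedAddCommGroup K] [NormedSpace ℝ K]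
    (C : K →L[ℝ] X) (φ : X → Z) (x : X) : K →L[ℝ] Z :=
  if h : ∃ L : K →L[ℝ] Z, HasCFrechetDerivAt C φ L x then h.choose else 0

/-- The `C`-derivative of a real function as an element of the Hilbert space `K`
(Riesz identification). -/
def cGrad [NormedAddCommGroup K] [InnerProductSpace ℝ K] [CompleteSpace K]
    (C : K →L[ℝ] X) (φ : X → ℝ) (x : X) : K :=
  (InnerProductSpace.toDual ℝ K).symm (cDeriv C φ x)

end CDerivative

/-! ### Semigroups and the covariance operators `Q_t` -/

/-- A strongly continuous semigroup of bounded operators on `E`; only times `t ≥ 0` matter. -/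
structure C0Semigroup (E : Type*) [NormedAddCommGroup E] [NormedSpace ℝ E] where
  /-- the operators `e^{tA}` -/
  op : ℝ → E →L[ℝ] E
  op_zero : op 0 = ContinuousLinearMap.id ℝ E
  op_add : ∀ s t : ℝ, 0 ≤ s → 0 ≤ t → op (s + t) = op s ∘L op t
  continuousOn_op : ∀ x : E, ContinuousOn (fun t => op t x) (Ici 0)

namespace C0Semigroup

lemma exists_bound {E : Type*} [NormedAddCommGroup E] [NormedSpace ℝ E] [CompleteSpace E]
    (S : C0Semigroup E) (t : ℝ) : ∃ M : ℝ, 0 ≤ M ∧ ∀ s ∈ Icc 0 t, ‖S.op s‖ ≤ M := by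
  have key : ∃ M, ∀ s : Icc (0 : ℝ) t, ‖S.op s‖ ≤ M := by
    refine banach_steinhaus (g := fun s : Icc (0 : ℝ) t => S.op s) fun x => ?_
    have hc : ContinuousOn (fun s => S.op s x) (Icc 0 t) :=
      (S.continuousOn_op x).mono Icc_subset_Ici_self
    obtain ⟨M, hM⟩ := (isCompact_Icc.image_of_continuousOn hc).isBounded.exists_norm_le
    exact ⟨M, fun s => hM _ ⟨s, s.2, rfl⟩⟩
  obtain ⟨M, hM⟩ := key
  exact ⟨max M 0, le_max_right _ _, fun s hs => (hM ⟨s, hs⟩).trans (le_max_left _ _)⟩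

variable {H Ξ : Type*} [NormedAddCommGroup H] [InnerProductSpace ℝ H] [CompleteSpace H]
  [NormedAddCommGroup Ξ] [InnerProductSpace ℝ Ξ] [CompleteSpace Ξ]

/-- The integrand `e^{sA} G G* e^{sA*} x` of the covariance operator. -/
def covIntegrand (S : C0Semigroup H) (G : Ξ →L[ℝ] H) (x : H) (s : ℝ) : H :=
  S.op s (G ((ContinuousLinearMap.adjoint G) ((ContinuousLinearMap.adjoint (S.op s)) x)))

end C0Semigroup

/-- In a separable Hilbert space weak measurability implies strong measurability. -/
lemma aestronglyMeasurable_of_inner {H : Type*} [NormedAddCommGroup H] [InnerProductSpace ℝ H]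
    [CompleteSpace H] [SecondCountableTopology H] {α : Type*} [MeasurableSpace α] {μ : Measure α}
    {F : α → H} (hF : ∀ y : H, AEStronglyMeasurable (fun s => ⟪y, F s⟫_ℝ) μ) :
    AEStronglyMeasurable F μ := by
  obtain ⟨w, b, -⟩ := exists_hilbertBasis ℝ H
  have : Countable w := by
    have hd : ∀ i j : w, i ≠ j → 1 ≤ dist (b i) (b j) := by
      intro i j hij
      have h0 : ⟪b i, b j⟫_ℝ = 0 := b.orthonormal.2 hij
      have h1 := norm_sub_sq_real (b i) (b j)
      rw [h0, b.orthonormal.1 i, b.orthonormal.1 j] at h1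
      rw [dist_eq_norm]
      nlinarith [norm_nonneg (b i - b j)]
    have hu : (univ : Set w).Countable := by
      refine Set.PairwiseDisjoint.countable_of_isOpen
        (s := fun i : w => Metric.ball (b i) (1 / 2)) ?_ (fun _ _ => Metric.isOpen_ball)
        (fun i _ => ⟨b i, Metric.mem_ball_self (by norm_num)⟩)
      intro i _ j _ hij
      refine Metric.ball_disjoint_ball ?_
      have := hd i j hij
      norm_num
      exact this
    exact Set.countable_univ_iff.1 hu
  refine aestronglyMeasurable_of_tendsto_ae (u := (atTop : Filter (Finset w)))
    (f := fun A s => ∑ i ∈ A, ⟪b i, F s⟫_ℝ • b i) ?_ ?_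
  · intro A
    refine Finset.aestronglyMeasurable_fun_sum _ fun i _ => ?_
    exact (hF (b i)).smul_const _
  · refine Eventually.of_forall fun s => ?_
    have := b.hasSum_repr (F s)
    simp only [b.repr_apply_apply] at this
    exact this

namespace C0Semigroup

variable {H Ξ : Type*} [NormedAddCommGroup H] [InnerProductSpace ℝ H] [CompleteSpace H]
  [SecondCountableTopology H]
  [NormedAddCommGroup Ξ] [InnerProductSpace ℝ Ξ] [CompleteSpace Ξ]

lemma aestronglyMeasurable_adjoint (S : C0Semigroup H) (x : H) (t : ℝ) :
    AEStronglyMeasurable (fun s => (ContinuousLinearMap.adjoint (S.op s)) x)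
      (volume.restrict (Ioc 0 t)) := by
  refine aestronglyMeasurable_of_inner fun y => ?_
  simp only [ContinuousLinearMap.adjoint_inner_right]
  have hc : ContinuousOn (fun s => ⟪S.op s y, x⟫_ℝ) (Ioc 0 t) :=
    ((S.continuousOn_op y).mono fun s hs => hs.1.le).inner continuousOn_const
  exact hc.aestronglyMeasurable measurableSet_Ioc

lemma integrable_covIntegrand (S : C0Semigroup H) (G : Ξ →L[ℝ] H) (t : ℝ) :
    ∃ M : ℝ, 0 ≤ M ∧ ∀ x, Integrable (S.covIntegrand G x) (volume.restrict (Ioc 0 t)) ∧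
      ∀ s ∈ Ioc 0 t, ‖S.covIntegrand G x s‖ ≤ M * ‖x‖ := by
  obtain ⟨M, hM0, hM⟩ := S.exists_bound t
  refine ⟨M * (‖G‖ * (‖G‖ * M)), by positivity, fun x => ?_⟩
  have hb : ∀ s ∈ Ioc 0 t, ‖S.covIntegrand G x s‖ ≤ M * (‖G‖ * (‖G‖ * M)) * ‖x‖ := by
    intro s hs
    have hs' := hM s ⟨hs.1.le, hs.2⟩
    have h1 : ‖(ContinuousLinearMap.adjoint (S.op s)) x‖ ≤ M * ‖x‖ := by
      refine ContinuousLinearMap.le_of_opNorm_le _ ?_ _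
      simpa using hs'
    have h2 : ‖(ContinuousLinearMap.adjoint G) ((ContinuousLinearMap.adjoint (S.op s)) x)‖
        ≤ ‖G‖ * (M * ‖x‖) := by
      refine ContinuousLinearMap.le_of_opNorm_le_of_le _ ?_ h1
      simp
    have h3 := G.le_of_opNorm_le_of_le le_rfl h2
    have h4 := (S.op s).le_of_opNorm_le_of_le hs' h3
    calc _ ≤ _ := h4
      _ = _ := by ring
  refine ⟨?_, hb⟩
  refine Integrable.of_bound (C := M * (‖G‖ * (‖G‖ * M)) * ‖x‖) ?_ ?_
  · refine aestronglyMeasurable_of_inner fun y => ?_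
    have : (fun s => ⟪y, S.covIntegrand G x s⟫_ℝ) = fun s =>
        ⟪(ContinuousLinearMap.adjoint (S.op s)) y,
          G ((ContinuousLinearMap.adjoint G) ((ContinuousLinearMap.adjoint (S.op s)) x))⟫_ℝ := by
      funext s
      rw [ContinuousLinearMap.adjoint_inner_left]
      rfl
    rw [this]
    refine (S.aestronglyMeasurable_adjoint y t).inner ?_
    exact (G ∘L ContinuousLinearMap.adjoint G).continuous.comp_aestronglyMeasurable
      (S.aestronglyMeasurable_adjoint x t)
  · exact (ae_restrict_iff' measurableSet_Ioc).2 (Eventually.of_forall hb)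

/-- The covariance operator `Q_t x = ∫_0^t e^{sA} G G* e^{sA*} x ds`. -/
def cov (S : C0Semigroup H) (G : Ξ →L[ℝ] H) (t : ℝ) : H →L[ℝ] H :=
  LinearMap.mkContinuousOfExistsBound
    { toFun := fun x => ∫ s in Ioc 0 t, S.covIntegrand G x s
      map_add' := by
        intro x y
        obtain ⟨M, -, hM⟩ := S.integrable_covIntegrand G t
        rw [← integral_add (hM x).1 (hM y).1]
        simp [covIntegrand]
      map_smul' := by
        intro c x
        rw [RingHom.id_apply, ← integral_smul]
        simp [covIntegrand] }
    (by
      obtain ⟨M, hM0, hM⟩ := S.integrable_covIntegrand G t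
      refine ⟨M * (volume.restrict (Ioc 0 t)).real univ, fun x => ?_⟩
      have h := norm_integral_le_of_norm_le_const (μ := volume.restrict (Ioc 0 t))
        (f := S.covIntegrand G x) (C := M * ‖x‖)
        ((ae_restrict_iff' measurableSet_Ioc).2 (Eventually.of_forall (hM x).2))
      calc _ ≤ _ := h
        _ = _ := by ring)

end C0Semigroup

/-! ### The setting -/

/-- The space `L²(0, s; H)`. -/
abbrev L2Path (H : Type*) [NormedAddCommGroup H] (s : ℝ) : Type _ :=
  Lp H 2 ((volume : Measure ℝ).restrict (Ioc 0 s))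

instance instMeasurableSpaceL2Path (H : Type*) [NormedAddCommGroup H] (s : ℝ) :
    MeasurableSpace (L2Path H s) := borel _

instance instBorelSpaceL2Path (H : Type*) [NormedAddCommGroup H] (s : ℝ) :
    BorelSpace (L2Path H s) := ⟨rfl⟩

/-- The data and standing assumptions: the Ornstein–Uhlenbeck semigroup on `H`
(semigroup `e^{tA}`, noise operator `G`, trace class `Q_t`), the larger Banach space `Hb` with the
extended semigroup, the control operator `C : K → Hb`, the operator `P` on `H`, the extensions
`PE t : Hb → H` of `P e^{tA}` for `t > 0`, and their integrable singularity at `t = 0`. -/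
structure OUSetting (H Hb K Ξ : Type*)
    [NormedAddCommGroup H] [InnerProductSpace ℝ H] [CompleteSpace H] [SecondCountableTopology H]
    [NormedAddCommGroup Hb] [NormedSpace ℝ Hb]
    [NormedAddCommGroup K] [InnerProductSpace ℝ K]
    [NormedAddCommGroup Ξ] [InnerProductSpace ℝ Ξ] [CompleteSpace Ξ] where
  /-- the semigroup `e^{tA}` on `H` -/
  S : C0Semigroup H
  /-- the noise operator -/
  G : Ξ →L[ℝ] H
  finite_trace : ∀ t : ℝ, 0 ≤ t → HasFiniteTrace (S.cov G t)
  /-- the inclusion of `H` in the larger space -/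
  ι : H →L[ℝ] Hb
  ι_injective : Function.Injective ι
  ι_denseRange : DenseRange ι
  /-- the extension of the semigroup to the larger space -/
  Sb : C0Semigroup Hb
  Sb_ext : ∀ t : ℝ, 0 ≤ t → ∀ x : H, Sb.op t (ι x) = ι (S.op t x)
  /-- the control operator -/
  C : K →L[ℝ] Hb
  /-- the operator through which paths are observed -/
  P : H →L[ℝ] H
  /-- the extension of `P e^{tA}` to the larger space, for `t > 0` -/
  PE : ℝ → Hb →L[ℝ] H
  PE_ext : ∀ t : ℝ, 0 < t → ∀ x : H, PE t (ι x) = P (S.op t x)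
  PE_bound : ∀ T : ℝ, 0 < T → ∃ c : ℝ, 0 < c ∧ ∃ θ : ℝ, 0 ≤ θ ∧ θ < 1 / 2 ∧
    ∀ t ∈ Ioc 0 T, ∀ x : Hb, ‖PE t x‖ ≤ c / t ^ θ * ‖x‖

namespace OUSetting

variable {H Hb K Ξ : Type*}
  [NormedAddCommGroup H] [InnerProductSpace ℝ H] [CompleteSpace H] [SecondCountableTopology H]
  [NormedAddCommGroup Hb] [NormedSpace ℝ Hb]
  [NormedAddCommGroup K] [InnerProductSpace ℝ K]
  [NormedAddCommGroup Ξ] [InnerProductSpace ℝ Ξ] [CompleteSpace Ξ]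

/-! ### Paths -/

lemma PE_eq (D : OUSetting H Hb K Ξ) {s t : ℝ} (hs : 0 < s) (hst : s ≤ t) (x : Hb) :
    D.PE t x = D.PE s (D.Sb.op (t - s) x) := by
  have h0 : 0 ≤ t - s := sub_nonneg.2 hst
  refine congrFun (D.ι_denseRange.equalizer (D.PE t).continuous
    ((D.PE s).continuous.comp (D.Sb.op (t - s)).continuous) ?_) x
  funext y
  have := D.S.op_add s (t - s) hs.le h0
  rw [add_sub_cancel] at this
  simp only [Function.comp_apply]
  rw [D.Sb_ext _ h0, D.PE_ext s hs, D.PE_ext t (hs.trans_le hst), this]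
  rfl

lemma continuousOn_PE (D : OUSetting H Hb K Ξ) (x : Hb) :
    ContinuousOn (fun t => D.PE t x) (Ioi 0) := by
  intro t ht
  have ht : 0 < t := ht
  refine ContinuousAt.continuousWithinAt ?_
  have hc : ContinuousOn (fun r => D.PE (t / 2) (D.Sb.op (r - t / 2) x)) (Ici (t / 2)) := by
    refine (D.PE (t / 2)).continuous.comp_continuousOn ?_
    refine (D.Sb.continuousOn_op x).comp (by fun_prop) ?_
    intro r hr
    have hr' : t / 2 ≤ r := hr
    exact sub_nonneg.2 hr'
  have hc' : ContinuousOn (fun r => D.PE r x) (Ici (t / 2)) :=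
    hc.congr fun r hr => D.PE_eq (half_pos ht) hr x
  exact hc'.continuousAt (Ici_mem_nhds (half_lt_self ht))

/-- The path `y_x(t) = PE t x`, `t > 0`, in `C((0,∞); H)` with the topology of uniform convergence
on compact sets. -/
def path (D : OUSetting H Hb K Ξ) (x : Hb) : C(Ioi (0 : ℝ), H) where
  toFun t := D.PE t x
  continuous_toFun := (D.continuousOn_PE x).domRestrict

/-- The set of all the paths `y_x`, `x ∈ Hb`, with the subspace topology of `C((0,∞); H)`. -/
abbrev PathSpace (D : OUSetting H Hb K Ξ) : Type _ := range D.path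

/-- The path of `x` as an element of the path space. -/
def toPath (D : OUSetting H Hb K Ξ) (x : Hb) : D.PathSpace := ⟨D.path x, x, rfl⟩

/-- The path `y(· ∧ t)` stopped at time `t > 0`. -/
def stopped (D : OUSetting H Hb K Ξ) {T : ℝ} (t : Ioc (0 : ℝ) T) (y : D.PathSpace)
    (r : Ioi (0 : ℝ)) : H :=
  (y : C(Ioi (0 : ℝ), H)) ⟨min (r : ℝ) (t : ℝ), lt_min r.2 t.2.1⟩

lemma memLp_path (D : OUSetting H Hb K Ξ) (s : ℝ) :
    ∃ M : ℝ, 0 ≤ M ∧ ∀ x : Hb, MemLp (fun t => D.PE t x) 2 (volume.restrict (Ioc 0 s)) ∧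
      (eLpNorm (fun t => D.PE t x) 2 (volume.restrict (Ioc 0 s))).toReal ≤ M * ‖x‖ := by
  rcases le_or_gt s 0 with hs | hs
  · refine ⟨0, le_rfl, fun x => ?_⟩
    simp [Ioc_eq_empty_of_le hs]
  obtain ⟨c, hc, θ, hθ0, hθ, hb⟩ := D.PE_bound s hs
  have hmeas : ∀ x : Hb, AEStronglyMeasurable (fun t => D.PE t x) (volume.restrict (Ioc 0 s)) :=
    fun x => ((D.continuousOn_PE x).mono fun t ht => ht.1).aestronglyMeasurable measurableSet_Ioc
  have hm : MemLp (fun t : ℝ => c / t ^ θ) 2 (volume.restrict (Ioc 0 s)) := by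
    have hmeas' : AEStronglyMeasurable (fun t : ℝ => c / t ^ θ) (volume.restrict (Ioc 0 s)) := by
      have : Measurable (fun t : ℝ => c / t ^ θ) := by fun_prop
      exact this.aestronglyMeasurable
    refine (memLp_two_iff_integrable_sq hmeas').2 ?_
    have h1 : IntegrableOn (fun t : ℝ => c ^ 2 * t ^ (-(2 * θ))) (Ioc 0 s) := by
      refine Integrable.const_mul ?_ _
      have := intervalIntegral.intervalIntegrable_rpow' (a := 0) (b := s) (r := -(2 * θ))
        (by linarith)
      exact (intervalIntegrable_iff_integrableOn_Ioc_of_le hs.le).1 this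
    refine h1.congr_fun (fun t ht => ?_) measurableSet_Ioc
    simp only
    rw [div_pow, Real.rpow_neg ht.1.le, mul_comm 2 θ, Real.rpow_mul ht.1.le]
    norm_num [div_eq_mul_inv]
  refine ⟨(eLpNorm (fun t : ℝ => c / t ^ θ) 2 (volume.restrict (Ioc 0 s))).toReal,
    ENNReal.toReal_nonneg, fun x => ?_⟩
  have hmx : MemLp (fun t : ℝ => c / t ^ θ * ‖x‖) 2 (volume.restrict (Ioc 0 s)) :=
    hm.mul_const ‖x‖
  have hae : ∀ᵐ t ∂(volume.restrict (Ioc 0 s)), ‖D.PE t x‖ ≤ ‖c / t ^ θ * ‖x‖‖ := by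
    refine (ae_restrict_iff' measurableSet_Ioc).2 (Eventually.of_forall fun t ht => ?_)
    exact (hb t ht x).trans (le_abs_self _)
  refine ⟨hmx.of_le (hmeas x) hae, ?_⟩
  have h2 : eLpNorm (fun t => D.PE t x) 2 (volume.restrict (Ioc 0 s)) ≤
      ENNReal.ofReal ‖x‖ * eLpNorm (fun t : ℝ => c / t ^ θ) 2 (volume.restrict (Ioc 0 s)) := by
    refine (eLpNorm_mono_ae hae).trans ?_
    have : (fun t : ℝ => c / t ^ θ * ‖x‖) = ‖x‖ • fun t : ℝ => c / t ^ θ := by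
      funext t; simp [mul_comm]
    rw [this, eLpNorm_const_smul, ← ofReal_norm, norm_norm]
  have h3 := ENNReal.toReal_mono (ENNReal.mul_ne_top ENNReal.ofReal_ne_top hm.2.ne) h2
  rw [ENNReal.toReal_mul, ENNReal.toReal_ofReal (norm_nonneg x), mul_comm] at h3
  exact h3

/-- The lifting operator `Υ_s : Hb → L²(0, s; H)`, `Υ_s x = y_x` restricted to `(0, s]`. -/
def Upsilon (D : OUSetting H Hb K Ξ) (s : ℝ) : Hb →L[ℝ] L2Path H s :=
  LinearMap.mkContinuousOfExistsBound
    { toFun := fun x => MemLp.toLp (fun t => D.PE t x) ((D.memLp_path s).choose_spec.2 x).1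
      map_add' := by
        intro x y
        rw [← MemLp.toLp_add]
        congr 1
        funext t
        simp
      map_smul' := by
        intro c x
        rw [RingHom.id_apply, ← MemLp.toLp_const_smul]
        congr 1
        funext t
        simp }
    ⟨(D.memLp_path s).choose, fun x => by
      have h := ((D.memLp_path s).choose_spec.2 x).2
      simp only [LinearMap.coe_mk, AddHom.coe_mk]
      rw [Lp.norm_toLp]
      exact h⟩

/-! ### Classes of path dependent functions -/

section Classes

variable {Z : Type*} [NormedAddCommGroup Z] [NormedSpace ℝ Z]

/-- `fhat` represents `f` on `(0, T] × Hb` as an element of `S^P_η((0,T] × Hb; Z)`: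
`fhat` is Borel on `(0,T] × PathSpace`, `t^η fhat` is bounded, and `f(t, x) = fhat(t, y_x)`. -/
def IsPathRep (D : OUSetting H Hb K Ξ) (T η : ℝ) (f : ℝ → Hb → Z)
    (fhat : Ioc (0 : ℝ) T × D.PathSpace → Z) : Prop :=
  @Measurable _ _ (borel _) (borel Z) fhat ∧
    (∃ M : ℝ, ∀ p, ‖((p.1 : ℝ) ^ η) • fhat p‖ ≤ M) ∧
    ∀ (t : Ioc (0 : ℝ) T) (x : Hb), f t x = fhat (t, D.toPath x)

/-- `fhat` represents `f` progressively, i.e. in addition `fhat(t, y)` depends on `y` only through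
the stopped path `y(· ∧ t)`. -/
def IsProgRep (D : OUSetting H Hb K Ξ) (T η : ℝ) (f : ℝ → Hb → Z)
    (fhat : Ioc (0 : ℝ) T × D.PathSpace → Z) : Prop :=
  D.IsPathRep T η f fhat ∧
    ∀ (t : Ioc (0 : ℝ) T) (y y' : D.PathSpace),
      D.stopped t y = D.stopped t y' → fhat (t, y) = fhat (t, y')

/-- The class `S^P_{η,prog}((0,T] × Hb; Z)`. -/
def SProg (D : OUSetting H Hb K Ξ) (T η : ℝ) (f : ℝ → Hb → Z) : Prop :=
  ∃ fhat : Ioc (0 : ℝ) T × D.PathSpace → Z, D.IsProgRep T η f fhat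

open Classical in
/-- `fhat(s, ·)` as a function on `L²(0, s; H)`, for a progressive `fhat`: on the image of `Υ_s`
(the set of the paths restricted to `(0, s]`) it is the value of `fhat(s, ·)` on any path that
restricts to the given one; elsewhere (a null set for the measures used below) it is `0`. -/
def onL2 (D : OUSetting H Hb K Ξ) {T : ℝ} (fhat : Ioc (0 : ℝ) T × D.PathSpace → ℝ) (s : ℝ)
    (z : L2Path H s) : ℝ :=
  if h : s ∈ Ioc 0 T ∧ ∃ x : Hb, D.Upsilon s x = z then
    fhat (⟨s, h.1⟩, D.toPath h.2.choose) else 0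

end Classes

/-- The space `C^{0,1,C}_α([0,T] × Hb)`: `f` is continuous and bounded on `[0,T] × H` and on
`(0,T] × Hb`, `f(t, ·)` is `C`-Fréchet differentiable with continuous bounded derivative for
`t ∈ (0,T]`, and `t^α ∇^C f` is continuous and bounded on `(0,T] × Hb`. -/
def C01C (D : OUSetting H Hb K Ξ) (T α : ℝ) (f : ℝ → Hb → ℝ) : Prop :=
  ContinuousOn (fun p : ℝ × H => f p.1 (D.ι p.2)) (Icc 0 T ×ˢ univ) ∧
  (∃ M : ℝ, ∀ t ∈ Icc 0 T, ∀ x : H, |f t (D.ι x)| ≤ M) ∧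
  ContinuousOn (fun p : ℝ × Hb => f p.1 p.2) (Ioc 0 T ×ˢ univ) ∧
  (∃ M : ℝ, ∀ t ∈ Ioc 0 T, ∀ x : Hb, |f t x| ≤ M) ∧
  (∀ t ∈ Ioc 0 T, ∀ x : Hb, CFrechetDifferentiableAt D.C (f t) x) ∧
  (∀ t ∈ Ioc 0 T, Continuous (fun x => cDeriv D.C (f t) x) ∧
    ∃ M : ℝ, ∀ x : Hb, ‖cDeriv D.C (f t) x‖ ≤ M) ∧
  ContinuousOn (fun p : ℝ × Hb => p.1 ^ α • cDeriv D.C (f p.1) p.2) (Ioc 0 T ×ˢ univ) ∧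
  (∃ M : ℝ, ∀ t ∈ Ioc 0 T, ∀ x : Hb, ‖t ^ α • cDeriv D.C (f t) x‖ ≤ M)

/-- The space `S^{1,P}_{α,prog}((0,T] × Hb)`: progressive functions in `C^{0,1,C}_α` such that
`t^α ∇^C f` is a bounded progressive `K`-valued function. -/
def S1Prog [CompleteSpace K] (D : OUSetting H Hb K Ξ) (T α : ℝ) (f : ℝ → Hb → ℝ) : Prop :=
  D.SProg T 0 f ∧ D.C01C T α f ∧
    D.SProg T 0 (fun t x => t ^ α • cGrad D.C (f t) x)

/-! ### The Ornstein–Uhlenbeck semigroup and convolutions -/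

/-- The covariance operator `Q_t`. -/
def Q (D : OUSetting H Hb K Ξ) (t : ℝ) : H →L[ℝ] H := D.S.cov D.G t

/-- `R_t[φ](x) = ∫_H φ(z + e^{tA} x) N(0, Q_t)(dz)` for `φ : Hb → ℝ`, `x ∈ Hb`. -/
def R [MeasurableSpace H] (D : OUSetting H Hb K Ξ) (t : ℝ) (φ : Hb → ℝ) (x : Hb) : ℝ :=
  ∫ z, φ (D.ι z + D.Sb.op t x) ∂(gaussian (D.Q t))

/-- `g(t, x) = ∫_0^t R_{t-s}[f(s, ·)](x) ds`. -/
def conv [MeasurableSpace H] (D : OUSetting H Hb K Ξ) (f : ℝ → Hb → ℝ) (t : ℝ) (x : Hb) : ℝ :=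
  ∫ s in (0 : ℝ)..t, D.R (t - s) (f s) x

/-- Both integrals in `∫_0^t R_{t-s}[f(s, ·)](x) ds` converge absolutely. -/
def ConvWellDefined [MeasurableSpace H] (D : OUSetting H Hb K Ξ) (f : ℝ → Hb → ℝ) (t : ℝ)
    (x : Hb) : Prop :=
  (∀ s ∈ Ioo 0 t,
    Integrable (fun z => f s (D.ι z + D.Sb.op (t - s) x)) (gaussian (D.Q (t - s)))) ∧
  IntervalIntegrable (fun s => D.R (t - s) (f s) x) volume 0 t

/-! ### Lifted controllability -/

/-- The lifted covariance `Υ_s Q_τ Υ_s^*` on `L²(0, s; H)`; the adjoint is that of `Υ_s`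
restricted to `H`. -/
def liftedCov (D : OUSetting H Hb K Ξ) (s τ : ℝ) : L2Path H s →L[ℝ] L2Path H s :=
  (D.Upsilon s ∘L D.ι) ∘L D.Q τ ∘L ContinuousLinearMap.adjoint (D.Upsilon s ∘L D.ι)

/-- `Λ_s(τ) k = (Υ_s Q_τ Υ_s^*)^{-1/2} Υ_s e^{τA} C k`. -/
def liftedLambda (D : OUSetting H Hb K Ξ) (s τ : ℝ) (k : K) : L2Path H s :=
  pinv (posSqrt (D.liftedCov s τ)) (D.Upsilon s (D.Sb.op τ (D.C k)))

/-- The time-localized lifted controllability hypothesis on `(0, T₁]` with constant `κ` and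
exponent `γ`. -/
structure LiftedControllability (D : OUSetting H Hb K Ξ) (T₁ κ γ : ℝ) : Prop where
  T₁_pos : 0 < T₁
  κ_pos : 0 < κ
  γ_pos : 0 < γ
  γ_lt_one : γ < 1
  mem_range : ∀ s t : ℝ, 0 < s → s < t → t ≤ T₁ → ∀ k : K,
    D.Upsilon s (D.Sb.op (t - s) (D.C k)) ∈ range (posSqrt (D.liftedCov s (t - s)))
  bound : ∀ s t : ℝ, 0 < s → s < t → t ≤ T₁ → ∀ k : K,
    ‖D.liftedLambda s (t - s) k‖ ≤ κ * (t - s) ^ (-γ) * ‖k‖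

/-- The integrand over `L²(0, s; H)` in the formula for the `C`-derivative of the convolution:
`fhat(s, z₁ + Υ_s e^{(t-s)A} x) ⟨Λ_s(t-s) k, (Υ_s Q_{t-s} Υ_s^*)^{-1/2} z₁⟩`. -/
def derivIntegrand (D : OUSetting H Hb K Ξ) {T : ℝ}
    (fhat : Ioc (0 : ℝ) T × D.PathSpace → ℝ) (t : ℝ) (x : Hb) (k : K) (s : ℝ)
    (z : L2Path H s) : ℝ :=
  D.onL2 fhat s (z + D.Upsilon s (D.Sb.op (t - s) x)) *
    gaussianFunctional (D.liftedCov s (t - s)) (D.liftedLambda s (t - s) k) z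

/-! ### The non-lifted controllability condition and functions of `P x` -/

/-- The controllability hypothesis on `P` with horizon `T`, constant `κ` and exponent `γ`. -/
structure Controllability (D : OUSetting H Hb K Ξ) (T κ γ : ℝ) : Prop where
  κ_pos : 0 < κ
  γ_pos : 0 < γ
  γ_lt_one : γ < 1
  mem_range : ∀ t : ℝ, 0 < t → ∀ k : K, D.PE t (D.C k) ∈
    range (posSqrt (D.P ∘L D.Q t ∘L ContinuousLinearMap.adjoint D.P))
  bound : ∀ t ∈ Ioc 0 T, ∀ k : K,
    ‖pinv (posSqrt (D.P ∘L D.Q t ∘L ContinuousLinearMap.adjoint D.P)) (D.PE t (D.C k))‖ ≤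
      κ * max (t ^ (-γ)) 1 * ‖k‖

/-- `t^η f(t, x) = ψ(t, P x)` on `(0,T] × H` for a bounded continuous `ψ` on `(0,T] × Im P`
(with the topology inherited from `H`). -/
def IsCbP (D : OUSetting H Hb K Ξ) (T η : ℝ) (f : ℝ → H → ℝ) : Prop :=
  ∃ ψ : ℝ → H → ℝ,
    ContinuousOn (fun p : ℝ × H => ψ p.1 p.2) (Ioc 0 T ×ˢ range D.P) ∧
    (∃ M : ℝ, ∀ t ∈ Ioc 0 T, ∀ y ∈ range D.P, |ψ t y| ≤ M) ∧
    ∀ t ∈ Ioc 0 T, ∀ x : H, t ^ η * f t x = ψ t (D.P x)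

open Classical in
/-- The function `φbar` on `Im P` with `φ(x) = φbar(P x)`, for `φ` depending on `x` only through
`P x`. -/
def factorP (D : OUSetting H Hb K Ξ) (φ : H → ℝ) (y : H) : ℝ :=
  if h : ∃ x : H, D.P x = y then φ h.choose else 0

/-- `R_t[φ](x) = ∫_H φbar(P z + PE t x) N(0, Q_t)(dz)`, the value at `x ∈ Hb` of `R_t[φ]` for
a function `φ = φbar ∘ P` on `H`. -/
def RP [MeasurableSpace H] (D : OUSetting H Hb K Ξ) (t : ℝ) (φ : H → ℝ) (x : Hb) : ℝ :=
  ∫ z, D.factorP φ (D.P z + D.PE t x) ∂(gaussian (D.Q t))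

/-- `g(t, x) = ∫_0^t R_{t-s}[f(s, ·)](x) ds` when `f(s, ·)` depends on `x` through `P x`. -/
def convP [MeasurableSpace H] (D : OUSetting H Hb K Ξ) (f : ℝ → H → ℝ) (t : ℝ) (x : Hb) : ℝ :=
  ∫ s in (0 : ℝ)..t, D.RP (t - s) (f s) x

/-- Both integrals defining `convP` converge absolutely. -/
def ConvPWellDefined [MeasurableSpace H] (D : OUSetting H Hb K Ξ) (f : ℝ → H → ℝ) (t : ℝ)
    (x : Hb) : Prop :=
  (∀ s ∈ Ioo 0 t, Integrable (fun z => D.factorP (f s) (D.P z + D.PE (t - s) x))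
    (gaussian (D.Q (t - s)))) ∧
  IntervalIntegrable (fun s => D.RP (t - s) (f s) x) volume 0 t

end OUSetting

end

/-!
# Smoothing of convolutions by an Ornstein–Uhlenbeck semigroup observed through paths

**Smoothing at one delay.** Let `μ = N(0, Q_τ)`, let `B` be a bounded operator on `H` and let the
directions `h k` lie in the range of `(B Q_τ B*)^{1/2}`. By the Cameron–Martin formula, shifting
the image of `μ` under `B` by `h k` multiplies it by the density `exp (w - |λ|² / 2)`, where
`w = ⟨λ, (B Q_τ B*)^{-1/2} ·⟩` and `λ = (B Q_τ B*)^{-1/2} h k`. Hence, for every bounded Borel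
function `F`, the first order term of `k ↦ ∫ F(B z + h k) dμ` is `∫ F(B z) w(B z) dμ`, linear in `k`
and represented by an element of `L²(μ)` of norm `|λ|`, and the remainder is
`O(|λ|^{1 + δ})` for every `δ ∈ [0, 1]` (`exists_gaussianWeight`). For path dependent data
`B = Υ_s` and `h k = Υ_s e^{τA} C k`; for functions of `P x`, `B = P` and `h k = P e^{τA} C k`.

**Integration in time.** Both cases are instances of `OUSetting.PathKernel`, a kernel
`Φ(s, τ, y, z)` whose means over `z ~ N(0, Q_τ)` are smooth along `C` with constant `κ τ^{-γ}` and
which is at most `M s^{-η}`. The convolution is `∫ Φ(t - τ, τ, y, z) N(0, Q_τ)(dz) dτ`.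
Its `C`-derivative is obtained by integrating the first order terms: one chooses `δ > 0` with
`(1 + δ) γ < 1`, so that the remainder is integrable in `τ` and of order `1 + δ` in the increment
(`OUSetting.PathKernel.exists_abs_conv_sub_le`). The bounds are beta integrals.

**Measurability.** The laws `N(0, Q_τ)` form a Markov kernel in `τ` (`OUSetting.noise`), so the
convolution is Borel in time and path, and so is its derivative, a limit of difference quotients. A
progressive function at time `s` factors through `Υ_s`, and its extension by `0` to `L²(0, s; H)` is
Borel because the image of a separable Banach space under a bounded operator is a Borel set
(`ContinuousLinearMap.measurable_extend_of_factor`).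

**Continuity.** In the variable `τ` the noise law does not depend on `t`, and a weight observed on
`(0, T - τ]` serves all `t ≤ T` at once. The increments of the convolution and of its derivative
are therefore at most `∫ τ^{-β} b(τ) dτ`, with `b(τ)` the `L²(N(0, Q_τ))`-distance of the data and
`β = 0` or `β = γ`. This distance tends to `0` for almost every `τ` and is dominated by the moving
singularities `(t - τ)₊^{-η}`, whose integrals converge; a generalized dominated
convergence theorem applies (`tendsto_integral_of_le_singKernel`).
-/

noncomputable section

/-! ### Square roots and pseudoinverses -/

section PositiveSqrt

variable {E F : Type*} [NormedAddCommGroup E] [InnerProductSpace ℝ E] [CompleteSpace E]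
  [NormedAddCommGroup F] [InnerProductSpace ℝ F] [CompleteSpace F]

/-- The iteration `Bₙ₊₁ = (A + Bₙ²) / 2`, whose limit `B` satisfies `(1 - B)² = 1 - A`. -/
def sqrtIter {𝒜 : Type*} [Ring 𝒜] [Algebra ℝ 𝒜] (A : 𝒜) : ℕ → 𝒜
  | 0 => 0
  | n + 1 => (2⁻¹ : ℝ) • (A + sqrtIter A n * sqrtIter A n)

lemma sqrtIter_commute {𝒜 : Type*} [Ring 𝒜] [Algebra ℝ 𝒜] (A : 𝒜) (n : ℕ) :
    Commute A (sqrtIter A n) := by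
  induction n with
  | zero => exact Commute.zero_right _
  | succ n ih =>
    exact ((Commute.refl A).add_right (ih.mul_right ih)).smul_right _

lemma sqrtIter_commute_succ {𝒜 : Type*} [Ring 𝒜] [Algebra ℝ 𝒜] (A : 𝒜) (n : ℕ) :
    Commute (sqrtIter A n) (sqrtIter A (n + 1)) := by
  have h := (sqrtIter_commute A n).symm
  exact (h.add_right ((Commute.refl _).mul_right (Commute.refl _))).smul_right _

lemma sqrtIter_real_mem {a : ℝ} (ha0 : 0 ≤ a) (ha : a ≤ 1) (n : ℕ) :
    0 ≤ sqrtIter a n ∧ sqrtIter a n ≤ 1 ∧ sqrtIter a n ≤ sqrtIter a (n + 1) := by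
  induction n with
  | zero => simp [sqrtIter]; exact ha0
  | succ n ih =>
    obtain ⟨h0, h1, h2⟩ := ih
    have h3 : sqrtIter a (n + 1) = 2⁻¹ * (a + sqrtIter a n * sqrtIter a n) := rfl
    have h4 : sqrtIter a (n + 2) = 2⁻¹ * (a + sqrtIter a (n + 1) * sqrtIter a (n + 1)) := rfl
    refine ⟨h0.trans h2, ?_, ?_⟩
    · rw [h3]; nlinarith
    · have := mul_le_mul h2 h2 h0 (h0.trans h2)
      rw [h4]
      linarith

/-- The operator iteration is dominated by the scalar iteration started at `‖A‖`. -/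
lemma norm_sqrtIter_sub_le {𝒜 : Type*} [NormedRing 𝒜] [NormedAlgebra ℝ 𝒜] (A : 𝒜)
    (n : ℕ) :
    ‖sqrtIter A n‖ ≤ sqrtIter ‖A‖ n ∧
      ‖sqrtIter A (n + 1) - sqrtIter A n‖ ≤ sqrtIter ‖A‖ (n + 1) - sqrtIter ‖A‖ n := by
  have hn : ∀ n, ‖sqrtIter A n‖ ≤ sqrtIter ‖A‖ n := by
    intro n
    induction n with
    | zero => simp [sqrtIter]
    | succ n ih =>
      have h3 : sqrtIter ‖A‖ (n + 1) = 2⁻¹ * (‖A‖ + sqrtIter ‖A‖ n * sqrtIter ‖A‖ n) := rfl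
      rw [h3]
      change ‖(2⁻¹ : ℝ) • (A + sqrtIter A n * sqrtIter A n)‖ ≤ _
      rw [norm_smul]
      norm_num
      refine (norm_add_le _ _).trans ?_
      gcongr
      exact (norm_mul_le _ _).trans (mul_le_mul ih ih (norm_nonneg _) ((norm_nonneg _).trans ih))
  refine ⟨hn n, ?_⟩
  induction n with
  | zero =>
    have := hn 1
    simpa [sqrtIter] using this
  | succ n ih =>
    have hc := sqrtIter_commute_succ A n
    have e1 : sqrtIter A (n + 2) - sqrtIter A (n + 1) = (2⁻¹ : ℝ) •
        ((sqrtIter A (n + 1) + sqrtIter A n) * (sqrtIter A (n + 1) - sqrtIter A n)) := by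
      change (2⁻¹ : ℝ) • (A + sqrtIter A (n + 1) * sqrtIter A (n + 1)) -
        (2⁻¹ : ℝ) • (A + sqrtIter A n * sqrtIter A n) = _
      rw [← smul_sub]
      congr 1
      rw [add_mul, mul_sub, mul_sub, hc.eq]
      abel
    have e2 : sqrtIter ‖A‖ (n + 2) - sqrtIter ‖A‖ (n + 1) = 2⁻¹ *
        ((sqrtIter ‖A‖ (n + 1) + sqrtIter ‖A‖ n) *
          (sqrtIter ‖A‖ (n + 1) - sqrtIter ‖A‖ n)) := by
      change 2⁻¹ * (‖A‖ + sqrtIter ‖A‖ (n + 1) * sqrtIter ‖A‖ (n + 1)) -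
        2⁻¹ * (‖A‖ + sqrtIter ‖A‖ n * sqrtIter ‖A‖ n) = _
      ring
    rw [e1, e2, norm_smul]
    norm_num
    refine (norm_mul_le _ _).trans ?_
    have h1 := (norm_nonneg _).trans (hn n)
    have h2 := (norm_nonneg _).trans (hn (n + 1))
    refine mul_le_mul ((norm_add_le _ _).trans (add_le_add (hn _) (hn _))) ih (norm_nonneg _)
      (by positivity)

lemma exists_tendsto_sqrtIter {𝒜 : Type*} [NormedRing 𝒜] [NormedAlgebra ℝ 𝒜] [CompleteSpace 𝒜]
    (A : 𝒜) (hA : ‖A‖ ≤ 1) :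
    ∃ B : 𝒜, Tendsto (sqrtIter A) atTop (𝓝 B) ∧ (1 - B) * (1 - B) = 1 - A ∧ ‖B‖ ≤ 1 := by
  have hmem := sqrtIter_real_mem (norm_nonneg A) hA
  have hmono : Monotone (sqrtIter ‖A‖) := monotone_nat_of_le_succ fun n => (hmem n).2.2
  have hlim := tendsto_atTop_ciSup hmono ⟨1, by rintro _ ⟨n, rfl⟩; exact (hmem n).2.1⟩
  have hcau : CauchySeq (sqrtIter A) := by
    refine cauchySeq_of_summable_dist ?_
    refine Summable.of_nonneg_of_le (fun _ => dist_nonneg)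
      (f := fun n => sqrtIter ‖A‖ (n + 1) - sqrtIter ‖A‖ n) (fun n => ?_) ?_
    · rw [dist_comm, dist_eq_norm]
      exact (norm_sqrtIter_sub_le A n).2
    · refine summable_of_sum_range_le (c := 1) (fun n => sub_nonneg.2 (hmem n).2.2) fun n => ?_
      rw [Finset.sum_range_sub]
      have h0 : sqrtIter ‖A‖ 0 = 0 := rfl
      rw [h0, sub_zero]
      exact (hmem n).2.1
  obtain ⟨B, hB⟩ := cauchySeq_tendsto_of_complete hcau
  refine ⟨B, hB, ?_, le_of_tendsto hB.norm (Eventually.of_forall fun n =>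
    (norm_sqrtIter_sub_le A n).1.trans (hmem n).2.1)⟩
  have h1 : Tendsto (fun n => sqrtIter A (n + 1)) atTop
      (𝓝 ((2⁻¹ : ℝ) • (A + B * B))) := ((hB.mul hB).const_add A).const_smul _
  have h2 := tendsto_nhds_unique (hB.comp (tendsto_add_atTop_nat 1)) h1
  have h3 : A + B * B = (2 : ℝ) • B := by
    conv_rhs => rw [h2]
    rw [smul_smul]; norm_num
  have h4 : A = (2 : ℝ) • B - B * B := eq_sub_of_add_eq h3
  rw [h4, two_smul]
  noncomm_ring

/-- `0 ≤ S` and the Cauchy-Schwarz inequality for the form of `S` give `‖1 - S / ‖S‖‖ ≤ 1`. -/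
lemma norm_one_sub_smul_le {S : E →L[ℝ] E} (hS : S.IsPositive) (h0 : S ≠ 0) :
    ‖(1 : E →L[ℝ] E) - ‖S‖⁻¹ • S‖ ≤ 1 := by
  have hcpos : 0 < ‖S‖ := norm_pos_iff.2 h0
  generalize hc : ‖S‖ = c at hcpos
  have hsymS : ∀ x y, ⟪S x, y⟫_ℝ = ⟪x, S y⟫_ℝ := fun x y => hS.isSymmetric x y
  have hp : ∀ y, 0 ≤ ⟪S y, y⟫_ℝ := fun y => hS.inner_nonneg_left y
  refine ContinuousLinearMap.opNorm_le_bound _ zero_le_one fun x => ?_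
  have key : ‖S x‖ ^ 2 ≤ c * ⟪S x, x⟫_ℝ := by
    -- nonnegativity of the form at `c x - S x`
    have h1 := hp (c • x - S x)
    have h3 : ⟪S (S x), S x⟫_ℝ ≤ c * ‖S x‖ ^ 2 := by
      calc _ ≤ ‖S (S x)‖ * ‖S x‖ := real_inner_le_norm _ _
        _ ≤ (c * ‖S x‖) * ‖S x‖ := by gcongr; rw [← hc]; exact S.le_opNorm _
        _ = _ := by ring
    have h4 : ⟪S (c • x - S x), c • x - S x⟫_ℝ =
        c ^ 2 * ⟪S x, x⟫_ℝ - 2 * c * ‖S x‖ ^ 2 + ⟪S (S x), S x⟫_ℝ := by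
      rw [map_sub, map_smul]
      simp only [inner_sub_left, inner_sub_right, inner_smul_left, inner_smul_right,
        RCLike.conj_to_real]
      rw [hsymS (S x) x, real_inner_self_eq_norm_sq]
      ring
    rw [h4] at h1
    have h5 : c * ‖S x‖ ^ 2 ≤ c * (c * ⟪S x, x⟫_ℝ) := by nlinarith
    exact le_of_mul_le_mul_left h5 hcpos
  have h2 : ‖x - c⁻¹ • S x‖ ^ 2 ≤ ‖x‖ ^ 2 := by
    rw [norm_sub_sq_real, norm_smul, inner_smul_right, real_inner_comm, mul_pow,
      Real.norm_of_nonneg (inv_nonneg.2 hcpos.le)]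
    have h6 : c⁻¹ ^ 2 * ‖S x‖ ^ 2 ≤ c⁻¹ ^ 2 * (c * ⟪S x, x⟫_ℝ) := by gcongr
    have h7 : c⁻¹ ^ 2 * (c * ⟪S x, x⟫_ℝ) = c⁻¹ * ⟪S x, x⟫_ℝ := by field_simp
    have h8 : 0 ≤ c⁻¹ * ⟪S x, x⟫_ℝ := mul_nonneg (by positivity) (hp x)
    linarith
  rw [one_mul]
  exact le_of_sq_le_sq h2 (norm_nonneg _)

lemma isSelfAdjoint_real_smul {B : E →L[ℝ] E} (hB : IsSelfAdjoint B) (c : ℝ) :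
    IsSelfAdjoint (c • B) :=
  IsSelfAdjoint.smul (by simp [IsSelfAdjoint]) hB

lemma isSelfAdjoint_sqrtIter {A : E →L[ℝ] E} (hA : IsSelfAdjoint A) (n : ℕ) :
    IsSelfAdjoint (sqrtIter A n) := by
  induction n with
  | zero => exact IsSelfAdjoint.zero _
  | succ n ih =>
    refine isSelfAdjoint_real_smul (hA.add ?_) _
    rw [IsSelfAdjoint, star_mul, ih.star_eq]

lemma isPositive_one_sub {B : E →L[ℝ] E} (hB : IsSelfAdjoint B) (hn : ‖B‖ ≤ 1) :
    ((1 : E →L[ℝ] E) - B).IsPositive := by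
  rw [ContinuousLinearMap.isPositive_def']
  refine ⟨(IsSelfAdjoint.one _).sub hB, fun x => ?_⟩
  have h1 : ⟪B x, x⟫_ℝ ≤ ⟪x, x⟫_ℝ := by
    calc _ ≤ ‖B x‖ * ‖x‖ := real_inner_le_norm _ _
      _ ≤ (1 * ‖x‖) * ‖x‖ := by gcongr; exact B.le_of_opNorm_le hn x
      _ = _ := by rw [real_inner_self_eq_norm_sq]; ring
  have h2 : ((1 : E →L[ℝ] E) - B).reApplyInnerSelf x = ⟪x, x⟫_ℝ - ⟪B x, x⟫_ℝ := by
    rw [ContinuousLinearMap.reApplyInnerSelf_apply, ← inner_sub_left]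
    rfl
  rw [h2]
  exact sub_nonneg.2 h1

lemma exists_isPositive_sqrt {S : E →L[ℝ] E} (hS : S.IsPositive) :
    ∃ R : E →L[ℝ] E, R.IsPositive ∧ R ∘L R = S := by
  by_cases h0 : S = 0
  · exact ⟨0, ContinuousLinearMap.isPositive_zero, by simp [h0]⟩
  have hcpos : 0 < ‖S‖ := norm_pos_iff.2 h0
  have hAsa : IsSelfAdjoint ((1 : E →L[ℝ] E) - ‖S‖⁻¹ • S) :=
    (IsSelfAdjoint.one _).sub (isSelfAdjoint_real_smul hS.isSelfAdjoint _)
  obtain ⟨B, hB, hBeq, hBn⟩ := exists_tendsto_sqrtIter _ (norm_one_sub_smul_le hS h0)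
  have hBsa : IsSelfAdjoint B :=
    tendsto_nhds_unique ((continuous_star.tendsto B).comp hB)
      (hB.congr fun n => (isSelfAdjoint_sqrtIter hAsa n).star_eq.symm)
  refine ⟨√‖S‖ • (1 - B), (isPositive_one_sub hBsa hBn).smul_of_nonneg (Real.sqrt_nonneg _), ?_⟩
  have h1 : (√‖S‖ • (1 - B)) ∘L (√‖S‖ • (1 - B)) = ‖S‖ • ((1 - B) * (1 - B)) := by
    rw [ContinuousLinearMap.comp_smul, ContinuousLinearMap.smul_comp, smul_smul,
      Real.mul_self_sqrt hcpos.le]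
    rfl
  rw [h1, hBeq, sub_sub_cancel, smul_smul, mul_inv_cancel₀ hcpos.ne', one_smul]

lemma posSqrt_isPositive {S : E →L[ℝ] E} (hS : S.IsPositive) : (posSqrt S).IsPositive := by
  have h := exists_isPositive_sqrt hS
  rw [posSqrt, dif_pos h]
  exact h.choose_spec.1

lemma posSqrt_comp_self {S : E →L[ℝ] E} (hS : S.IsPositive) : posSqrt S ∘L posSqrt S = S := by
  have h := exists_isPositive_sqrt hS
  rw [posSqrt, dif_pos h]
  exact h.choose_spec.2

lemma posSqrt_symm {S : E →L[ℝ] E} (hS : S.IsPositive) (x y : E) :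
    ⟪posSqrt S x, y⟫_ℝ = ⟪x, posSqrt S y⟫_ℝ :=
  (posSqrt_isPositive hS).isSymmetric x y

lemma inner_eq_posSqrt {S : E →L[ℝ] E} (hS : S.IsPositive) (x y : E) :
    ⟪S x, y⟫_ℝ = ⟪posSqrt S x, posSqrt S y⟫_ℝ := by
  conv_lhs => rw [← posSqrt_comp_self hS]
  exact posSqrt_symm hS _ _

lemma inner_self_eq_norm_posSqrt {S : E →L[ℝ] E} (hS : S.IsPositive) (x : E) :
    ⟪S x, x⟫_ℝ = ‖posSqrt S x‖ ^ 2 := by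
  rw [inner_eq_posSqrt hS, real_inner_self_eq_norm_sq]

lemma pinv_spec (R : E →L[ℝ] F) {y : F} (hy : y ∈ range R) :
    pinv R y ∈ (LinearMap.ker (R : E →ₗ[ℝ] F))ᗮ ∧ R (pinv R y) = y := by
  have h : ∃ x : E, x ∈ (LinearMap.ker (R : E →ₗ[ℝ] F))ᗮ ∧ R x = y := by
    obtain ⟨x, rfl⟩ := hy
    set V := LinearMap.ker (R : E →ₗ[ℝ] F)
    have : IsClosed (V : Set E) := R.isClosed_ker
    have : CompleteSpace V := this.completeSpace_coe
    refine ⟨x - V.starProjection x, V.sub_starProjection_mem_orthogonal x, ?_⟩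
    have h1 : V.starProjection x ∈ V := V.starProjection_apply_mem x
    have h2 : R (V.starProjection x) = 0 := h1
    rw [map_sub, h2, sub_zero]
  rw [pinv, dif_pos h]
  exact h.choose_spec

lemma pinv_eq_of_mem (R : E →L[ℝ] F) {x : E} (hx : x ∈ (LinearMap.ker (R : E →ₗ[ℝ] F))ᗮ) :
    pinv R (R x) = x := by
  obtain ⟨h1, h2⟩ := pinv_spec R ⟨x, rfl⟩
  have h3 : pinv R (R x) - x ∈ LinearMap.ker (R : E →ₗ[ℝ] F) := by
    simp [LinearMap.mem_ker, h2]
  have h4 := Submodule.inner_right_of_mem_orthogonal h3 (Submodule.sub_mem _ h1 hx)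
  exact sub_eq_zero.1 (inner_self_eq_zero.1 h4)

lemma pinv_add (R : E →L[ℝ] F) {y y' : F} (hy : y ∈ range R) (hy' : y' ∈ range R) :
    pinv R (y + y') = pinv R y + pinv R y' := by
  have h := pinv_eq_of_mem R (Submodule.add_mem _ (pinv_spec R hy).1 (pinv_spec R hy').1)
  rwa [map_add, (pinv_spec R hy).2, (pinv_spec R hy').2] at h

lemma pinv_smul (R : E →L[ℝ] F) (c : ℝ) {y : F} (hy : y ∈ range R) :
    pinv R (c • y) = c • pinv R y := by
  have h := pinv_eq_of_mem R (Submodule.smul_mem _ c (pinv_spec R hy).1)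
  rwa [map_smul, (pinv_spec R hy).2] at h

/-- The range of a self-adjoint operator is dense in the orthogonal complement of its kernel. -/
lemma exists_tendsto_apply_of_mem_ker_orthogonal {R : E →L[ℝ] E} (hR : R.IsPositive) {h : E}
    (hh : h ∈ (LinearMap.ker (R : E →ₗ[ℝ] E))ᗮ) :
    ∃ u : ℕ → E, Tendsto (fun n => R (u n)) atTop (𝓝 h) := by
  have h1 : h ∈ closure (range R) := by
    have h2 : (LinearMap.range (R : E →ₗ[ℝ] E)).topologicalClosure =
        (LinearMap.ker (R : E →ₗ[ℝ] E))ᗮ := by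
      rw [← Submodule.orthogonal_orthogonal_eq_closure]
      congr 1
      ext x
      rw [Submodule.mem_orthogonal, LinearMap.mem_ker]
      constructor
      · intro hx
        have := hx (R (R x)) ⟨R x, rfl⟩
        have h3 : ⟪R (R x), x⟫_ℝ = ⟪R x, R x⟫_ℝ := hR.isSymmetric _ _
        rw [h3] at this
        exact inner_self_eq_zero.1 this
      · rintro hx _ ⟨y, rfl⟩
        have h3 : ⟪R y, x⟫_ℝ = ⟪y, R x⟫_ℝ := hR.isSymmetric _ _
        have h4 : R x = 0 := hx
        change ⟪R y, x⟫_ℝ = 0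
        rw [h3, h4, inner_zero_right]
    rw [← h2] at hh
    exact hh
  obtain ⟨v, hv, hlim⟩ := mem_closure_iff_seq_limit.1 h1
  choose u hu using hv
  exact ⟨u, by simpa only [hu] using hlim⟩

end PositiveSqrt

/-! ### Gaussian measures on Hilbert spaces -/

section GaussianMeasure

open ProbabilityTheory Complex

lemma tendsto_integral_cexp_of_tendsto_eLpNorm {Ω ι : Type*} [MeasurableSpace Ω] {μ : Measure Ω}
    [IsProbabilityMeasure μ] {l : Filter ι} {u : ι → Ω → ℝ} {w : Ω → ℝ}
    (hu : ∀ i, AEStronglyMeasurable (u i) μ) (hw : AEStronglyMeasurable w μ)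
    (h : Tendsto (fun i => eLpNorm (fun ω => u i ω - w ω) 2 μ) l (𝓝 0)) :
    Tendsto (fun i => ∫ ω, cexp (u i ω * I) ∂μ) l (𝓝 (∫ ω, cexp (w ω * I) ∂μ)) := by
  have hm : ∀ v : Ω → ℝ, AEStronglyMeasurable v μ →
      AEStronglyMeasurable (fun ω => cexp (v ω * I)) μ := fun v hv =>
    (by fun_prop : Continuous fun x : ℝ => cexp (x * I)).comp_aestronglyMeasurable hv
  refine tendsto_integral_of_L1 _ (hm w hw) (Eventually.of_forall fun i => ?_) ?_
  · refine Integrable.of_bound (hm _ (hu i)) 1 (Eventually.of_forall fun ω => ?_)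
    rw [norm_exp_ofReal_mul_I]
  · refine tendsto_of_tendsto_of_tendsto_of_le_of_le tendsto_const_nhds h (fun _ => zero_le)
      fun i => ?_
    calc ∫⁻ ω, ‖cexp (u i ω * I) - cexp (w ω * I)‖ₑ ∂μ ≤ ∫⁻ ω, ‖u i ω - w ω‖ₑ ∂μ := by
          refine lintegral_mono fun ω => ?_
          have h1 : cexp (u i ω * I) - cexp (w ω * I) =
              cexp (w ω * I) * (cexp (I * ((u i ω - w ω : ℝ) : ℂ)) - 1) := by
            rw [mul_sub, ← Complex.exp_add, mul_one]
            congr 2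
            push_cast; ring
          rw [h1, enorm_mul]
          have h2 : ‖cexp (w ω * I)‖ₑ = 1 := by
            rw [← ofReal_norm, norm_exp_ofReal_mul_I]; simp
          rw [h2, one_mul]
          exact Real.enorm_exp_I_mul_ofReal_sub_one_le
      _ = eLpNorm (fun ω => u i ω - w ω) 1 μ := by rw [eLpNorm_one_eq_lintegral_enorm]
      _ ≤ _ := eLpNorm_le_eLpNorm_of_exponent_le (by norm_num) ((hu i).sub hw)

variable {E F : Type*} [NormedAddCommGroup E] [InnerProductSpace ℝ E] [CompleteSpace E]
  [SecondCountableTopology E] [MeasurableSpace E] [BorelSpace E]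
  [NormedAddCommGroup F] [InnerProductSpace ℝ F] [CompleteSpace F]
  [SecondCountableTopology F] [MeasurableSpace F] [BorelSpace F]

/-- The Gaussian series `∑ ξᵢ aᵢ` with independent standard normal coefficients converges in
`L²` as soon as `∑ ‖aᵢ‖² < ∞`. -/
lemma summable_gaussian_series {w : Type*} (a : w → E) (ha : Summable fun i => ‖a i‖ ^ 2)
    (hv : ∀ i, MemLp (fun ω : w → ℝ => ω i • a i) 2
      (Measure.infinitePi fun _ : w => gaussianReal 0 1)) :
    Summable fun i => (hv i).toLp := by
  set P := Measure.infinitePi fun _ : w => gaussianReal 0 1 with hP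
  have hmp : ∀ i, MeasurePreserving (fun ω : w → ℝ => ω i) P (gaussianReal 0 1) := fun i =>
    measurePreserving_eval_infinitePi _ i
  have hint : ∀ i, ∫ ω, ω i ∂P = 0 := by
    intro i
    have h := integral_map (μ := P) (hmp i).measurable.aemeasurable
      (f := fun x : ℝ => x) (by fun_prop)
    rw [(hmp i).map_eq, integral_id_gaussianReal] at h
    exact h.symm
  have hsq : ∀ i, ∫ ω, ω i ^ 2 ∂P = 1 := by
    intro i
    have h := integral_map (μ := P) (hmp i).measurable.aemeasurable
      (f := fun x : ℝ => x ^ 2) (by fun_prop)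
    rw [(hmp i).map_eq] at h
    have h2 := variance_fun_id_gaussianReal (μ := 0) (v := 1)
    rw [variance_of_integral_eq_zero (by fun_prop) integral_id_gaussianReal] at h2
    rw [← h]; exact_mod_cast h2
  have hind : iIndepFun (fun i (ω : w → ℝ) => ω i) P :=
    iIndepFun_infinitePi (X := fun _ (x : ℝ) => x) (fun _ => measurable_id)
  have hinner : ∀ i j, ⟪(hv i).toLp, (hv j).toLp⟫_ℝ = (∫ ω, ω i * ω j ∂P) * ⟪a i, a j⟫_ℝ := by
    intro i j
    rw [L2.inner_def, ← integral_mul_const]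
    refine integral_congr_ae ?_
    filter_upwards [(hv i).coeFn_toLp, (hv j).coeFn_toLp] with ω h1 h2
    rw [h1, h2, inner_smul_left, inner_smul_right]
    simp; ring
  have hnorm : ∀ i, ‖(hv i).toLp‖ ^ 2 = ‖a i‖ ^ 2 := by
    intro i
    rw [← real_inner_self_eq_norm_sq, hinner, real_inner_self_eq_norm_sq]
    simp only [← pow_two, hsq, one_mul]
  have horth : OrthogonalFamily ℝ (fun i => ↥(Submodule.span ℝ {(hv i).toLp}))
      fun i => (Submodule.span ℝ {(hv i).toLp}).subtypeₗᵢ := by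
    refine OrthogonalFamily.of_pairwise fun i j hij => ?_
    change Submodule.span ℝ {(hv i).toLp} ⟂ Submodule.span ℝ {(hv j).toLp}
    rw [Submodule.isOrtho_span]
    rintro _ rfl _ rfl
    rw [hinner]
    have h1 := (hind.indepFun hij).integral_fun_mul_eq_mul_integral
      (measurable_pi_apply i).aestronglyMeasurable (measurable_pi_apply j).aestronglyMeasurable
    rw [h1, hint, zero_mul, zero_mul]
  refine (horth.summable_iff_norm_sq_summable
    fun i => ⟨(hv i).toLp, Submodule.mem_span_singleton_self _⟩).2 ?_
  simpa only [Submodule.coe_norm, hnorm] using ha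

/-- A positive operator of finite trace is the covariance of a Gaussian measure: the law of the
series `∑ ξᵢ S^{1/2} bᵢ` for a Hilbert basis `b`. -/
lemma exists_isCentredGaussian {S : E →L[ℝ] E} (hS : S.IsPositive) (hT : HasFiniteTrace S) :
    ∃ μ : Measure E, IsCentredGaussian S μ := by
  obtain ⟨w, b, hb⟩ := hT
  set P := Measure.infinitePi fun _ : w => gaussianReal 0 1 with hP
  set a : w → E := fun i => posSqrt S (b i) with ha
  have hmp : ∀ i, MeasurePreserving (fun ω : w → ℝ => ω i) P (gaussianReal 0 1) := fun i =>
    measurePreserving_eval_infinitePi _ i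
  have hv : ∀ i, MemLp (fun ω : w → ℝ => ω i • a i) 2 P := by
    intro i
    have h1 : MemLp (fun x : ℝ => x) 2 (gaussianReal 0 1) := memLp_id_gaussianReal' 2 (by norm_num)
    have h2 : MemLp (fun ω : w → ℝ => ω i) 2 P := h1.comp_measurePreserving (hmp i)
    exact (memLp_top_const (a i)).smul h2
  have hsum := summable_gaussian_series a (by simpa only [ha, inner_self_eq_norm_posSqrt hS] using hb)
    hv
  set X := ∑' i, (hv i).toLp with hX
  have hXm : AEMeasurable (X : (w → ℝ) → E) P := (Lp.aestronglyMeasurable X).aemeasurable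
  refine ⟨P.map X, Measure.isProbabilityMeasure_map hXm, fun x => ?_⟩
  have hlim : Tendsto (fun A : Finset w => eLpNorm
      (fun ω => ⟪∑ i ∈ A, ω i • a i, x⟫_ℝ - ⟪X ω, x⟫_ℝ) 2 P) atTop (𝓝 0) := by
    have h1 := (Lp.tendsto_Lp_iff_tendsto_eLpNorm' _ _).1 hsum.hasSum
    have h2 : Tendsto (fun A : Finset w => ‖x‖ₑ * eLpNorm
        (⇑(∑ i ∈ A, (hv i).toLp) - ⇑X) 2 P) atTop (𝓝 0) := by
      simpa using ENNReal.Tendsto.const_mul h1 (Or.inr (by simp : ‖x‖ₑ ≠ ⊤))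
    refine tendsto_of_tendsto_of_tendsto_of_le_of_le tendsto_const_nhds h2 (fun _ => zero_le)
      fun A => ?_
    have h3 : ∀ᵐ ω ∂P, ∀ i ∈ A, ((hv i).toLp : (w → ℝ) → E) ω = ω i • a i :=
      (ae_ball_iff A.countable_toSet).2 fun i _ => (hv i).coeFn_toLp
    have h4 : ‖x‖ₑ = ‖(‖x‖ : ℝ)‖ₑ := by simp
    rw [h4, ← eLpNorm_const_smul]
    refine eLpNorm_mono_ae ?_
    filter_upwards [h3, Lp.coeFn_fun_finsetSum A fun i => (hv i).toLp] with ω h5 h6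
    rw [← inner_sub_left, Pi.smul_apply, Pi.sub_apply, h6, Finset.sum_congr rfl h5, norm_smul,
      norm_norm, mul_comm]
    exact norm_inner_le_norm _ _
  have hm1 : ∀ i, Measurable fun ω : w → ℝ => ω i := fun i => measurable_pi_apply i
  have hm2 : ∀ i, Measurable fun ω : w → ℝ => ω i • a i := fun i => (hm1 i).smul_const _
  have hm3 : ∀ A : Finset w, Measurable fun ω : w → ℝ => ∑ i ∈ A, ω i • a i := fun A =>
    Finset.measurable_fun_sum _ fun i _ => hm2 i
  have hind : iIndepFun (fun i (ω : w → ℝ) => ω i • a i) P :=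
    iIndepFun_infinitePi (X := fun i (x : ℝ) => x • a i) (fun i => by fun_prop)
  have hchar : ∀ A : Finset w, ∫ ω, cexp ((⟪∑ i ∈ A, ω i • a i, x⟫_ℝ : ℝ) * I) ∂P =
      cexp (-((∑ i ∈ A, ⟪a i, x⟫_ℝ ^ 2 : ℝ) : ℂ) / 2) := by
    intro A
    have h1 := congrFun (iIndepFun.charFun_map_fun_finsetSum_eq_prod (s := A)
      (X := fun i (ω : w → ℝ) => ω i • a i) (P := P) (fun i _ => (hm2 i).aemeasurable)
      (hind.restrict _)) x
    rw [charFun_apply, integral_map (hm3 A).aemeasurable (by fun_prop)] at h1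
    rw [h1, Finset.prod_apply]
    have h2 : ∀ i, charFun (P.map fun ω : w → ℝ => ω i • a i) x =
        cexp (-((⟪a i, x⟫_ℝ ^ 2 : ℝ) : ℂ) / 2) := by
      intro i
      rw [charFun_apply, integral_map (hm2 i).aemeasurable (by fun_prop)]
      have h3 := charFun_gaussianReal (μ := 0) (v := 1) ⟪a i, x⟫_ℝ
      rw [charFun_apply, ← (hmp i).map_eq, integral_map (hm1 i).aemeasurable (by fun_prop)] at h3
      simp only [inner_smul_left, RCLike.conj_to_real]
      simp only [RCLike.inner_apply, RCLike.conj_to_real] at h3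
      have h4 : ∀ ω : w → ℝ, ω i * ⟪a i, x⟫_ℝ = ⟪a i, x⟫_ℝ * ω i := fun ω => mul_comm _ _
      simp only [h4]
      rw [h3]
      congr 1
      push_cast; ring
    simp only [h2]
    rw [← Complex.exp_sum]
    congr 1
    push_cast
    rw [← Finset.sum_div, Finset.sum_neg_distrib]
  have hl1 := tendsto_integral_cexp_of_tendsto_eLpNorm
    (fun A => (hm3 A).aestronglyMeasurable.inner aestronglyMeasurable_const)
    ((Lp.aestronglyMeasurable X).inner aestronglyMeasurable_const) hlim
  have hl2 : Tendsto (fun A : Finset w => cexp (-((∑ i ∈ A, ⟪a i, x⟫_ℝ ^ 2 : ℝ) : ℂ) / 2)) atTop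
      (𝓝 (cexp (-((⟪S x, x⟫_ℝ : ℝ) : ℂ) / 2))) := by
    have h1 : HasSum (fun i => ⟪a i, x⟫_ℝ ^ 2) ⟪S x, x⟫_ℝ := by
      rw [inner_eq_posSqrt hS]
      refine (b.hasSum_inner_mul_inner (posSqrt S x) (posSqrt S x)).congr_fun fun i => ?_
      rw [ha, posSqrt_symm hS, real_inner_comm, pow_two, real_inner_comm (b i)]
    refine (by fun_prop : Continuous fun y : ℝ => cexp (-(y : ℂ) / 2)).tendsto _ |>.comp h1
  rw [charFun_apply, integral_map hXm (by fun_prop)]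
  refine tendsto_nhds_unique hl1 (hl2.congr fun A => (hchar A).symm)

lemma gaussian_spec {S : E →L[ℝ] E} (h : ∃ μ : Measure E, IsCentredGaussian S μ) :
    IsCentredGaussian S (gaussian S) := by
  rw [gaussian, dif_pos h]
  exact h.choose_spec

lemma IsCentredGaussian.eq_gaussian {S : E →L[ℝ] E} {μ : Measure E} (h : IsCentredGaussian S μ) :
    gaussian S = μ := by
  have h1 := gaussian_spec ⟨μ, h⟩
  have := h1.1
  have := h.1
  refine Measure.ext_of_charFun ?_
  ext x
  rw [h1.2, h.2]

lemma IsCentredGaussian.map {S : E →L[ℝ] E} {μ : Measure E} (h : IsCentredGaussian S μ)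
    (B : E →L[ℝ] F) :
    IsCentredGaussian (B ∘L S ∘L ContinuousLinearMap.adjoint B) (μ.map B) := by
  have := h.1
  refine ⟨Measure.isProbabilityMeasure_map (by fun_prop), fun x => ?_⟩
  rw [charFun_apply, integral_map (by fun_prop) (by fun_prop)]
  have h1 := h.2 (ContinuousLinearMap.adjoint B x)
  rw [charFun_apply] at h1
  simp only [ContinuousLinearMap.adjoint_inner_right] at h1
  rw [h1]
  rfl

lemma IsCentredGaussian.add {S T : E →L[ℝ] E} {μ ν : Measure E} (h : IsCentredGaussian S μ)
    (h' : IsCentredGaussian T ν) : IsCentredGaussian (S + T) (μ.conv ν) := by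
  have := h.1
  have := h'.1
  refine ⟨inferInstance, fun x => ?_⟩
  rw [charFun_conv, h.2, h'.2, ← Complex.exp_add]
  congr 1
  simp only [_root_.add_apply, inner_add_left]
  push_cast; ring

/-- The functional `⟨u, ·⟩` is a centred normal variable of variance `⟨S u, u⟩`. -/
lemma IsCentredGaussian.map_inner {S : E →L[ℝ] E} {μ : Measure E} (hS : S.IsPositive)
    (h : IsCentredGaussian S μ) (u : E) :
    μ.map (fun z => ⟪u, z⟫_ℝ) = gaussianReal 0 (‖posSqrt S u‖₊ ^ 2) := by
  have := h.1
  have : IsProbabilityMeasure (μ.map (fun z => ⟪u, z⟫_ℝ)) :=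
    Measure.isProbabilityMeasure_map (by fun_prop)
  refine Measure.ext_of_charFun ?_
  ext t
  rw [charFun_gaussianReal, charFun_apply, integral_map (by fun_prop) (by fun_prop)]
  have h1 := h.2 (t • u)
  rw [charFun_apply, inner_self_eq_norm_posSqrt hS] at h1
  have h2 : ∀ z, ⟪⟪u, z⟫_ℝ, t⟫_ℝ = ⟪z, t • u⟫_ℝ := by
    intro z
    rw [inner_smul_right, real_inner_comm z]
    simp
  simp only [h2, h1]
  rw [map_smul, norm_smul]
  congr 1
  push_cast
  rw [mul_pow, ← Complex.ofReal_pow, Real.norm_eq_abs, sq_abs]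
  push_cast
  ring

lemma integral_sq_gaussianReal (v : NNReal) : ∫ x, x ^ 2 ∂(gaussianReal 0 v) = v := by
  have h2 := variance_fun_id_gaussianReal (μ := 0) (v := v)
  rwa [variance_of_integral_eq_zero (by fun_prop) integral_id_gaussianReal] at h2

lemma IsCentredGaussian.memLp_inner {S : E →L[ℝ] E} {μ : Measure E} (hS : S.IsPositive)
    (h : IsCentredGaussian S μ) (u : E) : MemLp (fun z => ⟪u, z⟫_ℝ) 2 μ := by
  have h1 : MemLp id 2 (μ.map fun z => ⟪u, z⟫_ℝ) := by
    rw [h.map_inner hS]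
    exact memLp_id_gaussianReal' 2 (by norm_num)
  exact (memLp_map_measure_iff (f := fun z => ⟪u, z⟫_ℝ) (by fun_prop) (by fun_prop)).1 h1

lemma IsCentredGaussian.integral_inner_sq {S : E →L[ℝ] E} {μ : Measure E} (hS : S.IsPositive)
    (h : IsCentredGaussian S μ) (u : E) : ∫ z, ⟪u, z⟫_ℝ ^ 2 ∂μ = ‖posSqrt S u‖ ^ 2 := by
  have h1 := integral_map (μ := μ) (φ := fun z => ⟪u, z⟫_ℝ) (by fun_prop)
    (f := fun x : ℝ => x ^ 2) (by fun_prop)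
  rw [← h1, h.map_inner hS, integral_sq_gaussianReal]
  simp

lemma IsCentredGaussian.eLpNorm_inner {S : E →L[ℝ] E} {μ : Measure E} (hS : S.IsPositive)
    (h : IsCentredGaussian S μ) (u : E) :
    eLpNorm (fun z => ⟪u, z⟫_ℝ) 2 μ = ‖posSqrt S u‖ₑ := by
  have hm := h.memLp_inner hS u
  rw [hm.eLpNorm_eq_integral_rpow_norm (by norm_num) (by norm_num)]
  have h1 := h.integral_inner_sq hS u
  simp only [ENNReal.toReal_ofNat, Real.rpow_two, Real.norm_eq_abs, sq_abs, h1]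
  rw [← one_div, ← Real.sqrt_eq_rpow, Real.sqrt_sq (norm_nonneg _), ofReal_norm]

/-- The mean square of the norm under `N(0, S)` is the trace of `S`. -/
lemma IsCentredGaussian.lintegral_norm_sq {S : E →L[ℝ] E} {μ : Measure E} (hS : S.IsPositive)
    (h : IsCentredGaussian S μ) {w : Set E} [Countable w] (b : HilbertBasis w ℝ E) :
    ∫⁻ z, ENNReal.ofReal (‖z‖ ^ 2) ∂μ = ∑' i, ENNReal.ofReal ⟪S (b i), b i⟫_ℝ := by
  have h1 : ∀ z : E, ENNReal.ofReal (‖z‖ ^ 2) = ∑' i, ENNReal.ofReal (⟪b i, z⟫_ℝ ^ 2) := by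
    intro z
    have h2 := b.hasSum_inner_mul_inner z z
    rw [real_inner_self_eq_norm_sq] at h2
    rw [← h2.tsum_eq, ENNReal.ofReal_tsum_of_nonneg _ h2.summable]
    · refine tsum_congr fun i => ?_
      rw [real_inner_comm z, pow_two]
    · intro i
      rw [real_inner_comm z]
      exact mul_self_nonneg _
  simp only [h1]
  rw [lintegral_tsum fun i => by fun_prop]
  refine tsum_congr fun i => ?_
  rw [← ofReal_integral_eq_lintegral_ofReal, h.integral_inner_sq hS, inner_self_eq_norm_posSqrt hS]
  · exact (h.memLp_inner hS (b i)).integrable_sq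
  · exact Eventually.of_forall fun z => sq_nonneg _

end GaussianMeasure

/-! ### Measurable linear functionals of a Gaussian measure -/

section GaussianFunctional

open ProbabilityTheory Complex

variable {E : Type*} [NormedAddCommGroup E] [InnerProductSpace ℝ E] [CompleteSpace E]
  [SecondCountableTopology E] [MeasurableSpace E] [BorelSpace E]
  {S : E →L[ℝ] E}

lemma exists_isGaussianFunctional (hS : S.IsPositive) (hν : IsCentredGaussian S (gaussian S))
    {h : E} (hh : h ∈ (LinearMap.ker (posSqrt S : E →ₗ[ℝ] E))ᗮ) :
    ∃ w : E → ℝ, IsGaussianFunctional S h w := by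
  obtain ⟨u, hu⟩ := exists_tendsto_apply_of_mem_ker_orthogonal (posSqrt_isPositive hS) hh
  have hm := fun n => hν.memLp_inner hS (u n)
  have hcau : CauchySeq fun n => (hm n).toLp := by
    rw [Metric.cauchySeq_iff]
    have h1 := Metric.cauchySeq_iff.1 hu.cauchySeq
    intro ε hε
    obtain ⟨N, hN⟩ := h1 ε hε
    refine ⟨N, fun m hm' n hn => ?_⟩
    have h2 := hN m hm' n hn
    rw [dist_eq_norm, ← MemLp.toLp_sub, Lp.norm_toLp]
    have h3 : ((fun z => ⟪u m, z⟫_ℝ) - fun z => ⟪u n, z⟫_ℝ) = fun z => ⟪u m - u n, z⟫_ℝ := by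
      funext z; simp [inner_sub_left]
    rw [h3, hν.eLpNorm_inner hS, map_sub, toReal_enorm, ← dist_eq_norm]
    exact h2
  obtain ⟨W, hW⟩ := cauchySeq_tendsto_of_complete hcau
  refine ⟨W, Lp.memLp W, u, hu, ?_⟩
  rw [Lp.tendsto_Lp_iff_tendsto_eLpNorm'] at hW
  refine hW.congr fun n => eLpNorm_congr_ae ?_
  filter_upwards [(hm n).coeFn_toLp] with z hz
  rw [Pi.sub_apply, hz]

lemma isGaussianFunctional_gaussianFunctional (hS : S.IsPositive)
    (hν : IsCentredGaussian S (gaussian S)) {h : E}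
    (hh : h ∈ (LinearMap.ker (posSqrt S : E →ₗ[ℝ] E))ᗮ) :
    IsGaussianFunctional S h (gaussianFunctional S h) := by
  have hw := exists_isGaussianFunctional hS hν hh
  rw [gaussianFunctional, dif_pos hw]
  exact hw.choose_spec

lemma IsGaussianFunctional.add {h h' : E} {w w' : E → ℝ} (hw : IsGaussianFunctional S h w)
    (hw' : IsGaussianFunctional S h' w') : IsGaussianFunctional S (h + h') (w + w') := by
  obtain ⟨hm, u, hu, hl⟩ := hw
  obtain ⟨hm', u', hu', hl'⟩ := hw'
  refine ⟨hm.add hm', fun n => u n + u' n, ?_, ?_⟩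
  · simpa only [map_add] using hu.add hu'
  · have h0 := hl.add hl'
    rw [add_zero] at h0
    refine tendsto_of_tendsto_of_tendsto_of_le_of_le tendsto_const_nhds h0
      (fun _ => zero_le) fun n => ?_
    refine le_trans (le_of_eq ?_) (eLpNorm_add_le (p := 2)
      ((by fun_prop : AEStronglyMeasurable (fun z => ⟪u n, z⟫_ℝ) (gaussian S)).sub hm.1)
      ((by fun_prop : AEStronglyMeasurable (fun z => ⟪u' n, z⟫_ℝ) (gaussian S)).sub hm'.1)
      (by norm_num))
    congr 1
    funext z
    simp only [Pi.add_apply, inner_add_left]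
    ring

lemma IsGaussianFunctional.smul {h : E} {w : E → ℝ} (hw : IsGaussianFunctional S h w) (c : ℝ) :
    IsGaussianFunctional S (c • h) (c • w) := by
  obtain ⟨hm, u, hu, hl⟩ := hw
  refine ⟨hm.const_smul c, fun n => c • u n, ?_, ?_⟩
  · simpa only [map_smul] using hu.const_smul c
  · have h0 : Tendsto (fun n => ‖c‖ₑ * eLpNorm (fun z => ⟪u n, z⟫_ℝ - w z) 2 (gaussian S)) atTop
        (𝓝 0) := by
      simpa using ENNReal.Tendsto.const_mul hl (Or.inr (by simp : ‖c‖ₑ ≠ ⊤))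
    refine h0.congr fun n => ?_
    rw [← eLpNorm_const_smul]
    congr 1
    funext z
    simp only [Pi.smul_apply, inner_smul_left, smul_eq_mul, RCLike.conj_to_real]
    ring

/-- The joint law of `⟨x, ·⟩` and of the functional of `h` is Gaussian, with the covariance read off
from the vectors `S^{1/2} x` and `h`. -/
lemma IsGaussianFunctional.integral_cexp (hS : S.IsPositive)
    (hν : IsCentredGaussian S (gaussian S)) {h : E} {w : E → ℝ}
    (hw : IsGaussianFunctional S h w) (x : E) (t : ℝ) :
    ∫ z, cexp ((⟪x, z⟫_ℝ + t * w z : ℝ) * I) ∂(gaussian S) =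
      cexp (-((‖posSqrt S x + t • h‖ ^ 2 : ℝ) : ℂ) / 2) := by
  obtain ⟨hm, u, hu, hl⟩ := hw
  have := hν.1
  have h1 : Tendsto (fun n => eLpNorm (fun z => ⟪x + t • u n, z⟫_ℝ - (⟪x, z⟫_ℝ + t * w z)) 2
      (gaussian S)) atTop (𝓝 0) := by
    have h0 : Tendsto (fun n => ‖t‖ₑ * eLpNorm (fun z => ⟪u n, z⟫_ℝ - w z) 2 (gaussian S)) atTop
        (𝓝 0) := by
      simpa using ENNReal.Tendsto.const_mul hl (Or.inr (by simp : ‖t‖ₑ ≠ ⊤))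
    refine h0.congr fun n => ?_
    rw [← eLpNorm_const_smul]
    congr 1
    funext z
    simp only [Pi.smul_apply, inner_add_left, inner_smul_left, smul_eq_mul, RCLike.conj_to_real]
    ring
  have hwm : AEStronglyMeasurable (fun z => ⟪x, z⟫_ℝ + t * w z) (gaussian S) :=
    (by fun_prop : AEStronglyMeasurable (fun z => ⟪x, z⟫_ℝ) (gaussian S)).add (hm.1.const_mul t)
  have h2 := tendsto_integral_cexp_of_tendsto_eLpNorm (fun n => by fun_prop) hwm h1
  have h3 : ∀ n, ∫ z, cexp ((⟪x + t • u n, z⟫_ℝ : ℝ) * I) ∂(gaussian S) =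
      cexp (-((‖posSqrt S (x + t • u n)‖ ^ 2 : ℝ) : ℂ) / 2) := by
    intro n
    have h4 := hν.2 (x + t • u n)
    rw [charFun_apply, inner_self_eq_norm_posSqrt hS] at h4
    rw [← h4]
    congr 1
    funext z
    rw [real_inner_comm]
  simp only [h3, map_add, map_smul] at h2
  refine tendsto_nhds_unique h2 ?_
  have h5 : Tendsto (fun n => ‖posSqrt S x + t • posSqrt S (u n)‖ ^ 2) atTop
      (𝓝 (‖posSqrt S x + t • h‖ ^ 2)) := ((hu.const_smul t).const_add _).norm.pow 2
  exact ((by fun_prop : Continuous fun y : ℝ => cexp (-(y : ℂ) / 2)).tendsto _).comp h5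

/-- The functional of `h` is a centred normal variable of variance `‖h‖²`. -/
lemma IsGaussianFunctional.map_eq (hS : S.IsPositive) (hν : IsCentredGaussian S (gaussian S))
    {h : E} {w : E → ℝ} (hw : IsGaussianFunctional S h w) :
    (gaussian S).map w = gaussianReal 0 (‖h‖₊ ^ 2) := by
  have := hν.1
  have hm := hw.1.1.aemeasurable
  have : IsProbabilityMeasure ((gaussian S).map w) := Measure.isProbabilityMeasure_map hm
  refine Measure.ext_of_charFun ?_
  ext t
  rw [charFun_gaussianReal, charFun_apply_real, integral_map hm (by fun_prop)]
  have h1 := hw.integral_cexp hS hν 0 t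
  simp only [inner_zero_left, zero_add, map_zero, norm_smul] at h1
  push_cast at h1 ⊢
  rw [h1]
  congr 1
  rw [mul_pow, ← Complex.ofReal_pow, Real.norm_eq_abs, sq_abs]
  push_cast
  ring

lemma IsGaussianFunctional.integral_sq (hS : S.IsPositive) (hν : IsCentredGaussian S (gaussian S))
    {h : E} {w : E → ℝ} (hw : IsGaussianFunctional S h w) :
    ∫ z, w z ^ 2 ∂(gaussian S) = ‖h‖ ^ 2 := by
  have h1 := integral_map (μ := gaussian S) hw.1.1.aemeasurable
    (f := fun x : ℝ => x ^ 2) (by fun_prop)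
  rw [← h1, hw.map_eq hS hν, integral_sq_gaussianReal]
  simp

lemma IsGaussianFunctional.eLpNorm_eq (hS : S.IsPositive) (hν : IsCentredGaussian S (gaussian S))
    {h : E} {w : E → ℝ} (hw : IsGaussianFunctional S h w) :
    eLpNorm w 2 (gaussian S) = ‖h‖ₑ := by
  rw [hw.1.eLpNorm_eq_integral_rpow_norm (by norm_num) (by norm_num)]
  have h1 := hw.integral_sq hS hν
  simp only [ENNReal.toReal_ofNat, Real.rpow_two, Real.norm_eq_abs, sq_abs, h1]
  rw [← one_div, ← Real.sqrt_eq_rpow, Real.sqrt_sq (norm_nonneg _), ofReal_norm]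

lemma IsGaussianFunctional.ae_eq (hS : S.IsPositive) (hν : IsCentredGaussian S (gaussian S))
    {h : E} {w w' : E → ℝ} (hw : IsGaussianFunctional S h w)
    (hw' : IsGaussianFunctional S h w') : w =ᵐ[gaussian S] w' := by
  have h1 := (hw.add (hw'.smul (-1))).eLpNorm_eq hS hν
  have h0 : h + (-1 : ℝ) • h = 0 := by simp
  rw [h0, enorm_zero,
    eLpNorm_eq_zero_iff (hw.1.1.add (hw'.1.1.const_smul _)) (by norm_num)] at h1
  filter_upwards [h1] with z hz
  simp only [Pi.add_apply, Pi.neg_apply, neg_smul, one_smul, Pi.zero_apply] at hz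
  linarith

end GaussianFunctional

/-! ### The Cameron-Martin formula and the first-order expansion of a shift -/

section CameronMartin

open ProbabilityTheory Complex

section OneDimensional

lemma memLp_exp_gaussianReal (v : NNReal) (c : ℝ) :
    MemLp (fun x => Real.exp (x - c)) 2 (gaussianReal 0 v) := by
  refine (memLp_two_iff_integrable_sq (by fun_prop)).2 ?_
  have h1 := (integrable_exp_mul_gaussianReal (μ := 0) (v := v) 2).mul_const (Real.exp (-(2 * c)))
  refine h1.congr (Eventually.of_forall fun x => ?_)
  simp only
  rw [← Real.exp_add, pow_two, ← Real.exp_add]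
  congr 1; ring

lemma integral_exp_gaussianReal (v : NNReal) (t : ℝ) :
    ∫ x, Real.exp (t * x) ∂(gaussianReal 0 v) = Real.exp (v * t ^ 2 / 2) := by
  have h := congrFun (mgf_fun_id_gaussianReal (μ := 0) (v := v)) t
  simpa [mgf] using h

lemma integral_exp_sub_half_gaussianReal (v : NNReal) :
    ∫ x, Real.exp (x - v / 2) ∂(gaussianReal 0 v) = 1 := by
  have h1 : ∀ x : ℝ, Real.exp (x - v / 2) = Real.exp (1 * x) * Real.exp (-(v / 2)) := by
    intro x
    rw [← Real.exp_add]
    congr 1; ring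
  simp only [h1]
  rw [integral_mul_const, integral_exp_gaussianReal, ← Real.exp_add, one_pow, mul_one,
    add_neg_cancel, Real.exp_zero]

lemma integral_mul_exp_gaussianReal (v : NNReal) :
    ∫ x, x * Real.exp x ∂(gaussianReal 0 v) = v * Real.exp (v / 2) := by
  have h1 := hasDerivAt_mgf (X := fun x : ℝ => x) (μ := gaussianReal 0 v) (t := 1)
    (by rw [integrableExpSet_fun_id_gaussianReal]; simp)
  have h2 : HasDerivAt (fun t : ℝ => Real.exp (0 * t + (v : ℝ) * t ^ 2 / 2))
      ((v : ℝ) * Real.exp (v / 2)) 1 := by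
    have h3 : HasDerivAt (fun t : ℝ => 0 * t + (v : ℝ) * t ^ 2 / 2) (v : ℝ) 1 := by
      have h4 : HasDerivAt (fun t : ℝ => t ^ 2) (2 * 1) 1 := by
        simpa using hasDerivAt_pow 2 (1 : ℝ)
      have h5 := (h4.const_mul (v : ℝ)).div_const 2
      have h6 := h5.const_add 0
      have e1 : (v : ℝ) * (2 * 1) / 2 = v := by ring
      rw [e1] at h6
      refine h6.congr_of_eventuallyEq (Eventually.of_forall fun t => ?_)
      simp
    have h7 := h3.exp
    convert! h7 using 1
    norm_num
    ring
  rw [mgf_fun_id_gaussianReal] at h1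
  have h8 := h1.unique h2
  simpa using h8

/-- The second moment of the second-order remainder of the Cameron-Martin density. -/
lemma integral_sq_exp_remainder (v : NNReal) :
    ∫ x, (Real.exp (x - v / 2) - 1 - x) ^ 2 ∂(gaussianReal 0 v) = Real.exp v - 1 - v := by
  have hx : MemLp (fun x : ℝ => x) 2 (gaussianReal 0 v) := memLp_id_gaussianReal' 2 (by norm_num)
  have he := memLp_exp_gaussianReal v (v / 2)
  have i1 : Integrable (fun x => Real.exp (x - v / 2) ^ 2) (gaussianReal 0 v) := he.integrable_sq
  have i2 : Integrable (fun x => Real.exp (x - v / 2)) (gaussianReal 0 v) :=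
    he.integrable (by norm_num)
  have i3 : Integrable (fun x => x * Real.exp (x - v / 2)) (gaussianReal 0 v) :=
    hx.integrable_mul he
  have i4 : Integrable (fun x : ℝ => x) (gaussianReal 0 v) := hx.integrable (by norm_num)
  have i5 : Integrable (fun x : ℝ => x ^ 2) (gaussianReal 0 v) := hx.integrable_sq
  have e1 : ∫ x, Real.exp (x - v / 2) ^ 2 ∂(gaussianReal 0 v) = Real.exp v := by
    have : ∀ x : ℝ, Real.exp (x - v / 2) ^ 2 = Real.exp (2 * x) * Real.exp (-v) := by
      intro x
      rw [pow_two, ← Real.exp_add, ← Real.exp_add]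
      congr 1; ring
    simp only [this]
    rw [integral_mul_const, integral_exp_gaussianReal, ← Real.exp_add]
    congr 1; ring
  have e2 : ∫ x, Real.exp (x - v / 2) ∂(gaussianReal 0 v) = 1 :=
    integral_exp_sub_half_gaussianReal v
  have e3 : ∫ x, x * Real.exp (x - v / 2) ∂(gaussianReal 0 v) = v := by
    have : ∀ x : ℝ, x * Real.exp (x - v / 2) = x * Real.exp x * Real.exp (-(v / 2)) := by
      intro x
      rw [mul_assoc, ← Real.exp_add]
      congr 1
    simp only [this]
    rw [integral_mul_const, integral_mul_exp_gaussianReal, mul_assoc, ← Real.exp_add]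
    simp
  have hexp : ∀ x : ℝ, (Real.exp (x - v / 2) - 1 - x) ^ 2 =
      ((((Real.exp (x - v / 2) ^ 2 - 2 * Real.exp (x - v / 2)) -
        2 * (x * Real.exp (x - v / 2))) + 1) + 2 * x) + x ^ 2 := fun x => by ring
  simp only [hexp]
  have j1 : Integrable (fun x => Real.exp (x - v / 2) ^ 2 - 2 * Real.exp (x - v / 2))
    (gaussianReal 0 v) := i1.sub (i2.const_mul 2)
  have j2 : Integrable (fun x => Real.exp (x - v / 2) ^ 2 - 2 * Real.exp (x - v / 2) -
    2 * (x * Real.exp (x - v / 2))) (gaussianReal 0 v) := j1.sub (i3.const_mul 2)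
  have j3 : Integrable (fun x => Real.exp (x - v / 2) ^ 2 - 2 * Real.exp (x - v / 2) -
    2 * (x * Real.exp (x - v / 2)) + 1) (gaussianReal 0 v) := j2.add (integrable_const (1 : ℝ))
  have j4 : Integrable (fun x => Real.exp (x - v / 2) ^ 2 - 2 * Real.exp (x - v / 2) -
    2 * (x * Real.exp (x - v / 2)) + 1 + 2 * x) (gaussianReal 0 v) := j3.add (i4.const_mul 2)
  rw [integral_add j4 i5, integral_add j3 (i4.const_mul 2), integral_add j2 (integrable_const _),
    integral_sub j1 (i3.const_mul 2), integral_sub i1 (i2.const_mul 2), integral_const_mul,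
    integral_const_mul, integral_const_mul, e1, e2, e3, integral_sq_gaussianReal,
    integral_id_gaussianReal]
  simp
  ring

lemma integral_abs_le_sqrt {Ω : Type*} [MeasurableSpace Ω] {μ : Measure Ω} [IsProbabilityMeasure μ]
    {f : Ω → ℝ} (hf : MemLp f 2 μ) : ∫ x, |f x| ∂μ ≤ √(∫ x, f x ^ 2 ∂μ) := by
  refine Real.le_sqrt_of_sq_le ?_
  have h1 := variance_nonneg (fun x => |f x|) μ
  rw [variance_eq_sub (by simpa only [Real.norm_eq_abs] using hf.norm)] at h1
  simp only [Pi.pow_apply, sq_abs] at h1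
  linarith

/-- The remainder of the Cameron-Martin density in `L¹`, bounded by interpolating between the
quadratic estimate for small shifts and the linear one for large shifts. -/
lemma integral_abs_exp_remainder_le (s : NNReal) {δ : ℝ} (hδ0 : 0 ≤ δ) (hδ1 : δ ≤ 1) :
    ∫ x, |Real.exp (x - (s ^ 2 : NNReal) / 2) - 1 - x| ∂(gaussianReal 0 (s ^ 2)) ≤
      3 * (s : ℝ) ^ (1 + δ) := by
  set v : NNReal := s ^ 2 with hv
  have hvs : (v : ℝ) = (s : ℝ) ^ 2 := by simp [hv]
  have hx : MemLp (fun x : ℝ => x) 2 (gaussianReal 0 v) := memLp_id_gaussianReal' 2 (by norm_num)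
  have he := memLp_exp_gaussianReal v (v / 2)
  have i2 : Integrable (fun x => Real.exp (x - v / 2)) (gaussianReal 0 v) :=
    he.integrable (by norm_num)
  have i4 : Integrable (fun x : ℝ => x) (gaussianReal 0 v) := hx.integrable (by norm_num)
  have hm : MemLp (fun x : ℝ => Real.exp (x - v / 2) - 1 - x) 2 (gaussianReal 0 v) :=
    (he.sub (memLp_const 1)).sub hx
  have e2 : ∫ x, Real.exp (x - v / 2) ∂(gaussianReal 0 v) = 1 :=
    integral_exp_sub_half_gaussianReal v
  have hs0 : (0 : ℝ) ≤ s := s.2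
  rcases le_or_gt (s : ℝ) 1 with h1 | h1
  · have h2 := integral_abs_le_sqrt hm
    rw [integral_sq_exp_remainder] at h2
    have hv1 : (v : ℝ) ≤ 1 := by rw [hvs]; nlinarith
    have hv0 : (0 : ℝ) ≤ v := v.2
    have h3 : Real.exp v - 1 - v ≤ (v : ℝ) ^ 2 := by
      have := Real.abs_exp_sub_one_sub_id_le (x := v) (by rwa [abs_of_nonneg hv0])
      exact (le_abs_self _).trans this
    have h4 : √(Real.exp v - 1 - v) ≤ v := (Real.sqrt_le_left hv0).2 h3
    have h5 : (v : ℝ) ≤ (s : ℝ) ^ (1 + δ) := by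
      rcases hs0.eq_or_lt with h6 | h6
      · rw [hvs, ← h6]
        simp [Real.zero_rpow (by linarith : (1 + δ) ≠ 0)]
      · rw [hvs, ← Real.rpow_two]
        exact Real.rpow_le_rpow_of_exponent_ge h6 h1 (by linarith)
    have h6 : 0 ≤ (s : ℝ) ^ (1 + δ) := by positivity
    linarith
  · have h2 : ∫ x, |Real.exp (x - v / 2) - 1 - x| ∂(gaussianReal 0 v) ≤
        ∫ x, (Real.exp (x - v / 2) + 1 + |x|) ∂(gaussianReal 0 v) := by
      refine integral_mono (hm.integrable (by norm_num)).abs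
        ((i2.add (integrable_const 1)).add i4.abs) fun x => ?_
      have h3 := Real.exp_pos (x - v / 2)
      have h4 := abs_sub (Real.exp (x - v / 2) - 1) x
      have h5 := abs_sub (Real.exp (x - v / 2)) 1
      rw [abs_of_pos h3, abs_one] at h5
      simp only
      linarith
    have h3 : ∫ x, (Real.exp (x - v / 2) + 1 + |x|) ∂(gaussianReal 0 v) =
        1 + 1 + ∫ x, |x| ∂(gaussianReal 0 v) := by
      have i6 : Integrable (fun x => Real.exp (x - v / 2) + 1) (gaussianReal 0 v) :=
        i2.add (integrable_const 1)
      rw [integral_add i6 i4.abs,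
        integral_add i2 (integrable_const 1), e2]
      simp
    have h4 := integral_abs_le_sqrt hx
    rw [integral_sq_gaussianReal, hvs, Real.sqrt_sq hs0] at h4
    have h5 : (s : ℝ) ≤ (s : ℝ) ^ (1 + δ) := by
      conv_lhs => rw [← Real.rpow_one (s : ℝ)]
      exact Real.rpow_le_rpow_of_exponent_le h1.le (by linarith)
    linarith

end OneDimensional

variable {E : Type*} [NormedAddCommGroup E] [InnerProductSpace ℝ E] [CompleteSpace E]
  [SecondCountableTopology E] [MeasurableSpace E] [BorelSpace E]
  {S : E →L[ℝ] E}

/-- The part of `⟨x, ·⟩` orthogonal to the functional of `h` is independent of that functional. -/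
lemma IsGaussianFunctional.indepFun (hS : S.IsPositive)
    (hν : IsCentredGaussian S (gaussian S)) {h : E} {w : E → ℝ}
    (hw : IsGaussianFunctional S h w) (x : E) (c : ℝ)
    (hc : ⟪posSqrt S x - c • h, h⟫_ℝ = 0) :
    IndepFun (fun z => ⟪x, z⟫_ℝ - c * w z) w (gaussian S) := by
  have := hν.1
  have hwm := hw.1.1.aemeasurable
  have hYm : AEMeasurable (fun z => ⟪x, z⟫_ℝ - c * w z) (gaussian S) :=
    (by fun_prop : AEMeasurable (fun z => ⟪x, z⟫_ℝ) (gaussian S)).sub (hwm.const_mul c)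
  have key : ∀ p q : ℝ, ∫ z, cexp ((p * (⟪x, z⟫_ℝ - c * w z) + q * w z : ℝ) * I) ∂(gaussian S) =
      cexp (-((p ^ 2 * ‖posSqrt S x - c • h‖ ^ 2 + q ^ 2 * ‖h‖ ^ 2 : ℝ) : ℂ) / 2) := by
    intro p q
    have h1 := hw.integral_cexp hS hν (p • x) (q - c * p)
    have h2 : ∀ z, ⟪p • x, z⟫_ℝ + (q - c * p) * w z =
        p * (⟪x, z⟫_ℝ - c * w z) + q * w z := by
      intro z
      rw [inner_smul_left]; simp; ring
    simp only [h2] at h1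
    rw [h1]
    congr 4
    have h3 : posSqrt S (p • x) + (q - c * p) • h = p • (posSqrt S x - c • h) + q • h := by
      rw [map_smul]; module
    rw [h3, norm_add_sq_real, inner_smul_left, inner_smul_right, hc, norm_smul, norm_smul,
      mul_pow, mul_pow, Real.norm_eq_abs, Real.norm_eq_abs, sq_abs, sq_abs]
    simp
  rw [indepFun_iff_charFun_prod hYm hwm]
  intro t
  rw [charFun_apply, charFun_apply_real, charFun_apply_real,
    integral_map (by fun_prop) (by fun_prop), integral_map hYm (by fun_prop),
    integral_map hwm (by fun_prop)]
  have h1 := key t.ofLp.1 t.ofLp.2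
  have h2 := key t.ofLp.1 0
  have h3 := key 0 t.ofLp.2
  have e1 : ∀ z, ⟪WithLp.toLp 2 (⟪x, z⟫_ℝ - c * w z, w z), t⟫_ℝ =
      t.ofLp.1 * (⟪x, z⟫_ℝ - c * w z) + t.ofLp.2 * w z := by
    intro z
    rw [WithLp.prod_inner_apply]
    simp
  simp only [e1, h1]
  simp only [zero_mul, add_zero, zero_add] at h2 h3
  push_cast at h2 h3 ⊢
  rw [h2, h3, ← Complex.exp_add]
  congr 1
  ring

/-- The Cameron-Martin formula: shifting `N(0, S)` by `S^{1/2} h` has density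
`exp (w - ‖h‖² / 2)`, where `w` is the functional of `h`. -/
lemma IsGaussianFunctional.map_add_eq_withDensity (hS : S.IsPositive)
    (hν : IsCentredGaussian S (gaussian S)) {h : E} {w : E → ℝ}
    (hw : IsGaussianFunctional S h w) :
    (gaussian S).map (fun z => z + posSqrt S h) =
      (gaussian S).withDensity fun z => ENNReal.ofReal (Real.exp (w z - ‖h‖ ^ 2 / 2)) := by
  have := hν.1
  have hwm := hw.1.1.aemeasurable
  have hlaw := hw.map_eq hS hν
  have hint : Integrable (fun z => Real.exp (w z - ‖h‖ ^ 2 / 2)) (gaussian S) := by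
    have h1 := (memLp_exp_gaussianReal (‖h‖₊ ^ 2) (‖h‖ ^ 2 / 2)).integrable (by norm_num)
    rw [← hlaw] at h1
    exact h1.comp_aemeasurable hwm
  have hfin : IsFiniteMeasure
      ((gaussian S).withDensity fun z => ENNReal.ofReal (Real.exp (w z - ‖h‖ ^ 2 / 2))) :=
    isFiniteMeasure_withDensity_ofReal hint.2
  have : IsProbabilityMeasure ((gaussian S).map (fun z => z + posSqrt S h)) :=
    Measure.isProbabilityMeasure_map (by fun_prop)
  refine Measure.ext_of_charFun ?_
  ext x
  rw [charFun_map_add_const, hν.2, charFun_apply,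
    integral_withDensity_eq_integral_toReal_smul₀ (by fun_prop)
      (Eventually.of_forall fun _ => ENNReal.ofReal_lt_top)]
  set c : ℝ := ⟪posSqrt S x, h⟫_ℝ / ‖h‖ ^ 2 with hc
  have hcn : c * ‖h‖ ^ 2 = ⟪posSqrt S x, h⟫_ℝ := by
    by_cases h0 : h = 0
    · simp [h0]
    · rw [hc, div_mul_cancel₀]
      exact pow_ne_zero 2 (norm_ne_zero_iff.2 h0)
  have horth : ⟪posSqrt S x - c • h, h⟫_ℝ = 0 := by
    rw [inner_sub_left, inner_smul_left, real_inner_self_eq_norm_sq]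
    simp [hcn]
  have hYm : AEMeasurable (fun z => ⟪x, z⟫_ℝ - c * w z) (gaussian S) :=
    (by fun_prop : AEMeasurable (fun z => ⟪x, z⟫_ℝ) (gaussian S)).sub (hwm.const_mul c)
  have hind := hw.indepFun hS hν x c horth
  have hprod := (hind.comp (φ := fun y : ℝ => cexp (y * I))
    (ψ := fun y : ℝ => cexp ((1 + c * I) * y)) (by fun_prop) (by fun_prop)).integral_fun_mul_eq_mul_integral
    (by simp only [Function.comp_def]; fun_prop) (by simp only [Function.comp_def]; fun_prop)
  simp only [Function.comp_def] at hprod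
  have hY : ∫ z, cexp (((⟪x, z⟫_ℝ - c * w z : ℝ) : ℂ) * I) ∂(gaussian S) =
      cexp (-((‖posSqrt S x - c • h‖ ^ 2 : ℝ) : ℂ) / 2) := by
    have h1 := hw.integral_cexp hS hν x (-c)
    simp only [neg_mul, neg_smul, ← sub_eq_add_neg] at h1
    exact h1
  have hW := complexMGF_gaussianReal hlaw (1 + c * I)
  rw [complexMGF] at hW
  rw [hY, hW] at hprod
  have e1 : ∀ z, (ENNReal.ofReal (Real.exp (w z - ‖h‖ ^ 2 / 2))).toReal • cexp (⟪z, x⟫_ℝ * I) =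
      cexp (((⟪x, z⟫_ℝ - c * w z : ℝ) : ℂ) * I) * cexp ((1 + c * I) * (w z)) *
        cexp (-(‖h‖ ^ 2 / 2)) := by
    intro z
    rw [ENNReal.toReal_ofReal (Real.exp_pos _).le, Complex.real_smul, Complex.ofReal_exp,
      ← Complex.exp_add, ← Complex.exp_add, ← Complex.exp_add, real_inner_comm]
    congr 1
    push_cast
    ring
  simp only [e1]
  rw [integral_mul_const, hprod, ← Complex.exp_add, ← Complex.exp_add, ← Complex.exp_add]
  congr 1
  have e2 : ‖posSqrt S x - c • h‖ ^ 2 = ‖posSqrt S x‖ ^ 2 - c ^ 2 * ‖h‖ ^ 2 := by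
    rw [norm_sub_sq_real, inner_smul_right, ← hcn, norm_smul, mul_pow, Real.norm_eq_abs, sq_abs]
    ring
  rw [e2, inner_self_eq_norm_posSqrt hS, posSqrt_symm hS, real_inner_comm, ← hcn]
  push_cast
  ring_nf
  simp only [Complex.I_sq]
  ring

lemma integrable_mul_of_bounded {Ω : Type*} [MeasurableSpace Ω] {μ : Measure Ω}
    {φ w : Ω → ℝ} {M : ℝ} (hφ : AEStronglyMeasurable φ μ) (hM : ∀ z, |φ z| ≤ M)
    (hw : Integrable w μ) :
    Integrable (fun z => φ z * w z) μ :=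
  hw.bdd_mul hφ (Eventually.of_forall hM)

/-- First-order expansion of `∫ φ d(N(0, S) shifted by S^{1/2} h)` at `h = 0` for a bounded Borel
`φ`; the exponent `1 + δ` of the remainder is free in `[1, 2]`. -/
lemma IsGaussianFunctional.abs_integral_shift_sub_le (hS : S.IsPositive)
    (hν : IsCentredGaussian S (gaussian S)) {h : E} {w : E → ℝ}
    (hw : IsGaussianFunctional S h w) {φ : E → ℝ} (hφ : Measurable φ) {M : ℝ}
    (hM : ∀ z, |φ z| ≤ M) {δ : ℝ} (hδ0 : 0 ≤ δ) (hδ1 : δ ≤ 1) :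
    |∫ z, φ (z + posSqrt S h) ∂(gaussian S) - ∫ z, φ z ∂(gaussian S) -
      ∫ z, φ z * w z ∂(gaussian S)| ≤ 3 * M * ‖h‖ ^ (1 + δ) := by
  have := hν.1
  have hwm := hw.1.1.aemeasurable
  have hlaw := hw.map_eq hS hν
  have hM0 : 0 ≤ M := (abs_nonneg _).trans (hM 0)
  have h1 : ∫ z, φ (z + posSqrt S h) ∂(gaussian S) =
      ∫ z, φ z * Real.exp (w z - ‖h‖ ^ 2 / 2) ∂(gaussian S) := by
    rw [← integral_map (φ := fun z => z + posSqrt S h) (by fun_prop)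
      hφ.aestronglyMeasurable, hw.map_add_eq_withDensity hS hν,
      integral_withDensity_eq_integral_toReal_smul₀ (by fun_prop)
      (Eventually.of_forall fun _ => ENNReal.ofReal_lt_top)]
    refine integral_congr_ae (Eventually.of_forall fun z => ?_)
    simp only
    rw [ENNReal.toReal_ofReal (Real.exp_pos _).le, smul_eq_mul, mul_comm]
  have hint : Integrable (fun z => Real.exp (w z - ‖h‖ ^ 2 / 2)) (gaussian S) := by
    have h1 := (memLp_exp_gaussianReal (‖h‖₊ ^ 2) (‖h‖ ^ 2 / 2)).integrable (by norm_num)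
    rw [← hlaw] at h1
    exact h1.comp_aemeasurable hwm
  have hwi : Integrable w (gaussian S) := hw.1.integrable (by norm_num)
  have hφi : Integrable φ (gaussian S) :=
    Integrable.of_bound hφ.aestronglyMeasurable M (Eventually.of_forall hM)
  have j1 := integrable_mul_of_bounded hφ.aestronglyMeasurable hM hint
  have j2 := integrable_mul_of_bounded hφ.aestronglyMeasurable hM hwi
  have j3 : Integrable (fun z => φ z * Real.exp (w z - ‖h‖ ^ 2 / 2) - φ z) (gaussian S) :=
    j1.sub hφi
  rw [h1, ← integral_sub j1 hφi, ← integral_sub j3 j2]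
  have h2 : ∫ z, |Real.exp (w z - ‖h‖ ^ 2 / 2) - 1 - w z| ∂(gaussian S) ≤
      3 * ‖h‖ ^ (1 + δ) := by
    have h3 := integral_abs_exp_remainder_le ‖h‖₊ hδ0 hδ1
    rw [← hlaw, integral_map hwm (by fun_prop)] at h3
    simpa using h3
  calc |∫ z, (φ z * Real.exp (w z - ‖h‖ ^ 2 / 2) - φ z - φ z * w z) ∂(gaussian S)|
      ≤ ∫ z, M * |Real.exp (w z - ‖h‖ ^ 2 / 2) - 1 - w z| ∂(gaussian S) := by
        have j4 : Integrable (fun z => M * |Real.exp (w z - ‖h‖ ^ 2 / 2) - 1 - w z|)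
            (gaussian S) := ((hint.sub (integrable_const 1)).sub hwi).abs.const_mul M
        rw [← Real.norm_eq_abs]
        refine norm_integral_le_of_norm_le j4 (Eventually.of_forall fun z => ?_)
        have h4 : φ z * Real.exp (w z - ‖h‖ ^ 2 / 2) - φ z - φ z * w z =
          φ z * (Real.exp (w z - ‖h‖ ^ 2 / 2) - 1 - w z) := by ring
        rw [h4, norm_mul, Real.norm_eq_abs, Real.norm_eq_abs]
        exact mul_le_mul_of_nonneg_right (hM z) (abs_nonneg _)
    _ = M * ∫ z, |Real.exp (w z - ‖h‖ ^ 2 / 2) - 1 - w z| ∂(gaussian S) := by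
        rw [integral_const_mul]
    _ ≤ M * (3 * ‖h‖ ^ (1 + δ)) := by gcongr
    _ = _ := by ring

end CameronMartin

/-! ### Directional weights of an image of a Gaussian measure -/

section GaussianWeight

open ProbabilityTheory

variable {H E K : Type*} [NormedAddCommGroup H] [InnerProductSpace ℝ H] [CompleteSpace H]
  [SecondCountableTopology H] [MeasurableSpace H] [BorelSpace H]
  [NormedAddCommGroup E] [InnerProductSpace ℝ E] [CompleteSpace E]
  [SecondCountableTopology E] [MeasurableSpace E] [BorelSpace E]
  [NormedAddCommGroup K] [NormedSpace ℝ K]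

lemma isPositive_conj {Q : H →L[ℝ] H} (hQ : Q.IsPositive) (B : H →L[ℝ] E) :
    (B ∘L Q ∘L ContinuousLinearMap.adjoint B).IsPositive :=
  hQ.conj_adjoint B

lemma measurePreserving_gaussian {Q : H →L[ℝ] H} (hμ : IsCentredGaussian Q (gaussian Q))
    (B : H →L[ℝ] E) :
    MeasurePreserving B (gaussian Q) (gaussian (B ∘L Q ∘L ContinuousLinearMap.adjoint B)) :=
  ⟨by fun_prop, ((hμ.map B).eq_gaussian).symm⟩

/-- If the directions `h k` lie in the range of `(B Q B*)^{1/2}`, then the functionals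
`z ↦ ⟨(B Q B*)^{-1/2} h k, (B Q B*)^{-1/2} B z⟩` on `(H, N(0, Q))` are the values of a bounded
operator `W : K → L²(N(0, Q))`, and they represent the first-order variation of
`∫ F(B z) N(0, Q)(dz)` in the directions `h k`, for bounded Borel `F`. -/
lemma exists_gaussianWeight {Q : H →L[ℝ] H} (hQ : Q.IsPositive)
    (hμ : IsCentredGaussian Q (gaussian Q)) (B : H →L[ℝ] E) (h : K →L[ℝ] E) {c : ℝ} (hc : 0 ≤ c)
    (hmem : ∀ k, h k ∈ range (posSqrt (B ∘L Q ∘L ContinuousLinearMap.adjoint B)))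
    (hb : ∀ k, ‖pinv (posSqrt (B ∘L Q ∘L ContinuousLinearMap.adjoint B)) (h k)‖ ≤ c * ‖k‖) :
    ∃ W : K →L[ℝ] Lp ℝ 2 (gaussian Q), (∀ k, ‖W k‖ ≤ c * ‖k‖) ∧
      (∀ k, (W k : H → ℝ) =ᵐ[gaussian Q] fun z =>
        gaussianFunctional (B ∘L Q ∘L ContinuousLinearMap.adjoint B)
          (pinv (posSqrt (B ∘L Q ∘L ContinuousLinearMap.adjoint B)) (h k)) (B z)) ∧
      ∀ (F : E → ℝ) (M : ℝ), Measurable F → (∀ z, |F z| ≤ M) → ∀ k, ∀ δ : ℝ, 0 ≤ δ → δ ≤ 1 →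
        |∫ z, F (B z + h k) ∂(gaussian Q) - ∫ z, F (B z) ∂(gaussian Q) -
          ∫ z, F (B z) * W k z ∂(gaussian Q)| ≤ 3 * M * (c * ‖k‖) ^ (1 + δ) := by
  set S := B ∘L Q ∘L ContinuousLinearMap.adjoint B with hSdef
  have hS : S.IsPositive := isPositive_conj hQ B
  have hmp : MeasurePreserving B (gaussian Q) (gaussian S) := measurePreserving_gaussian hμ B
  have hν : IsCentredGaussian S (gaussian S) := gaussian_spec ⟨_, hμ.map B⟩
  set l : K → E := fun k => pinv (posSqrt S) (h k) with hl
  set w : K → E → ℝ := fun k => gaussianFunctional S (l k) with hw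
  have hgf : ∀ k, IsGaussianFunctional S (l k) (w k) := fun k =>
    isGaussianFunctional_gaussianFunctional hS hν (pinv_spec _ (hmem k)).1
  have hladd : ∀ k k', l (k + k') = l k + l k' := fun k k' => by
    simp only [hl, map_add]; exact pinv_add _ (hmem k) (hmem k')
  have hlsmul : ∀ (a : ℝ) k, l (a • k) = a • l k := fun a k => by
    simp only [hl, map_smul]; exact pinv_smul _ a (hmem k)
  have hwadd : ∀ k k', w (k + k') =ᵐ[gaussian S] w k + w k' := fun k k' =>
    (hgf (k + k')).ae_eq hS hν (by rw [hladd]; exact (hgf k).add (hgf k'))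
  have hwsmul : ∀ (a : ℝ) k, w (a • k) =ᵐ[gaussian S] a • w k := fun a k =>
    (hgf (a • k)).ae_eq hS hν (by rw [hlsmul]; exact (hgf k).smul a)
  have hmem2 : ∀ k, MemLp (fun z => w k (B z)) 2 (gaussian Q) := fun k =>
    (hgf k).1.comp_measurePreserving hmp
  have hnorm : ∀ k, ‖(hmem2 k).toLp‖ ≤ c * ‖k‖ := by
    intro k
    have h1 : eLpNorm (fun z => w k (B z)) 2 (gaussian Q) = ‖l k‖ₑ :=
      (eLpNorm_comp_measurePreserving (hgf k).1.1 hmp).trans ((hgf k).eLpNorm_eq hS hν)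
    rw [Lp.norm_toLp, h1, toReal_enorm]
    exact hb k
  let W : K →L[ℝ] Lp ℝ 2 (gaussian Q) := LinearMap.mkContinuous
    { toFun := fun k => (hmem2 k).toLp
      map_add' := fun k k' => by
        rw [← MemLp.toLp_add]
        exact MemLp.toLp_congr _ _ (hmp.quasiMeasurePreserving.ae (hwadd k k'))
      map_smul' := fun a k => by
        rw [RingHom.id_apply, ← MemLp.toLp_const_smul]
        exact MemLp.toLp_congr _ _ (hmp.quasiMeasurePreserving.ae (hwsmul a k)) } c hnorm
  have hWae : ∀ k, (W k : H → ℝ) =ᵐ[gaussian Q] fun z => w k (B z) := fun k =>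
    (hmem2 k).coeFn_toLp
  refine ⟨W, hnorm, hWae, fun F M hF hM k δ hδ0 hδ1 => ?_⟩
  have hM0 : 0 ≤ M := (abs_nonneg _).trans (hM 0)
  have h1 := (hgf k).abs_integral_shift_sub_le hS hν hF hM hδ0 hδ1
  have h2 : posSqrt S (l k) = h k := (pinv_spec _ (hmem k)).2
  rw [h2] at h1
  have e1 : ∫ z, F (B z + h k) ∂(gaussian Q) = ∫ z, F (z + h k) ∂(gaussian S) := by
    rw [← hmp.map_eq, integral_map hmp.measurable.aemeasurable
      (by fun_prop : Measurable fun z => F (z + h k)).aestronglyMeasurable]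
  have e2 : ∫ z, F (B z) ∂(gaussian Q) = ∫ z, F z ∂(gaussian S) := by
    rw [← hmp.map_eq, integral_map hmp.measurable.aemeasurable hF.aestronglyMeasurable]
  have e3 : ∫ z, F (B z) * W k z ∂(gaussian Q) = ∫ z, F z * w k z ∂(gaussian S) := by
    have h3 : AEStronglyMeasurable (fun z => F z * w k z) (gaussian S) :=
      hF.aestronglyMeasurable.mul (hgf k).1.1
    rw [← hmp.map_eq] at h3
    have h4 := integral_map hmp.measurable.aemeasurable h3
    rw [hmp.map_eq] at h4
    rw [h4]
    refine integral_congr_ae ?_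
    filter_upwards [hWae k] with z hz
    rw [hz]
  rw [e1, e2, e3]
  refine h1.trans ?_
  have h5 : ‖l k‖ ^ (1 + δ) ≤ (c * ‖k‖) ^ (1 + δ) :=
    Real.rpow_le_rpow (norm_nonneg _) (hb k) (by linarith)
  gcongr

end GaussianWeight

/-! ### The covariance operators of the stochastic convolution -/

lemma HilbertBasis.countable_index {E : Type*} [NormedAddCommGroup E] [InnerProductSpace ℝ E]
    [SecondCountableTopology E] {w : Set E} (b : HilbertBasis w ℝ E) : Countable w := by
  have hd : ∀ i j : w, i ≠ j → 1 ≤ dist (b i) (b j) := by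
    intro i j hij
    have h0 : ⟪b i, b j⟫_ℝ = 0 := b.orthonormal.2 hij
    have h1 := norm_sub_sq_real (b i) (b j)
    rw [h0, b.orthonormal.1 i, b.orthonormal.1 j] at h1
    rw [dist_eq_norm]
    nlinarith [norm_nonneg (b i - b j)]
  refine Set.countable_univ_iff.1 (Set.PairwiseDisjoint.countable_of_isOpen
    (s := fun i : w => Metric.ball (b i) (1 / 2)) ?_ (fun _ _ => Metric.isOpen_ball)
    (fun i _ => ⟨b i, Metric.mem_ball_self (by norm_num)⟩))
  intro i _ j _ hij
  refine Metric.ball_disjoint_ball ?_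
  norm_num
  exact hd i j hij

namespace C0Semigroup

variable {H Ξ : Type*} [NormedAddCommGroup H] [InnerProductSpace ℝ H] [CompleteSpace H]
  [SecondCountableTopology H]
  [NormedAddCommGroup Ξ] [InnerProductSpace ℝ Ξ] [CompleteSpace Ξ]

/-- The quadratic integrand `⟨G* e^{sA*} x, G* e^{sA*} y⟩`. -/
def covForm (S : C0Semigroup H) (G : Ξ →L[ℝ] H) (x y : H) (s : ℝ) : ℝ :=
  ⟪ContinuousLinearMap.adjoint G (ContinuousLinearMap.adjoint (S.op s) x),
    ContinuousLinearMap.adjoint G (ContinuousLinearMap.adjoint (S.op s) y)⟫_ℝ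

lemma inner_covIntegrand (S : C0Semigroup H) (G : Ξ →L[ℝ] H) (x y : H) (s : ℝ) :
    ⟪y, S.covIntegrand G x s⟫_ℝ = S.covForm G x y s := by
  rw [covIntegrand, covForm, ← ContinuousLinearMap.adjoint_inner_left,
    ← ContinuousLinearMap.adjoint_inner_left, real_inner_comm]

lemma intervalIntegrable_covForm (S : C0Semigroup H) (G : Ξ →L[ℝ] H) (x y : H) {a b : ℝ}
    (ha : 0 ≤ a) (hb : 0 ≤ b) : IntervalIntegrable (S.covForm G x y) volume a b := by
  have h0 : ∀ t : ℝ, 0 ≤ t → IntervalIntegrable (S.covForm G x y) volume 0 t := by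
    intro t ht
    rw [intervalIntegrable_iff_integrableOn_Ioc_of_le ht]
    obtain ⟨M, -, hM⟩ := S.integrable_covIntegrand G t
    refine ((hM x).1.const_inner y).congr (Eventually.of_forall fun s => ?_)
    exact S.inner_covIntegrand G x y s
  exact (h0 a ha).symm.trans (h0 b hb)

lemma inner_cov (S : C0Semigroup H) (G : Ξ →L[ℝ] H) {t : ℝ} (ht : 0 ≤ t) (x y : H) :
    ⟪S.cov G t x, y⟫_ℝ = ∫ s in (0 : ℝ)..t, S.covForm G x y s := by
  obtain ⟨M, -, hM⟩ := S.integrable_covIntegrand G t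
  have h1 : S.cov G t x = ∫ s in Ioc 0 t, S.covIntegrand G x s := rfl
  rw [h1, real_inner_comm, ← integral_inner (hM x).1 y, intervalIntegral.integral_of_le ht]
  simp only [S.inner_covIntegrand]

lemma cov_isPositive (S : C0Semigroup H) (G : Ξ →L[ℝ] H) {t : ℝ} (ht : 0 ≤ t) :
    (S.cov G t).IsPositive := by
  refine (ContinuousLinearMap.isPositive_iff _).2 ⟨fun x y => ?_, fun x => ?_⟩
  · change ⟪S.cov G t x, y⟫_ℝ = ⟪x, S.cov G t y⟫_ℝ
    rw [real_inner_comm (S.cov G t y) x, S.inner_cov G ht, S.inner_cov G ht]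
    simp only [covForm, real_inner_comm]
  · have h1 := S.inner_cov G ht x x
    rw [h1]
    exact intervalIntegral.integral_nonneg ht fun s _ => real_inner_self_nonneg

lemma cov_add (S : C0Semigroup H) (G : Ξ →L[ℝ] H) {a b : ℝ} (ha : 0 ≤ a) (hb : 0 ≤ b) :
    S.cov G (a + b) =
      S.cov G b + S.op b ∘L S.cov G a ∘L ContinuousLinearMap.adjoint (S.op b) := by
  ext x
  refine ext_inner_right ℝ fun y => ?_
  rw [_root_.add_apply, inner_add_left, S.inner_cov G (add_nonneg ha hb), S.inner_cov G hb]
  have h1 : ⟪(S.op b ∘L S.cov G a ∘L ContinuousLinearMap.adjoint (S.op b)) x, y⟫_ℝ =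
      ⟪S.cov G a (ContinuousLinearMap.adjoint (S.op b) x),
        ContinuousLinearMap.adjoint (S.op b) y⟫_ℝ := by
    rw [ContinuousLinearMap.adjoint_inner_right]; rfl
  rw [h1, S.inner_cov G ha, ← intervalIntegral.integral_add_adjacent_intervals
    (S.intervalIntegrable_covForm G x y le_rfl hb)
    (S.intervalIntegrable_covForm G x y hb (add_nonneg ha hb))]
  congr 1
  have h2 := intervalIntegral.integral_comp_add_right (S.covForm G x y) (a := 0) (b := a) b
  rw [zero_add] at h2
  rw [← h2]
  refine intervalIntegral.integral_congr fun s hs => ?_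
  rw [uIcc_of_le ha] at hs
  simp only [covForm]
  rw [add_comm s b, S.op_add b s hb hs.1, ContinuousLinearMap.adjoint_comp]
  rfl

lemma inner_cov_mono (S : C0Semigroup H) (G : Ξ →L[ℝ] H) {a t : ℝ} (ha : 0 ≤ a) (hat : a ≤ t)
    (x : H) : ⟪S.cov G a x, x⟫_ℝ ≤ ⟪S.cov G t x, x⟫_ℝ := by
  rw [S.inner_cov G ha, S.inner_cov G (ha.trans hat)]
  exact intervalIntegral.integral_mono_interval le_rfl ha hat
    (Eventually.of_forall fun s => real_inner_self_nonneg)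
    (S.intervalIntegrable_covForm G _ _ le_rfl (ha.trans hat))

lemma tendsto_inner_cov (S : C0Semigroup H) (G : Ξ →L[ℝ] H) (x : H) :
    Tendsto (fun a => ⟪S.cov G a x, x⟫_ℝ) (𝓝[≥] 0) (𝓝 0) := by
  have h2 : ContinuousOn (fun a => ∫ s in (0 : ℝ)..a, S.covForm G x x s) (Icc 0 1) := by
    have h3 := intervalIntegral.continuousOn_primitive_interval (μ := volume)
      (f := S.covForm G x x) (a := 0) (b := 1) (by
        rw [uIcc_of_le zero_le_one]
        exact (intervalIntegrable_iff_integrableOn_Icc_of_le zero_le_one).1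
          (S.intervalIntegrable_covForm G x x le_rfl zero_le_one))
    rwa [uIcc_of_le zero_le_one] at h3
  have h4 := h2 0 ⟨le_rfl, zero_le_one⟩
  rw [ContinuousWithinAt, intervalIntegral.integral_same,
    nhdsWithin_Icc_eq_nhdsGE zero_lt_one] at h4
  refine h4.congr' ?_
  filter_upwards [self_mem_nhdsWithin] with a ha
  rw [S.inner_cov G ha]

end C0Semigroup

namespace OUSetting

open ProbabilityTheory

variable {H Hb K Ξ : Type*}
  [NormedAddCommGroup H] [InnerProductSpace ℝ H] [CompleteSpace H] [SecondCountableTopology H]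
  [MeasurableSpace H] [BorelSpace H]
  [NormedAddCommGroup Hb] [NormedSpace ℝ Hb]
  [NormedAddCommGroup K] [InnerProductSpace ℝ K]
  [NormedAddCommGroup Ξ] [InnerProductSpace ℝ Ξ] [CompleteSpace Ξ]

/-! ### Dependence on time of the laws of the stochastic convolution -/

lemma Q_isPositive (D : OUSetting H Hb K Ξ) {t : ℝ} (ht : 0 ≤ t) : (D.Q t).IsPositive :=
  D.S.cov_isPositive D.G ht

lemma isCentredGaussian_Q (D : OUSetting H Hb K Ξ) {t : ℝ} (ht : 0 ≤ t) :
    IsCentredGaussian (D.Q t) (gaussian (D.Q t)) :=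
  gaussian_spec (exists_isCentredGaussian (D.Q_isPositive ht) (D.finite_trace t ht))

lemma isProbabilityMeasure_Q (D : OUSetting H Hb K Ξ) {t : ℝ} (ht : 0 ≤ t) :
    IsProbabilityMeasure (gaussian (D.Q t)) := (D.isCentredGaussian_Q ht).1

/-- `N(0, Q_{a+b})` is the convolution of `N(0, Q_b)` and of the image of `N(0, Q_a)` under
`e^{bA}`. -/
lemma gaussian_Q_add (D : OUSetting H Hb K Ξ) {a b : ℝ} (ha : 0 ≤ a) (hb : 0 ≤ b) :
    gaussian (D.Q (a + b)) =
      (gaussian (D.Q b)).conv ((gaussian (D.Q a)).map (D.S.op b)) := by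
  have h := (D.isCentredGaussian_Q hb).add ((D.isCentredGaussian_Q ha).map (D.S.op b))
  rw [← h.eq_gaussian, Q, D.S.cov_add D.G ha hb]
  rfl

/-- The mean square norm, hence the mean norm, of `N(0, Q_a)` vanishes as `a → 0`. -/
lemma exists_norm_moment_bound (D : OUSetting H Hb K Ξ) :
    ∃ m : ℝ → ℝ, Tendsto m (𝓝[≥] 0) (𝓝 0) ∧ ∀ a ∈ Icc (0 : ℝ) 1,
      Integrable (fun z : H => ‖z‖) (gaussian (D.Q a)) ∧ ∫ z, ‖z‖ ∂(gaussian (D.Q a)) ≤ m a := by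
  obtain ⟨w, b, hb⟩ := D.finite_trace 1 zero_le_one
  have := b.countable_index
  have hle : ∀ a ∈ Icc (0 : ℝ) 1, ∀ i, ⟪D.Q a (b i), b i⟫_ℝ ≤ ⟪D.S.cov D.G 1 (b i), b i⟫_ℝ := by
    intro a ha i
    exact D.S.inner_cov_mono D.G ha.1 ha.2 (b i)
  have hnn : ∀ a ∈ Icc (0 : ℝ) 1, ∀ i, 0 ≤ ⟪D.Q a (b i), b i⟫_ℝ := fun a ha i =>
    (D.Q_isPositive ha.1).inner_nonneg_left _
  have hsum : ∀ a ∈ Icc (0 : ℝ) 1, Summable fun i => ⟪D.Q a (b i), b i⟫_ℝ := fun a ha =>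
    Summable.of_nonneg_of_le (hnn a ha) (hle a ha) hb
  refine ⟨fun a => √(∑' i, ⟪D.Q a (b i), b i⟫_ℝ), ?_, fun a ha => ?_⟩
  · have h1 : Tendsto (fun a => ∑' i, ⟪D.Q a (b i), b i⟫_ℝ) (𝓝[≥] 0) (𝓝 (∑' _ : w, (0 : ℝ))) := by
      refine tendsto_tsum_of_dominated_convergence hb
        (fun i => D.S.tendsto_inner_cov D.G (b i)) ?_
      rw [← nhdsWithin_Icc_eq_nhdsGE zero_lt_one]
      filter_upwards [self_mem_nhdsWithin] with a ha i
      rw [Real.norm_of_nonneg (hnn a ha i)]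
      exact hle a ha i
    rw [tsum_zero] at h1
    simpa using h1.sqrt
  · have hpr := D.isProbabilityMeasure_Q ha.1
    have h1 := (D.isCentredGaussian_Q ha.1).lintegral_norm_sq (D.Q_isPositive ha.1) b
    rw [← ENNReal.ofReal_tsum_of_nonneg (hnn a ha) (hsum a ha)] at h1
    have h2 : MemLp (fun z : H => ‖z‖) 2 (gaussian (D.Q a)) := by
      refine (memLp_two_iff_integrable_sq (by fun_prop)).2 ⟨by fun_prop, ?_⟩
      rw [hasFiniteIntegral_iff_ofReal (Eventually.of_forall fun z => sq_nonneg _), h1]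
      exact ENNReal.ofReal_lt_top
    refine ⟨h2.integrable (by norm_num), ?_⟩
    have h3 := integral_abs_le_sqrt h2
    simp only [abs_norm] at h3
    rwa [integral_eq_lintegral_of_nonneg_ae (f := fun z : H => ‖z‖ ^ 2)
      (Eventually.of_forall fun z => sq_nonneg _)
      (by fun_prop), h1, ENNReal.toReal_ofReal (tsum_nonneg (hnn a ha))] at h3

/-- Integrals of bounded Lipschitz functions against `N(0, Q_t)` depend continuously on `t ≥ 0`. -/
lemma continuousOn_integral_gaussian_Q (D : OUSetting H Hb K Ξ) {φ : H → ℝ} {L M : ℝ}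
    (hφ : Continuous φ) (hL : ∀ x y, |φ x - φ y| ≤ L * ‖x - y‖) (hM : ∀ x, |φ x| ≤ M) :
    ContinuousOn (fun t => ∫ z, φ z ∂(gaussian (D.Q t))) (Ici 0) := by
  obtain ⟨m, hm, hmb⟩ := D.exists_norm_moment_bound
  have hLL : ∀ x y, |φ x - φ y| ≤ |L| * ‖x - y‖ := fun x y =>
    (hL x y).trans (mul_le_mul_of_nonneg_right (le_abs_self L) (norm_nonneg _))
  have hint : ∀ t : ℝ, 0 ≤ t → Integrable φ (gaussian (D.Q t)) := fun t ht => by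
    have := D.isProbabilityMeasure_Q ht
    exact Integrable.of_bound hφ.aestronglyMeasurable M (Eventually.of_forall hM)
  have key : ∀ (C b a : ℝ), 0 ≤ b → ‖D.S.op b‖ ≤ C → a ∈ Icc (0 : ℝ) 1 →
      |∫ z, φ z ∂(gaussian (D.Q (a + b))) - ∫ z, φ z ∂(gaussian (D.Q b))| ≤ |L| * (C * m a) := by
    intro C b a hb hC ha
    have := D.isProbabilityMeasure_Q hb
    have := D.isProbabilityMeasure_Q ha.1
    have hC0 : 0 ≤ C := (norm_nonneg _).trans hC
    have h1 : ∫ z, φ z ∂(gaussian (D.Q (a + b))) =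
        ∫ x, ∫ z, φ (z + D.S.op b x) ∂(gaussian (D.Q b)) ∂(gaussian (D.Q a)) := by
      rw [D.gaussian_Q_add ha.1 hb, Measure.conv, integral_map (by fun_prop) (by fun_prop)]
      have hi : ∀ (ρ : Measure (H × H)) [IsProbabilityMeasure ρ],
          Integrable (fun p : H × H => φ (p.1 + p.2)) ρ := fun ρ _ =>
        Integrable.of_bound (by fun_prop) M (Eventually.of_forall fun p => hM _)
      have hp : IsProbabilityMeasure ((gaussian (D.Q a)).map (D.S.op b)) :=
        Measure.isProbabilityMeasure_map (by fun_prop)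
      rw [integral_prod_symm _ (hi _)]
      rw [integral_map (by fun_prop)]
      exact (StronglyMeasurable.integral_prod_left (f := fun z x : H => φ (z + x))
        (by fun_prop : Continuous fun p : H × H => φ (p.1 + p.2)).stronglyMeasurable).aestronglyMeasurable
    have h2 : ∫ z, φ z ∂(gaussian (D.Q b)) =
        ∫ x, ∫ z, φ z ∂(gaussian (D.Q b)) ∂(gaussian (D.Q a)) := by simp
    have hs : ∀ x, Integrable (fun z => φ (z + D.S.op b x)) (gaussian (D.Q b)) := fun x =>
      Integrable.of_bound (by fun_prop) M (Eventually.of_forall fun p => hM _)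
    rw [h1, h2, ← integral_sub]
    · rw [← Real.norm_eq_abs]
      refine (norm_integral_le_of_norm_le (g := fun x => |L| * (C * ‖x‖))
        (((hmb a ha).1.const_mul C).const_mul |L|) (Eventually.of_forall fun x => ?_)).trans ?_
      · rw [← integral_sub (hs x) (hint b hb)]
        refine (norm_integral_le_of_norm_le_const (C := |L| * (C * ‖x‖))
          (Eventually.of_forall fun z => ?_)).trans (by simp)
        refine (hLL _ _).trans ?_
        rw [add_sub_cancel_left]
        gcongr
        exact (D.S.op b).le_of_opNorm_le hC x
      · rw [integral_const_mul, integral_const_mul]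
        have := (hmb a ha).2
        gcongr
    · refine Integrable.of_bound (C := M) ?_ (Eventually.of_forall fun x => ?_)
      · exact (StronglyMeasurable.integral_prod_right (f := fun x z : H => φ (z + D.S.op b x))
          (by fun_prop : Continuous fun p : H × H => φ (p.2 + D.S.op b p.1)).stronglyMeasurable).aestronglyMeasurable
      · refine (norm_integral_le_of_norm_le_const (C := M)
          (Eventually.of_forall fun z => hM _)).trans (by simp)
    · exact integrable_const _
  intro t0 ht0
  obtain ⟨C, hC0, hC⟩ := D.S.exists_bound (t0 + 1)
  rw [ContinuousWithinAt, tendsto_iff_dist_tendsto_zero]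
  have hlim : Tendsto (fun t => |L| * (C * m |t - t0|)) (𝓝[Ici 0] t0) (𝓝 0) := by
    have h1 : Tendsto (fun t => |t - t0|) (𝓝[Ici 0] t0) (𝓝[≥] 0) := by
      refine tendsto_nhdsWithin_iff.2 ⟨?_, Eventually.of_forall fun t => abs_nonneg (t - t0)⟩
      have : Tendsto (fun t => |t - t0|) (𝓝 t0) (𝓝 |t0 - t0|) := by
        exact (by fun_prop : Continuous fun t => |t - t0|).tendsto _
      rw [sub_self, abs_zero] at this
      exact this.mono_left nhdsWithin_le_nhds
    simpa using ((hm.comp h1).const_mul C).const_mul |L|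
  refine squeeze_zero' (Eventually.of_forall fun _ => dist_nonneg) ?_ hlim
  have hnear : ∀ᶠ t in 𝓝[Ici 0] t0, |t - t0| ≤ 1 := by
    refine nhdsWithin_le_nhds ?_
    have : Icc (t0 - 1) (t0 + 1) ∈ 𝓝 t0 := Icc_mem_nhds (by linarith) (by linarith)
    filter_upwards [this] with t ht
    rw [abs_le]; constructor <;> linarith [ht.1, ht.2]
  filter_upwards [hnear, self_mem_nhdsWithin] with t ht1 ht2
  have ht2' : 0 ≤ t := ht2
  have ht0' : 0 ≤ t0 := ht0
  rw [Real.dist_eq]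
  rcases le_total t0 t with h | h
  · have h1 := key C t0 |t - t0| ht0' (hC t0 ⟨ht0', by linarith⟩) ⟨abs_nonneg _, ht1⟩
    rwa [abs_of_nonneg (sub_nonneg.2 h), sub_add_cancel, ← abs_of_nonneg (sub_nonneg.2 h)] at h1
  · have h1 := key C t |t - t0| ht2' (hC t ⟨ht2', by linarith⟩) ⟨abs_nonneg _, ht1⟩
    have h2 : |t - t0| + t = t0 := by rw [abs_of_nonpos (sub_nonpos.2 h)]; ring
    rw [h2] at h1
    rwa [abs_sub_comm]

/-- The laws `N(0, Q_t)` as a Markov kernel in `t` (constant for `t ≤ 0`). -/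
def noise (D : OUSetting H Hb K Ξ) : Kernel ℝ H where
  toFun t := gaussian (D.Q (max t 0))
  measurable' := by
    have hp : ∀ t : ℝ, IsProbabilityMeasure (gaussian (D.Q (max t 0))) := fun t =>
      D.isProbabilityMeasure_Q (le_max_right _ _)
    refine Measurable.measure_of_isPiSystem_of_isProbabilityMeasure (S := {s | IsClosed s})
      ((BorelSpace.measurable_eq).trans borel_eq_generateFrom_isClosed) isPiSystem_isClosed ?_
    intro F hF
    have hpos : ∀ n : ℕ, (0 : ℝ) < 1 / (n + 1) := fun n => Nat.one_div_pos_of_nat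
    refine measurable_of_tendsto_metrizable (f := fun (n : ℕ) (t : ℝ) =>
      ∫⁻ ω, (thickenedIndicator (hpos n) F ω : ENNReal) ∂(gaussian (D.Q (max t 0)))) ?_ ?_
    · intro n
      have h1 : ∀ t : ℝ, ∫⁻ ω, (thickenedIndicator (hpos n) F ω : ENNReal)
          ∂(gaussian (D.Q (max t 0))) =
          ENNReal.ofReal (∫ ω, (thickenedIndicator (hpos n) F ω : ℝ)
            ∂(gaussian (D.Q (max t 0)))) := by
        intro t
        rw [lintegral_coe_eq_integral]
        exact integrable_thickenedIndicator F (hpos n)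
      simp only [h1]
      refine ENNReal.measurable_ofReal.comp (Continuous.measurable ?_)
      have h2 := D.continuousOn_integral_gaussian_Q
        (φ := fun z => (thickenedIndicator (hpos n) F z : ℝ))
        (L := ((1 / ((n : ℝ) + 1)).toNNReal⁻¹ : NNReal)) (M := 1) (by fun_prop)
        (fun x y => by
          have := (lipschitzWith_thickenedIndicator (hpos n) F).dist_le_mul x y
          rwa [NNReal.dist_eq, dist_eq_norm] at this)
        (fun x => by
          rw [abs_of_nonneg (NNReal.coe_nonneg _)]
          exact_mod_cast thickenedIndicator_le_one (hpos n) F x)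
      exact h2.comp_continuous (by fun_prop) fun t => mem_Ici.2 (le_max_right _ _)
    · rw [tendsto_pi_nhds]
      intro t
      exact tendsto_lintegral_thickenedIndicator_of_isClosed _ hF hpos
        tendsto_one_div_add_atTop_nhds_zero_nat

instance instIsMarkovKernelNoise (D : OUSetting H Hb K Ξ) : IsMarkovKernel D.noise :=
  ⟨fun _ => D.isProbabilityMeasure_Q (le_max_right _ _)⟩

lemma noise_apply (D : OUSetting H Hb K Ξ) {t : ℝ} (ht : 0 ≤ t) :
    D.noise t = gaussian (D.Q t) := by
  have h : D.noise t = gaussian (D.Q (max t 0)) := rfl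
  rw [h, max_eq_left ht]

end OUSetting

/-! ### Borel functions that factor through a bounded operator -/

section Factor

variable {X E : Type*} [NormedAddCommGroup X] [NormedSpace ℝ X] [CompleteSpace X]
  [SecondCountableTopology X] [MeasurableSpace X] [BorelSpace X]
  [NormedAddCommGroup E] [NormedSpace ℝ E] [MeasurableSpace E] [BorelSpace E]
  [SecondCountableTopology E]

/-- A Borel function `φ` on a separable Banach space that factors through a bounded operator `U`
descends to a Borel function on the whole target space, extended by `0` off the range: the quotient
by `ker U` is Polish and embeds measurably (Lusin–Souslin). -/
lemma ContinuousLinearMap.measurable_extend_of_factor (U : X →L[ℝ] E) {φ : X → ℝ}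
    (hφ : Measurable φ) (hU : ∀ x x', U x = U x' → φ x = φ x') :
    Measurable (Function.extend U φ 0) := by
  set N : Submodule ℝ X := LinearMap.ker (U : X →ₗ[ℝ] E) with hN
  have hNc : IsClosed (N : Set X) := U.isClosed_ker
  let _ : MeasurableSpace (X ⧸ N) := borel _
  have : BorelSpace (X ⧸ N) := ⟨rfl⟩
  have hq : Continuous (N.mkQ : X → X ⧸ N) := continuous_quot_mk
  have hsurj : Function.Surjective (N.mkQ : X → X ⧸ N) := N.mkQ_surjective
  have hsep : TopologicalSpace.SeparableSpace (X ⧸ N) :=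
    hsurj.denseRange.separableSpace hq
  have hpol : PolishSpace (X ⧸ N) := by
    have : SecondCountableTopology (X ⧸ N) := UniformSpace.secondCountable_of_separable _
    infer_instance
  let V : X ⧸ N → E := N.liftQ (U : X →ₗ[ℝ] E) le_rfl
  have hV : ∀ x, V (N.mkQ x) = U x := fun x => rfl
  have hVc : Continuous V := N.isQuotientMap_mkQ.continuous_iff.2 U.continuous
  have hVi : Function.Injective V := by
    refine LinearMap.ker_eq_bot.1 ?_
    rw [Submodule.ker_liftQ, ← hN]
    exact Submodule.mkQ_map_self N
  have hemb := hVc.measurableEmbedding hVi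
  -- the Borel sets of the quotient are exactly those with Borel preimage
  let ψ : X ⧸ N → ℝ := fun p => φ (Function.surjInv hsurj p)
  have hψ : ∀ x, ψ (N.mkQ x) = φ x := fun x => by
    refine hU _ _ ?_
    rw [← hV, ← hV, Function.surjInv_eq hsurj]
  have hψm : Measurable ψ := by
    intro s hs
    have h1 := hq.map_eq_borel hsurj
    have h2 : MeasurableSet[MeasurableSpace.map (N.mkQ : X → X ⧸ N) ‹MeasurableSpace X›]
        (ψ ⁻¹' s) := by
      change MeasurableSet (N.mkQ ⁻¹' (ψ ⁻¹' s))
      have : N.mkQ ⁻¹' (ψ ⁻¹' s) = φ ⁻¹' s := by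
        ext x; simp only [mem_preimage, hψ]
      rw [this]
      exact hφ hs
    rw [h1] at h2
    exact h2
  have hext : Function.extend U φ 0 = Function.extend V ψ 0 := by
    funext z
    by_cases hz : ∃ x, U x = z
    · obtain ⟨x, rfl⟩ := hz
      rw [Function.FactorsThrough.extend_apply (fun a b h => hU a b h), ← hV,
        hVi.extend_apply, hψ]
    · rw [Function.extend_apply' _ _ _ hz, Function.extend_apply']
      rintro ⟨p, rfl⟩
      obtain ⟨x, rfl⟩ := hsurj p
      exact hz ⟨x, rfl⟩
  rw [hext]
  exact hemb.measurable_extend hψm measurable_zero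

end Factor

/-! ### The path space -/

lemma C0Semigroup.continuousOn_uncurry {E : Type*} [NormedAddCommGroup E] [NormedSpace ℝ E]
    [CompleteSpace E] (S : C0Semigroup E) :
    ContinuousOn (fun p : ℝ × E => S.op p.1 p.2) (Ici 0 ×ˢ univ) := by
  rintro ⟨t₀, x₀⟩ ⟨ht₀, -⟩
  have ht₀ : 0 ≤ t₀ := ht₀
  obtain ⟨M, hM0, hM⟩ := S.exists_bound (t₀ + 1)
  rw [ContinuousWithinAt, tendsto_iff_dist_tendsto_zero]
  have h1 : Tendsto (fun p : ℝ × E => S.op p.1 x₀) (𝓝[Ici 0 ×ˢ univ] (t₀, x₀))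
      (𝓝 (S.op t₀ x₀)) := by
    refine (S.continuousOn_op x₀ t₀ ht₀).tendsto.comp ?_
    refine tendsto_nhdsWithin_iff.2 ⟨(continuous_fst.tendsto _).mono_left nhdsWithin_le_nhds, ?_⟩
    filter_upwards [self_mem_nhdsWithin] with p hp using hp.1
  have h2 : Tendsto (fun p : ℝ × E => M * ‖p.2 - x₀‖ + dist (S.op p.1 x₀) (S.op t₀ x₀))
      (𝓝[Ici 0 ×ˢ univ] (t₀, x₀)) (𝓝 0) := by
    have h3 : Tendsto (fun p : ℝ × E => M * ‖p.2 - x₀‖) (𝓝[Ici 0 ×ˢ univ] (t₀, x₀))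
        (𝓝 (M * ‖x₀ - x₀‖)) :=
      ((by fun_prop : Continuous fun p : ℝ × E => M * ‖p.2 - x₀‖).tendsto _).mono_left
        nhdsWithin_le_nhds
    simpa using h3.add (tendsto_iff_dist_tendsto_zero.1 h1)
  refine squeeze_zero' (Eventually.of_forall fun _ => dist_nonneg) ?_ h2
  have hn : ∀ᶠ p : ℝ × E in 𝓝[Ici 0 ×ˢ univ] (t₀, x₀), p.1 ≤ t₀ + 1 := by
    refine nhdsWithin_le_nhds ?_
    exact (continuous_fst.tendsto (t₀, x₀)).eventually (Iic_mem_nhds (by simp))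
  filter_upwards [hn, self_mem_nhdsWithin] with p hp1 hp2
  refine (dist_triangle _ (S.op p.1 x₀) _).trans ?_
  gcongr
  rw [dist_eq_norm, ← map_sub]
  exact (S.op p.1).le_of_opNorm_le (hM _ ⟨hp2.1, hp1⟩) _

namespace OUSetting

variable {H Hb K Ξ : Type*}
  [NormedAddCommGroup H] [InnerProductSpace ℝ H] [CompleteSpace H] [SecondCountableTopology H]
  [NormedAddCommGroup Hb] [NormedSpace ℝ Hb]
  [NormedAddCommGroup K] [InnerProductSpace ℝ K]
  [NormedAddCommGroup Ξ] [InnerProductSpace ℝ Ξ] [CompleteSpace Ξ]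

lemma secondCountable_extension (D : OUSetting H Hb K Ξ) : SecondCountableTopology Hb := by
  have : TopologicalSpace.SeparableSpace Hb := D.ι_denseRange.separableSpace D.ι.continuous
  exact UniformSpace.secondCountable_of_separable _

instance (D : OUSetting H Hb K Ξ) : MeasurableSpace D.PathSpace := borel _

instance (D : OUSetting H Hb K Ξ) : BorelSpace D.PathSpace := ⟨rfl⟩

instance instLocallyCompactSpaceTimes : LocallyCompactSpace (Ioi (0 : ℝ)) :=
  isOpen_Ioi.locallyCompactSpace

instance (D : OUSetting H Hb K Ξ) : SecondCountableTopology D.PathSpace :=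
  inferInstanceAs (SecondCountableTopology (range D.path))

lemma PE_add (D : OUSetting H Hb K Ξ) {r τ : ℝ} (hr : 0 < r) (hτ : 0 ≤ τ) (x : Hb) :
    D.PE (r + τ) x = D.PE r (D.Sb.op τ x) := by
  rw [D.PE_eq hr (by linarith), add_sub_cancel_left]

lemma continuousOn_PE_uncurry [CompleteSpace Hb] (D : OUSetting H Hb K Ξ) :
    ContinuousOn (fun p : ℝ × Hb => D.PE p.1 p.2) (Ioi 0 ×ˢ univ) := by
  rintro ⟨t, x⟩ ⟨ht, -⟩
  have ht : 0 < t := ht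
  refine ContinuousAt.continuousWithinAt ?_
  have hc : ContinuousOn (fun p : ℝ × Hb => D.PE (t / 2) (D.Sb.op (p.1 - t / 2) p.2))
      (Ici (t / 2) ×ˢ univ) := by
    refine (D.PE (t / 2)).continuous.comp_continuousOn ?_
    refine D.Sb.continuousOn_uncurry.comp
      (f := fun p : ℝ × Hb => (p.1 - t / 2, p.2)) (by fun_prop) ?_
    rintro p ⟨hp, -⟩
    have hp : t / 2 ≤ p.1 := hp
    exact ⟨sub_nonneg.2 hp, trivial⟩
  have hc' : ContinuousOn (fun p : ℝ × Hb => D.PE p.1 p.2) (Ici (t / 2) ×ˢ univ) :=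
    hc.congr fun p hp => D.PE_eq (half_pos ht) hp.1 p.2
  exact hc'.continuousAt (prod_mem_nhds (Ici_mem_nhds (half_lt_self ht)) univ_mem)

lemma continuous_toPath [CompleteSpace Hb] (D : OUSetting H Hb K Ξ) : Continuous D.toPath := by
  refine Continuous.subtype_mk (f := D.path) ?_ _
  refine ContinuousMap.continuous_of_continuous_uncurry _ ?_
  exact D.continuousOn_PE_uncurry.comp_continuous
    (f := fun p : Hb × Ioi (0 : ℝ) => ((p.2 : ℝ), p.1)) (by fun_prop) fun p => ⟨p.2.2, trivial⟩

lemma toPath_surjective (D : OUSetting H Hb K Ξ) : Function.Surjective D.toPath := by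
  rintro ⟨_, x, rfl⟩
  exact ⟨x, rfl⟩

/-- The path of `x + v`, as a function of the path of `x`. -/
def addPath (D : OUSetting H Hb K Ξ) (y : D.PathSpace) (v : Hb) : D.PathSpace :=
  ⟨y.1 + D.path v, by
    obtain ⟨_, x, rfl⟩ := y
    exact ⟨x + v, ContinuousMap.ext fun r => map_add (D.PE r) x v⟩⟩

lemma addPath_toPath (D : OUSetting H Hb K Ξ) (x v : Hb) :
    D.addPath (D.toPath x) v = D.toPath (x + v) := by
  exact Subtype.ext (ContinuousMap.ext fun r => (map_add (D.PE r) x v).symm)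

lemma continuous_addPath [CompleteSpace Hb] (D : OUSetting H Hb K Ξ) :
    Continuous fun p : D.PathSpace × Hb => D.addPath p.1 p.2 := by
  refine Continuous.subtype_mk (f := fun p : D.PathSpace × Hb => p.1.1 + D.path p.2) ?_ _
  have h : Continuous fun v => D.path v := continuous_subtype_val.comp D.continuous_toPath
  exact (continuous_subtype_val.comp continuous_fst).add (h.comp continuous_snd)

/-- The time shift `r ↦ r + τ` of `(0, ∞)`, for `τ ≥ 0` (the identity for `τ < 0`). -/
def timeShift (τ : ℝ) : C(Ioi (0 : ℝ), Ioi (0 : ℝ)) where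
  toFun r := ⟨r + max τ 0,
    mem_Ioi.2 (add_pos_of_pos_of_nonneg (mem_Ioi.1 r.2) (le_max_right _ _))⟩
  continuous_toFun := Continuous.subtype_mk (by fun_prop) _

/-- The path of `e^{τA} x`, as a function of the path of `x`, for `τ ≥ 0`. -/
def shiftPath (D : OUSetting H Hb K Ξ) (τ : ℝ) (y : D.PathSpace) : D.PathSpace :=
  ⟨y.1.comp (timeShift τ), by
    obtain ⟨_, x, rfl⟩ := y
    exact ⟨D.Sb.op (max τ 0) x,
      ContinuousMap.ext fun r => (D.PE_add r.2 (le_max_right τ 0) x).symm⟩⟩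

lemma shiftPath_toPath (D : OUSetting H Hb K Ξ) {τ : ℝ} (hτ : 0 ≤ τ) (x : Hb) :
    D.shiftPath τ (D.toPath x) = D.toPath (D.Sb.op τ x) := by
  refine Subtype.ext (ContinuousMap.ext fun r => ?_)
  have h : D.PE (r + max τ 0) x = D.PE r (D.Sb.op τ x) := by
    rw [max_eq_left hτ, D.PE_add r.2 hτ x]
  exact h

lemma continuous_shiftPath (D : OUSetting H Hb K Ξ) :
    Continuous fun p : ℝ × D.PathSpace => D.shiftPath p.1 p.2 := by
  refine Continuous.subtype_mk
    (f := fun p : ℝ × D.PathSpace => p.2.1.comp (timeShift p.1)) ?_ _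
  have h : Continuous timeShift := by
    refine ContinuousMap.continuous_of_continuous_uncurry _ ?_
    exact Continuous.subtype_mk (f := fun p : ℝ × Ioi (0 : ℝ) => (p.2 : ℝ) + max p.1 0)
      (by fun_prop) fun p => (timeShift p.1 p.2).2
  exact (continuous_subtype_val.comp continuous_snd).compCM (h.comp continuous_fst)

lemma stopped_eq_iff (D : OUSetting H Hb K Ξ) {T : ℝ} (t : Ioc (0 : ℝ) T) (y y' : D.PathSpace) :
    D.stopped t y = D.stopped t y' ↔ ∀ r : Ioi (0 : ℝ), (r : ℝ) ≤ t → y.1 r = y'.1 r := by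
  constructor
  · intro h r hr
    have := congrFun h r
    simpa [stopped, min_eq_left hr] using this
  · intro h
    funext r
    exact h _ (min_le_right _ _)

/-! ### The lifting operators -/

lemma coeFn_Upsilon (D : OUSetting H Hb K Ξ) (s : ℝ) (x : Hb) :
    D.Upsilon s x =ᵐ[volume.restrict (Ioc 0 s)] fun t => D.PE t x :=
  MemLp.coeFn_toLp ((D.memLp_path s).choose_spec.2 x).1

lemma Upsilon_eq_iff (D : OUSetting H Hb K Ξ) {s : ℝ} (x x' : Hb) :
    D.Upsilon s x = D.Upsilon s x' ↔ ∀ r : Ioi (0 : ℝ), (r : ℝ) ≤ s →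
      (D.toPath x).1 r = (D.toPath x').1 r := by
  constructor
  · intro h r hr
    have h1 : (fun t => D.PE t x) =ᵐ[volume.restrict (Ioc 0 s)] fun t => D.PE t x' :=
      (D.coeFn_Upsilon s x).symm.trans (h ▸ D.coeFn_Upsilon s x')
    have h2 : EqOn (fun t => D.PE t x) (fun t => D.PE t x') (Ioc 0 s) := by
      refine Measure.eqOn_of_ae_eq h1 ((D.continuousOn_PE x).mono Ioc_subset_Ioi_self)
        ((D.continuousOn_PE x').mono Ioc_subset_Ioi_self) ?_
      rw [interior_Ioc, closure_Ioo (r.2.trans_le hr).ne]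
      exact Ioc_subset_Icc_self
    exact h2 ⟨r.2, hr⟩
  · intro h
    refine Lp.ext ((D.coeFn_Upsilon s x).trans (EventuallyEq.trans ?_ (D.coeFn_Upsilon s x').symm))
    refine (ae_restrict_iff' measurableSet_Ioc).2 (Eventually.of_forall fun r hr => ?_)
    exact h ⟨r, hr.1⟩ hr.2

lemma IsProgRep.congr {D : OUSetting H Hb K Ξ} {Z : Type*} [NormedAddCommGroup Z] [NormedSpace ℝ Z]
    {T η : ℝ} {f : ℝ → Hb → Z} {fhat : Ioc (0 : ℝ) T × D.PathSpace → Z}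
    (hf : D.IsProgRep T η f fhat) (s : Ioc (0 : ℝ) T) {y y' : D.PathSpace}
    (h : ∀ r : Ioi (0 : ℝ), (r : ℝ) ≤ s → y.1 r = y'.1 r) : fhat (s, y) = fhat (s, y') :=
  hf.2 s y y' ((D.stopped_eq_iff s y y').2 h)

/-- On the image of `Υ_{s'}`, `s' ≥ s`, a progressive function at time `s` is well defined. -/
lemma IsProgRep.eq_of_Upsilon_eq {D : OUSetting H Hb K Ξ} {T η : ℝ} {f : ℝ → Hb → ℝ}
    {fhat : Ioc (0 : ℝ) T × D.PathSpace → ℝ} (hf : D.IsProgRep T η f fhat) (s : Ioc (0 : ℝ) T)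
    {s' : ℝ} (hs : s ≤ s') {x x' : Hb} (h : D.Upsilon s' x = D.Upsilon s' x') :
    f s x = f s x' := by
  rw [hf.1.2.2, hf.1.2.2]
  exact hf.congr s fun r hr => (D.Upsilon_eq_iff x x').1 h r (hr.trans hs)

lemma onL2_eq_extend {D : OUSetting H Hb K Ξ} {T η : ℝ} {f : ℝ → Hb → ℝ}
    {fhat : Ioc (0 : ℝ) T × D.PathSpace → ℝ} (hf : D.IsProgRep T η f fhat) (s : Ioc (0 : ℝ) T) :
    D.onL2 fhat s = Function.extend (D.Upsilon s) (f s) 0 := by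
  classical
  funext z
  by_cases hz : ∃ x, D.Upsilon s x = z
  · have h : (s : ℝ) ∈ Ioc 0 T ∧ ∃ x, D.Upsilon s x = z := ⟨s.2, hz⟩
    rw [onL2, dif_pos h]
    conv_rhs => rw [← h.2.choose_spec]
    rw [Function.FactorsThrough.extend_apply (fun a b hab => hf.eq_of_Upsilon_eq s le_rfl hab)]
    exact (hf.1.2.2 _ _).symm
  · rw [Function.extend_apply' _ _ _ hz, onL2, dif_neg fun h => hz h.2]
    rfl

end OUSetting

/-! ### Singular integrals in time -/

lemma intervalIntegrable_rpow_mul_sub_rpow {a b t : ℝ} (ha : a < 1) (hb : b < 1) (ht : 0 < t) :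
    IntervalIntegrable (fun s : ℝ => s ^ (-a) * (t - s) ^ (-b)) volume 0 t := by
  have h1 : IntervalIntegrable (fun s : ℝ => s ^ (-a) * (t - s) ^ (-b)) volume 0 (t / 2) := by
    refine (intervalIntegral.intervalIntegrable_rpow' (by linarith)).mul_continuousOn ?_
    refine ContinuousOn.rpow_const (by fun_prop) fun s hs => Or.inl ?_
    rw [uIcc_of_le (by linarith)] at hs
    have := hs.2
    linarith
  have h2 : IntervalIntegrable (fun s : ℝ => s ^ (-a) * (t - s) ^ (-b)) volume (t / 2) t := by
    have h3 : IntervalIntegrable (fun s : ℝ => (t - s) ^ (-b)) volume (t / 2) t := by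
      have := (intervalIntegral.intervalIntegrable_rpow' (a := t / 2) (b := 0) (r := -b)
        (by linarith)).comp_sub_left t
      simpa [sub_half] using this
    refine h3.continuousOn_mul ?_
    refine ContinuousOn.rpow_const (by fun_prop) fun s hs => Or.inl ?_
    rw [uIcc_of_le (by linarith)] at hs
    have := hs.1
    linarith
  exact h1.trans h2

lemma integral_rpow_mul_sub_rpow {a b t : ℝ} (ha : a < 1) (hb : b < 1) (ht : 0 < t) :
    ∫ s in (0 : ℝ)..t, s ^ (-a) * (t - s) ^ (-b) =
      ProbabilityTheory.beta (1 - a) (1 - b) * t ^ (1 - a - b) := by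
  have h1 := Complex.betaIntegral_scaled ((1 - a : ℝ) : ℂ) ((1 - b : ℝ) : ℂ) ht
  have h2 : ∀ s ∈ uIcc 0 t, (s : ℂ) ^ (((1 - a : ℝ) : ℂ) - 1) *
      ((t : ℂ) - s) ^ (((1 - b : ℝ) : ℂ) - 1) = ((s ^ (-a) * (t - s) ^ (-b) : ℝ) : ℂ) := by
    intro s hs
    rw [uIcc_of_le ht.le] at hs
    rw [Complex.ofReal_mul, Complex.ofReal_cpow hs.1, Complex.ofReal_cpow (sub_nonneg.2 hs.2)]
    push_cast
    ring_nf
  rw [intervalIntegral.integral_congr h2, intervalIntegral.integral_ofReal] at h1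
  have h3 : (t : ℂ) ^ (((1 - a : ℝ) : ℂ) + ((1 - b : ℝ) : ℂ) - 1) =
      ((t ^ (1 - a - b) : ℝ) : ℂ) := by
    rw [Complex.ofReal_cpow ht.le]
    push_cast
    ring_nf
  rw [h3] at h1
  have h4 := congrArg Complex.re h1
  rw [Complex.re_ofReal_mul, Complex.ofReal_re,
    ← ProbabilityTheory.beta_eq_betaIntegralReal _ _ (by linarith) (by linarith)] at h4
  rw [h4, mul_comm]

/-- The function `τ ↦ (t - τ)₊^{-η}`. -/
def singKernel (η t τ : ℝ) : ℝ := if τ < t then (t - τ) ^ (-η) else 0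

lemma singKernel_nonneg (η t τ : ℝ) : 0 ≤ singKernel η t τ := by
  rw [singKernel]
  split_ifs with h
  · exact Real.rpow_nonneg (by linarith) _
  · exact le_rfl

lemma measurable_singKernel (η : ℝ) : Measurable fun p : ℝ × ℝ => singKernel η p.1 p.2 := by
  refine Measurable.ite (measurableSet_lt measurable_snd measurable_fst) ?_ measurable_const
  fun_prop

lemma integral_singKernel {β η t T : ℝ} (hβ : β < 1) (hη : η < 1) (ht : t ∈ Icc 0 T)
    (h0 : 0 < t ∨ β + η < 1) :
    IntegrableOn (fun τ => τ ^ (-β) * singKernel η t τ) (Ioc 0 T) ∧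
    ∫ τ in Ioc 0 T, τ ^ (-β) * singKernel η t τ =
      ProbabilityTheory.beta (1 - β) (1 - η) * t ^ (1 - β - η) := by
  have hind : (fun τ => τ ^ (-β) * singKernel η t τ) =
      (Iio t).indicator fun τ => τ ^ (-β) * (t - τ) ^ (-η) := by
    funext τ
    by_cases h : τ < t
    · rw [indicator_of_mem (mem_Iio.2 h), singKernel, if_pos h]
    · rw [indicator_of_notMem (by simpa using h), singKernel, if_neg h, mul_zero]
  have hset : Iio t ∩ Ioc 0 T = Ioo 0 t := by
    ext τ
    simp only [mem_inter_iff, mem_Iio, mem_Ioc, mem_Ioo]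
    exact ⟨fun h => ⟨h.2.1, h.1⟩, fun h => ⟨h.2, h.1, (h.2.le).trans ht.2⟩⟩
  rw [hind, IntegrableOn, integrable_indicator_iff measurableSet_Iio,
    integral_indicator measurableSet_Iio, IntegrableOn, Measure.restrict_restrict measurableSet_Iio,
    hset]
  rcases ht.1.eq_or_lt with h | h
  · subst h
    have : 1 - β - η ≠ 0 := by
      rcases h0 with h0 | h0
      · exact absurd h0 (lt_irrefl _)
      · linarith
    simp [Real.zero_rpow this]
  · rw [← integral_Ioc_eq_integral_Ioo, ← intervalIntegral.integral_of_le h.le,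
      integral_rpow_mul_sub_rpow hβ hη h]
    refine ⟨?_, rfl⟩
    have := (intervalIntegrable_iff_integrableOn_Ioo_of_le h.le).1
      (intervalIntegrable_rpow_mul_sub_rpow hβ hη h)
    exact this

lemma tendsto_singKernel {ι : Type*} {l : Filter ι} {t : ι → ℝ} {t₀ : ℝ}
    (ht : Tendsto t l (𝓝 t₀)) (η : ℝ) {τ : ℝ} (hτ : τ ≠ t₀) :
    Tendsto (fun i => singKernel η (t i) τ) l (𝓝 (singKernel η t₀ τ)) := by
  rcases lt_or_gt_of_ne hτ with h | h
  · have h1 : ∀ᶠ i in l, (t i - τ) ^ (-η) = singKernel η (t i) τ := by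
      filter_upwards [ht.eventually (Ioi_mem_nhds h)] with i hi
      rw [singKernel, if_pos (mem_Ioi.1 hi)]
    refine Tendsto.congr' h1 ?_
    rw [singKernel, if_pos h]
    exact (ht.sub_const τ).rpow_const (Or.inl (by linarith))
  · have h1 : ∀ᶠ i in l, 0 = singKernel η (t i) τ := by
      filter_upwards [ht.eventually (Iio_mem_nhds h)] with i hi
      rw [singKernel, if_neg (not_lt.2 (mem_Iio.1 hi).le)]
    refine Tendsto.congr' h1 ?_
    rw [singKernel, if_neg (not_lt.2 h.le)]
    exact tendsto_const_nhds

lemma ae_restrict_ne_and_mem {T t₀ : ℝ} {p : ℝ → Prop} (h : ∀ τ ∈ Ioc 0 T, τ ≠ t₀ → p τ) :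
    ∀ᵐ τ ∂(volume.restrict (Ioc 0 T)), p τ := by
  have h1 : ∀ᵐ τ ∂(volume.restrict (Ioc 0 T)), τ ≠ t₀ :=
    ae_restrict_of_ae (by simp [ae_iff])
  filter_upwards [h1, ae_restrict_mem measurableSet_Ioc] with τ h2 h3 using h τ h3 h2

/-- Scheffé's lemma for the kernels `τ ↦ τ^{-β} (t - τ)₊^{-η}` as `t → t₀`. -/
lemma tendsto_integral_abs_singKernel_sub {ι : Type*} {l : Filter ι} [l.IsCountablyGenerated]
    {T β η t₀ : ℝ} (hβ : β < 1) (hη : η < 1) (ht₀ : t₀ ∈ Icc 0 T)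
    (h0 : 0 < t₀ ∨ β + η < 1) {t : ι → ℝ} (ht : ∀ᶠ i in l, t i ∈ Icc 0 T)
    (htl : Tendsto t l (𝓝 t₀)) :
    Tendsto (fun i => ∫ τ in Ioc 0 T, τ ^ (-β) * |singKernel η (t i) τ - singKernel η t₀ τ|) l
      (𝓝 0) := by
  have hpos : ∀ᶠ i in l, 0 < t i ∨ β + η < 1 := by
    rcases h0 with h0 | h0
    · exact (htl.eventually (Ioi_mem_nhds h0)).mono fun i hi => Or.inl hi
    · exact Eventually.of_forall fun _ => Or.inr h0
  have hI₀ := integral_singKernel hβ hη ht₀ h0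
  have hm : ∀ t, Measurable fun τ => singKernel η t τ := fun t =>
    (measurable_singKernel η).comp (measurable_const.prodMk measurable_id)
  have hmβ : Measurable fun τ : ℝ => τ ^ (-β) := by fun_prop
  have hneg : Tendsto (fun i => ∫ τ in Ioc 0 T,
      τ ^ (-β) * max (singKernel η t₀ τ - singKernel η (t i) τ) 0) l
      (𝓝 (∫ τ in Ioc 0 T, (0 : ℝ))) := by
    refine tendsto_integral_filter_of_dominated_convergence
      (fun τ => τ ^ (-β) * singKernel η t₀ τ) (Eventually.of_forall fun i => ?_)
      (Eventually.of_forall fun i => ?_) hI₀.1 ?_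
    · exact (hmβ.mul (((hm _).sub (hm _)).max measurable_const)).aestronglyMeasurable
    · refine (ae_restrict_iff' measurableSet_Ioc).2 (Eventually.of_forall fun τ hτ => ?_)
      have h1 := singKernel_nonneg η (t i) τ
      have h2 := singKernel_nonneg η t₀ τ
      have h3 : 0 ≤ τ ^ (-β) := Real.rpow_nonneg hτ.1.le _
      rw [Real.norm_eq_abs, abs_of_nonneg (mul_nonneg h3 (le_max_right _ _))]
      refine mul_le_mul_of_nonneg_left (max_le (by linarith) h2) h3
    · refine ae_restrict_ne_and_mem (t₀ := t₀) fun τ hτ hne => ?_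
      have h1 := tendsto_singKernel htl η hne
      have := ((h1.const_sub (singKernel η t₀ τ)).max
        (tendsto_const_nhds (x := (0 : ℝ)))).const_mul (τ ^ (-β))
      simpa using this
  rw [integral_zero] at hneg
  have hmain : Tendsto (fun i => ∫ τ in Ioc 0 T, τ ^ (-β) * singKernel η (t i) τ) l
      (𝓝 (∫ τ in Ioc 0 T, τ ^ (-β) * singKernel η t₀ τ)) := by
    rw [hI₀.2]
    have h1 : Tendsto (fun i => ProbabilityTheory.beta (1 - β) (1 - η) * t i ^ (1 - β - η)) l
        (𝓝 (ProbabilityTheory.beta (1 - β) (1 - η) * t₀ ^ (1 - β - η))) := by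
      refine (htl.rpow_const ?_).const_mul _
      rcases h0 with h0 | h0
      · exact Or.inl h0.ne'
      · exact Or.inr (by linarith)
    refine h1.congr' ?_
    filter_upwards [ht, hpos] with i hi hi'
    rw [(integral_singKernel hβ hη hi hi').2]
  have hsum := (hmain.sub (tendsto_const_nhds
    (x := ∫ τ in Ioc 0 T, τ ^ (-β) * singKernel η t₀ τ))).add (hneg.const_mul 2)
  simp only [sub_self, mul_zero, add_zero] at hsum
  refine hsum.congr' ?_
  filter_upwards [ht, hpos] with i hi hi'
  have hI := (integral_singKernel hβ hη hi hi').1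
  have hIm : IntegrableOn (fun τ => τ ^ (-β) *
      max (singKernel η t₀ τ - singKernel η (t i) τ) 0) (Ioc 0 T) := by
    refine Integrable.mono hI₀.1
      (hmβ.mul (((hm _).sub (hm _)).max measurable_const)).aestronglyMeasurable ?_
    refine (ae_restrict_iff' measurableSet_Ioc).2 (Eventually.of_forall fun τ hτ => ?_)
    have h1 := singKernel_nonneg η (t i) τ
    have h2 := singKernel_nonneg η t₀ τ
    have h3 : 0 ≤ τ ^ (-β) := Real.rpow_nonneg hτ.1.le _
    rw [Real.norm_eq_abs, abs_of_nonneg (mul_nonneg h3 (le_max_right _ _)), Real.norm_eq_abs,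
      abs_of_nonneg (mul_nonneg h3 h2)]
    exact mul_le_mul_of_nonneg_left (max_le (by linarith) h2) h3
  have hd : IntegrableOn (fun τ => τ ^ (-β) * singKernel η (t i) τ -
      τ ^ (-β) * singKernel η t₀ τ) (Ioc 0 T) := hI.sub hI₀.1
  rw [← integral_sub hI hI₀.1, ← integral_const_mul, ← integral_add hd (hIm.const_mul 2)]
  refine integral_congr_ae (Eventually.of_forall fun τ => ?_)
  simp only
  rcases le_total (singKernel η (t i) τ) (singKernel η t₀ τ) with h | h
  · rw [max_eq_left (by linarith), abs_of_nonpos (by linarith)]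
    ring
  · rw [max_eq_right (by linarith), abs_of_nonneg (by linarith)]
    ring

/-- Convergence of integrals `∫ τ^{-β} bᵢ(τ) dτ` when `bᵢ` tends to `0` pointwise off `t₀` and is
dominated by the moving singularities `(tᵢ - τ)₊^{-η} + (t₀ - τ)₊^{-η}`. -/
lemma tendsto_integral_of_le_singKernel {ι : Type*} {l : Filter ι} [l.IsCountablyGenerated]
    {T β η t₀ M : ℝ} (hβ : β < 1) (hη : η < 1) (hM : 0 ≤ M) (ht₀ : t₀ ∈ Icc 0 T)
    (h0 : 0 < t₀ ∨ β + η < 1) {t : ι → ℝ} (ht : ∀ᶠ i in l, t i ∈ Icc 0 T)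
    (htl : Tendsto t l (𝓝 t₀)) {b : ι → ℝ → ℝ}
    (hbm : ∀ i, AEStronglyMeasurable (b i) (volume.restrict (Ioc 0 T)))
    (hb0 : ∀ i τ, 0 ≤ b i τ)
    (hb : ∀ i, ∀ τ ∈ Ioc 0 T, b i τ ≤ M * (singKernel η (t i) τ + singKernel η t₀ τ))
    (hlim : ∀ τ ∈ Ioc 0 T, τ ≠ t₀ → Tendsto (fun i => b i τ) l (𝓝 0)) :
    Tendsto (fun i => ∫ τ in Ioc 0 T, τ ^ (-β) * b i τ) l (𝓝 0) := by
  have hpos : ∀ᶠ i in l, 0 < t i ∨ β + η < 1 := by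
    rcases h0 with h0 | h0
    · exact (htl.eventually (Ioi_mem_nhds h0)).mono fun i hi => Or.inl hi
    · exact Eventually.of_forall fun _ => Or.inr h0
  have hI₀ := (integral_singKernel hβ hη ht₀ h0).1
  have hm : ∀ t, Measurable fun τ => singKernel η t τ := fun t =>
    (measurable_singKernel η).comp (measurable_const.prodMk measurable_id)
  have hmβ : Measurable fun τ : ℝ => τ ^ (-β) := by fun_prop
  set e : ι → ℝ → ℝ := fun i τ => M * |singKernel η (t i) τ - singKernel η t₀ τ| with he
  have hem : ∀ i, Measurable (e i) := fun i => by
    have := ((hm (t i)).sub (hm t₀)).abs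
    exact this.const_mul M
  have hpm : ∀ i, AEStronglyMeasurable (fun τ => τ ^ (-β) * max (b i τ - e i τ) 0)
      (volume.restrict (Ioc 0 T)) := fun i =>
    hmβ.aestronglyMeasurable.mul
      (((hbm i).sub (hem i).aestronglyMeasurable).sup aestronglyMeasurable_const)
  have hpb : ∀ i, ∀ τ ∈ Ioc 0 T, ‖τ ^ (-β) * max (b i τ - e i τ) 0‖ ≤
      (2 * M) * (τ ^ (-β) * singKernel η t₀ τ) := by
    intro i τ hτ
    have h3 : 0 ≤ τ ^ (-β) := Real.rpow_nonneg hτ.1.le _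
    have h2 := singKernel_nonneg η t₀ τ
    rw [Real.norm_eq_abs, abs_of_nonneg (mul_nonneg h3 (le_max_right _ _))]
    have h4 : max (b i τ - e i τ) 0 ≤ 2 * M * singKernel η t₀ τ := by
      refine max_le ?_ (by positivity)
      have h5 := hb i τ hτ
      have h6 := mul_le_mul_of_nonneg_left
        (le_abs_self (singKernel η (t i) τ - singKernel η t₀ τ)) hM
      simp only [he]
      linarith
    calc _ ≤ τ ^ (-β) * (2 * M * singKernel η t₀ τ) := mul_le_mul_of_nonneg_left h4 h3
      _ = _ := by ring
  have hp : Tendsto (fun i => ∫ τ in Ioc 0 T, τ ^ (-β) * max (b i τ - e i τ) 0) l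
      (𝓝 (∫ τ in Ioc 0 T, (0 : ℝ))) := by
    refine tendsto_integral_filter_of_dominated_convergence
      (fun τ => (2 * M) * (τ ^ (-β) * singKernel η t₀ τ)) (Eventually.of_forall hpm)
      (Eventually.of_forall fun i => ?_) (hI₀.const_mul _) ?_
    · exact (ae_restrict_iff' measurableSet_Ioc).2 (Eventually.of_forall (hpb i))
    · refine ae_restrict_ne_and_mem (t₀ := t₀) fun τ hτ hne => ?_
      have h1 := tendsto_singKernel htl η hne
      have h2 := (((hlim τ hτ hne).sub ((h1.sub_const (singKernel η t₀ τ)).abs.const_mul M)).max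
        (tendsto_const_nhds (x := (0 : ℝ)))).const_mul (τ ^ (-β))
      simpa using h2
  rw [integral_zero] at hp
  have hS := tendsto_integral_abs_singKernel_sub (T := T) hβ hη ht₀ h0 ht htl
  have hsum := hp.add (hS.const_mul M)
  simp only [mul_zero, add_zero] at hsum
  refine squeeze_zero' (Eventually.of_forall fun i => ?_) ?_ hsum
  · exact setIntegral_nonneg measurableSet_Ioc fun τ hτ =>
      mul_nonneg (Real.rpow_nonneg hτ.1.le _) (hb0 i τ)
  filter_upwards [ht, hpos] with i hi hi'
  have hI := (integral_singKernel hβ hη hi hi').1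
  have h1 : IntegrableOn (fun τ => τ ^ (-β) * max (b i τ - e i τ) 0) (Ioc 0 T) :=
    Integrable.mono' (hI₀.const_mul (2 * M)) (hpm i)
      ((ae_restrict_iff' measurableSet_Ioc).2 (Eventually.of_forall (hpb i)))
  have h2 : IntegrableOn (fun τ => τ ^ (-β) * |singKernel η (t i) τ - singKernel η t₀ τ|)
      (Ioc 0 T) := by
    refine Integrable.mono' (hI.add hI₀) (hmβ.mul ((hm _).sub (hm _)).abs).aestronglyMeasurable ?_
    refine (ae_restrict_iff' measurableSet_Ioc).2 (Eventually.of_forall fun τ hτ => ?_)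
    have h3 : 0 ≤ τ ^ (-β) := Real.rpow_nonneg hτ.1.le _
    rw [Real.norm_eq_abs, abs_of_nonneg (mul_nonneg h3 (abs_nonneg _)), Pi.add_apply, ← mul_add]
    refine mul_le_mul_of_nonneg_left ((abs_sub _ _).trans ?_) h3
    rw [abs_of_nonneg (singKernel_nonneg _ _ _), abs_of_nonneg (singKernel_nonneg _ _ _)]
  rw [← integral_const_mul, ← integral_add h1 (h2.const_mul M)]
  refine integral_mono_of_nonneg ?_ (h1.add (h2.const_mul M)) ?_
  · exact (ae_restrict_iff' measurableSet_Ioc).2 (Eventually.of_forall fun τ hτ =>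
      mul_nonneg (Real.rpow_nonneg hτ.1.le _) (hb0 i τ))
  · refine (ae_restrict_iff' measurableSet_Ioc).2 (Eventually.of_forall fun τ hτ => ?_)
    have h3 : 0 ≤ τ ^ (-β) := Real.rpow_nonneg hτ.1.le _
    have h4 : b i τ ≤ max (b i τ - e i τ) 0 + e i τ := by
      linarith [le_max_left (b i τ - e i τ) 0]
    calc τ ^ (-β) * b i τ ≤ τ ^ (-β) * (max (b i τ - e i τ) 0 + e i τ) :=
          mul_le_mul_of_nonneg_left h4 h3
      _ = _ := by simp only [he]; ring

/-! ### Difference quotients and Cauchy–Schwarz -/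

lemma abs_slope_sub_le {u v d A δ a : ℝ} (ha : a ≠ 0) (h : |u - v - a * d| ≤ A * |a| ^ (1 + δ)) :
    |a⁻¹ * (u - v) - d| ≤ A * |a| ^ δ := by
  have ha' : 0 < |a| := abs_pos.2 ha
  have h1 : a⁻¹ * (u - v) - d = a⁻¹ * (u - v - a * d) := by field_simp
  rw [h1, abs_mul, abs_inv]
  calc |a|⁻¹ * |u - v - a * d| ≤ |a|⁻¹ * (A * |a| ^ (1 + δ)) := by gcongr
    _ = A * |a| ^ δ := by
      rw [Real.rpow_add ha', Real.rpow_one]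
      field_simp

lemma tendsto_mul_abs_rpow {A δ : ℝ} (hδ : 0 < δ) :
    Tendsto (fun a : ℝ => A * |a| ^ δ) (𝓝 0) (𝓝 0) := by
  have h1 : Tendsto (fun a : ℝ => |a|) (𝓝 0) (𝓝 0) := by
    simpa using (continuous_abs.tendsto (0 : ℝ))
  have := (h1.rpow_const (p := δ) (Or.inr hδ.le)).const_mul A
  simpa [Real.zero_rpow hδ.ne'] using this

lemma tendsto_nat_slope {ψ : ℝ → ℝ} {v d A δ : ℝ} (hδ : 0 < δ)
    (h : ∀ a, |ψ a - v - a * d| ≤ A * |a| ^ (1 + δ)) :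
    Tendsto (fun n : ℕ => (1 / ((n : ℝ) + 1))⁻¹ * (ψ (1 / ((n : ℝ) + 1)) - v)) atTop (𝓝 d) := by
  rw [tendsto_iff_dist_tendsto_zero]
  refine squeeze_zero (fun _ => dist_nonneg) (fun n => ?_)
    ((tendsto_mul_abs_rpow (A := A) hδ).comp (tendsto_one_div_add_atTop_nhds_zero_nat (𝕜 := ℝ)))
  rw [Real.dist_eq]
  exact abs_slope_sub_le (Nat.one_div_pos_of_nat).ne' (h _)

/-- A remainder estimate of order `1 + δ` along `C` gives `C`-Fréchet differentiability. -/
lemma hasCFrechetDerivAt_of_le {X K : Type*} [NormedAddCommGroup X] [NormedSpace ℝ X]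
    [NormedAddCommGroup K] [NormedSpace ℝ K] {C : K →L[ℝ] X} {φ : X → ℝ} {L : K →L[ℝ] ℝ} {x : X}
    {A δ : ℝ} (hA : 0 ≤ A) (hδ : 0 < δ)
    (h : ∀ k, |φ (x + C k) - φ x - L k| ≤ A * ‖k‖ ^ (1 + δ)) : HasCFrechetDerivAt C φ L x := by
  have key : ∀ k : K, ∀ a : ℝ, a ≠ 0 →
      |a⁻¹ • (φ (x + a • C k) - φ x) - L k| ≤ A * ‖k‖ ^ (1 + δ) * |a| ^ δ := by
    intro k a ha
    refine abs_slope_sub_le ha ?_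
    have h1 := h (a • k)
    rw [map_smul, map_smul, norm_smul, smul_eq_mul, Real.norm_eq_abs,
      Real.mul_rpow (abs_nonneg a) (norm_nonneg k)] at h1
    exact h1.trans (le_of_eq (by ring))
  refine ⟨fun k => ?_, ?_⟩
  · rw [tendsto_iff_dist_tendsto_zero]
    refine squeeze_zero' (Eventually.of_forall fun _ => dist_nonneg) ?_
      ((tendsto_mul_abs_rpow (A := A * ‖k‖ ^ (1 + δ)) hδ).mono_left nhdsWithin_le_nhds)
    filter_upwards [self_mem_nhdsWithin] with a ha
    rw [Real.dist_eq]
    exact key k a ha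
  · rw [Metric.tendstoUniformlyOn_iff]
    intro ε hε
    have h1 : ∀ᶠ a : ℝ in 𝓝[≠] 0, A * |a| ^ δ < ε :=
      ((tendsto_mul_abs_rpow (A := A) hδ).mono_left nhdsWithin_le_nhds).eventually
        (Iio_mem_nhds hε)
    filter_upwards [h1, self_mem_nhdsWithin] with a ha ha' k hk
    rw [dist_comm, Real.dist_eq]
    refine (key k a ha').trans_lt (lt_of_le_of_lt ?_ ha)
    have h2 : ‖k‖ ^ (1 + δ) ≤ 1 := by
      refine Real.rpow_le_one (norm_nonneg _) (by simpa using hk) (by linarith)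
    have h3 : 0 ≤ |a| ^ δ := Real.rpow_nonneg (abs_nonneg _) _
    nlinarith [mul_nonneg hA h3]

lemma HasCFrechetDerivAt.cDeriv_eq {X K Z : Type*} [NormedAddCommGroup X] [NormedSpace ℝ X]
    [NormedAddCommGroup K] [NormedSpace ℝ K] [NormedAddCommGroup Z] [NormedSpace ℝ Z]
    {C : K →L[ℝ] X} {φ : X → Z} {L : K →L[ℝ] Z} {x : X}
    (h : HasCFrechetDerivAt C φ L x) : cDeriv C φ x = L := by
  have he : ∃ L, HasCFrechetDerivAt C φ L x := ⟨L, h⟩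
  rw [cDeriv, dif_pos he]
  ext k
  exact tendsto_nhds_unique (he.choose_spec.1 k) (h.1 k)

lemma MeasureTheory.Lp.abs_integral_mul_le {Ω : Type*} [MeasurableSpace Ω] {μ : Measure Ω}
    {f : Ω → ℝ} (hf : MemLp f 2 μ) (w : Lp ℝ 2 μ) :
    |∫ z, f z * w z ∂μ| ≤ √(∫ z, f z ^ 2 ∂μ) * ‖w‖ := by
  have h1 : ⟪w, hf.toLp f⟫_ℝ = ∫ z, f z * w z ∂μ := by
    rw [L2.inner_def]
    refine integral_congr_ae ?_
    filter_upwards [hf.coeFn_toLp] with z hz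
    rw [hz]
    simp
  have h2 : ‖hf.toLp f‖ = √(∫ z, f z ^ 2 ∂μ) := by
    have h3 : ⟪hf.toLp f, hf.toLp f⟫_ℝ = ∫ z, f z ^ 2 ∂μ := by
      rw [L2.inner_def]
      refine integral_congr_ae ?_
      filter_upwards [hf.coeFn_toLp] with z hz
      rw [hz]
      simp [sq]
    rw [← h3, real_inner_self_eq_norm_sq, Real.sqrt_sq (norm_nonneg _)]
  rw [← h1, ← h2, mul_comm]
  exact abs_real_inner_le_norm _ _

lemma sqrt_integral_sq_le {Ω : Type*} [MeasurableSpace Ω] {μ : Measure Ω} [IsProbabilityMeasure μ]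
    {f : Ω → ℝ} {B : ℝ} (hB : 0 ≤ B) (hf : ∀ z, |f z| ≤ B) : √(∫ z, f z ^ 2 ∂μ) ≤ B := by
  refine Real.sqrt_le_left hB |>.2 ?_ |>.trans_eq' rfl
  have h1 : ‖∫ z, f z ^ 2 ∂μ‖ ≤ B ^ 2 := by
    refine (norm_integral_le_of_norm_le_const (C := B ^ 2)
      (Eventually.of_forall fun z => ?_)).trans (by simp)
    rw [Real.norm_eq_abs, abs_pow]
    exact pow_le_pow_left₀ (abs_nonneg _) (hf z) 2
  exact (le_abs_self _).trans h1

lemma measurable_of_inner {α H : Type*} [MeasurableSpace α] [NormedAddCommGroup H]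
    [InnerProductSpace ℝ H] [CompleteSpace H] [SecondCountableTopology H] [MeasurableSpace H]
    [BorelSpace H] {F : α → H} (hF : ∀ y : H, Measurable fun s => ⟪y, F s⟫_ℝ) : Measurable F := by
  obtain ⟨w, b, -⟩ := exists_hilbertBasis ℝ H
  have : Countable w := b.countable_index
  refine measurable_of_tendsto_metrizable' (atTop : Filter (Finset w))
    (f := fun A s => ∑ i ∈ A, ⟪b i, F s⟫_ℝ • b i) (fun A => ?_) ?_
  · exact Finset.measurable_fun_sum _ fun i _ => (hF (b i)).smul_const _
  · rw [tendsto_pi_nhds]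
    intro s
    have := b.hasSum_repr (F s)
    simp only [b.repr_apply_apply] at this
    exact this

/-! ### Convolutions of path dependent kernels -/

namespace OUSetting

variable {H Hb K Ξ : Type*}
  [NormedAddCommGroup H] [InnerProductSpace ℝ H] [CompleteSpace H] [SecondCountableTopology H]
  [MeasurableSpace H] [BorelSpace H]
  [NormedAddCommGroup Hb] [NormedSpace ℝ Hb]
  [NormedAddCommGroup K] [InnerProductSpace ℝ K]
  [NormedAddCommGroup Ξ] [InnerProductSpace ℝ Ξ] [CompleteSpace Ξ] [SecondCountableTopology Ξ]

/-- A kernel `Φ(s, τ, y, z)`, the value at time `s` of the datum along the trajectory that starts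
on the path `y` and is observed after a delay `τ` with noise `z`. It has a singularity `s^{-η}` at
`s = 0`, is progressive in `y`, and its mean over the noise `N(0, Q_τ)` is differentiable along `C`
with an explicit weight in `L²(N(0, Q_τ))` of norm at most `κ τ^{-γ}`, which is the same for all
`s ≤ T - τ`. -/
structure PathKernel (D : OUSetting H Hb K Ξ) (T κ γ η M : ℝ)
    (Φ : ℝ → ℝ → D.PathSpace → H → ℝ) : Prop where
  T_pos : 0 < T
  κ_nonneg : 0 ≤ κ
  γ_nonneg : 0 ≤ γ
  γ_lt_one : γ < 1
  η_nonneg : 0 ≤ η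
  η_lt_one : η < 1
  M_nonneg : 0 ≤ M
  measurable : Measurable fun p : (ℝ × ℝ × D.PathSpace) × H => Φ p.1.1 p.1.2.1 p.1.2.2 p.2
  eq_zero : ∀ s τ y z, s ≤ 0 → Φ s τ y z = 0
  bound : ∀ s τ y z, 0 < s → |Φ s τ y z| ≤ M * s ^ (-η)
  prog : ∀ s τ, 0 < s → 0 < τ → s + τ ≤ T → ∀ y y' : D.PathSpace,
    (∀ r : Ioi (0 : ℝ), (r : ℝ) ≤ s + τ → y.1 r = y'.1 r) → Φ s τ y = Φ s τ y'
  smooth : ∀ τ, 0 < τ → τ < T → ∃ W : K →L[ℝ] Lp ℝ 2 (D.noise τ),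
    (∀ k, ‖W k‖ ≤ κ * τ ^ (-γ) * ‖k‖) ∧
    ∀ s, 0 < s → s + τ ≤ T → ∀ (y : D.PathSpace) (k : K) (δ : ℝ), 0 ≤ δ → δ ≤ 1 →
      |∫ z, Φ s τ (D.addPath y (D.C k)) z ∂(D.noise τ) - ∫ z, Φ s τ y z ∂(D.noise τ) -
        ∫ z, Φ s τ y z * W k z ∂(D.noise τ)| ≤
          3 * (M * s ^ (-η)) * (κ * τ ^ (-γ) * ‖k‖) ^ (1 + δ)

namespace PathKernel

variable {D : OUSetting H Hb K Ξ} {T κ γ η M : ℝ} {Φ : ℝ → ℝ → D.PathSpace → H → ℝ}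

lemma abs_le (h : D.PathKernel T κ γ η M Φ) (t τ : ℝ) (y : D.PathSpace) (z : H) :
    |Φ (t - τ) τ y z| ≤ M * singKernel η t τ := by
  rw [singKernel]
  split_ifs with ht
  · exact h.bound _ _ _ _ (sub_pos.2 ht)
  · rw [h.eq_zero _ _ _ _ (by linarith)]
    simp

lemma measurable_noise (h : D.PathKernel T κ γ η M Φ) (s τ : ℝ) (y : D.PathSpace) :
    Measurable (Φ s τ y) :=
  h.measurable.comp (g := fun p : (ℝ × ℝ × D.PathSpace) × H => Φ p.1.1 p.1.2.1 p.1.2.2 p.2)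
    (f := fun z : H => ((s, τ, y), z)) (measurable_const.prodMk measurable_id)

lemma memLp (h : D.PathKernel T κ γ η M Φ) (s τ : ℝ) (y : D.PathSpace) (p : ENNReal) :
    MemLp (Φ s τ y) p (D.noise τ) := by
  refine MemLp.of_bound (h.measurable_noise s τ y).aestronglyMeasurable
    (M * singKernel η (s + τ) τ) (Eventually.of_forall fun z => ?_)
  have := h.abs_le (s + τ) τ y z
  rwa [add_sub_cancel_right] at this

lemma integrable (h : D.PathKernel T κ γ η M Φ) (s τ : ℝ) (y : D.PathSpace) :
    Integrable (Φ s τ y) (D.noise τ) := memLp_one_iff_integrable.1 (h.memLp s τ y 1)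

lemma stronglyMeasurable_mean (h : D.PathKernel T κ γ η M Φ) :
    StronglyMeasurable fun p : ℝ × ℝ × D.PathSpace =>
      ∫ z, Φ p.1 p.2.1 p.2.2 z ∂(D.noise p.2.1) := by
  have := MeasureTheory.StronglyMeasurable.integral_kernel_prod_right'
    (κ := D.noise.comap (fun p : ℝ × ℝ × D.PathSpace => p.2.1) (by fun_prop))
    h.measurable.stronglyMeasurable
  simpa only [ProbabilityTheory.Kernel.comap_apply] using this

lemma abs_mean_le (h : D.PathKernel T κ γ η M Φ) (t τ : ℝ) (y : D.PathSpace) :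
    |∫ z, Φ (t - τ) τ y z ∂(D.noise τ)| ≤ M * singKernel η t τ := by
  rw [← Real.norm_eq_abs]
  exact (norm_integral_le_of_norm_le_const (Eventually.of_forall (h.abs_le t τ y))).trans
    (by simp)

lemma integrableOn_singKernel (h : D.PathKernel T κ γ η M Φ) {t : ℝ} (ht : t ∈ Icc 0 T) :
    IntegrableOn (fun τ => singKernel η t τ) (Ioc 0 T) := by
  have := (integral_singKernel (β := 0) (η := η) (T := T) (by norm_num) h.η_lt_one ht
    (Or.inr (by linarith [h.η_lt_one]))).1
  simpa using this

/-- The means `τ ↦ ∫ Φ(t - τ, τ, y, z) N(0, Q_τ)(dz)` are integrable on `(0, T]`. -/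
lemma integrableOn_mean (h : D.PathKernel T κ γ η M Φ) {t : ℝ} (ht : t ∈ Icc 0 T)
    (y : D.PathSpace) :
    IntegrableOn (fun τ => ∫ z, Φ (t - τ) τ y z ∂(D.noise τ)) (Ioc 0 T) := by
  refine Integrable.mono' ((h.integrableOn_singKernel ht).const_mul M) ?_
    (Eventually.of_forall fun τ => h.abs_mean_le t τ y)
  exact (h.stronglyMeasurable_mean.comp_measurable
    (g := fun τ : ℝ => (t - τ, τ, y)) (by fun_prop)).aestronglyMeasurable

open Classical in
/-- The weight that represents the derivative of the mean at delay `τ`. -/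
def weight (h : D.PathKernel T κ γ η M Φ) (τ : ℝ) : K →L[ℝ] Lp ℝ 2 (D.noise τ) :=
  if hτ : 0 < τ ∧ τ < T then (h.smooth τ hτ.1 hτ.2).choose else 0

lemma norm_weight_le (h : D.PathKernel T κ γ η M Φ) {τ : ℝ} (hτ : 0 < τ) (k : K) :
    ‖h.weight τ k‖ ≤ κ * τ ^ (-γ) * ‖k‖ := by
  by_cases hT : 0 < τ ∧ τ < T
  · rw [weight, dif_pos hT]
    exact (h.smooth τ hT.1 hT.2).choose_spec.1 k
  · rw [weight, dif_neg hT]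
    have := h.κ_nonneg
    simp only [_root_.zero_apply, norm_zero]
    positivity

lemma integrable_mul_weight (h : D.PathKernel T κ γ η M Φ) (s τ : ℝ) (y : D.PathSpace) (k : K) :
    Integrable (fun z => Φ s τ y z * h.weight τ k z) (D.noise τ) :=
  (h.memLp s τ y 2).integrable_mul (Lp.memLp (h.weight τ k))

/-- The derivative along `C k` of the mean at delay `τ`. -/
def sens (h : D.PathKernel T κ γ η M Φ) (s τ : ℝ) (y : D.PathSpace) (k : K) : ℝ :=
  ∫ z, Φ s τ y z * h.weight τ k z ∂(D.noise τ)

lemma sens_add (h : D.PathKernel T κ γ η M Φ) (s τ : ℝ) (y : D.PathSpace) (k k' : K) :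
    h.sens s τ y (k + k') = h.sens s τ y k + h.sens s τ y k' := by
  rw [sens, sens, sens, ← integral_add (h.integrable_mul_weight s τ y k)
    (h.integrable_mul_weight s τ y k'), map_add]
  refine integral_congr_ae ?_
  filter_upwards [Lp.coeFn_add (h.weight τ k) (h.weight τ k')] with z hz
  rw [hz, Pi.add_apply, mul_add]

lemma sens_smul (h : D.PathKernel T κ γ η M Φ) (s τ : ℝ) (y : D.PathSpace) (a : ℝ) (k : K) :
    h.sens s τ y (a • k) = a * h.sens s τ y k := by
  rw [sens, sens, ← integral_const_mul, map_smul]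
  refine integral_congr_ae ?_
  filter_upwards [Lp.coeFn_smul a (h.weight τ k)] with z hz
  rw [hz, Pi.smul_apply, smul_eq_mul]
  ring

lemma sens_eq_zero (h : D.PathKernel T κ γ η M Φ) {s : ℝ} (hs : s ≤ 0) (τ : ℝ) (y : D.PathSpace)
    (k : K) : h.sens s τ y k = 0 := by
  simp [sens, h.eq_zero s τ y _ hs]

lemma abs_sens_le (h : D.PathKernel T κ γ η M Φ) (t : ℝ) {τ : ℝ} (hτ : 0 < τ) (y : D.PathSpace)
    (k : K) : |h.sens (t - τ) τ y k| ≤ M * κ * ‖k‖ * (τ ^ (-γ) * singKernel η t τ) := by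
  refine (Lp.abs_integral_mul_le (h.memLp _ τ y 2) (h.weight τ k)).trans ?_
  have h1 := sqrt_integral_sq_le (μ := D.noise τ)
    (mul_nonneg h.M_nonneg (singKernel_nonneg η t τ)) (h.abs_le t τ y)
  calc _ ≤ M * singKernel η t τ * (κ * τ ^ (-γ) * ‖k‖) :=
        mul_le_mul h1 (h.norm_weight_le hτ k) (norm_nonneg _)
          (mul_nonneg h.M_nonneg (singKernel_nonneg η t τ))
    _ = _ := by ring

/-- First order expansion of the mean along `C`, with a remainder of order `1 + δ`. -/
lemma abs_mean_sub_le (h : D.PathKernel T κ γ η M Φ) {t τ : ℝ} (ht : t ≤ T) (hτ : 0 < τ)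
    (y : D.PathSpace) (k : K) {δ : ℝ} (hδ0 : 0 ≤ δ) (hδ1 : δ ≤ 1) :
    |∫ z, Φ (t - τ) τ (D.addPath y (D.C k)) z ∂(D.noise τ) - ∫ z, Φ (t - τ) τ y z ∂(D.noise τ) -
      h.sens (t - τ) τ y k| ≤
        3 * M * κ ^ (1 + δ) * ‖k‖ ^ (1 + δ) * (τ ^ (-(γ * (1 + δ))) * singKernel η t τ) := by
  have hκ := h.κ_nonneg
  by_cases hτt : τ < t
  · have hT : 0 < τ ∧ τ < T := ⟨hτ, hτt.trans_le ht⟩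
    have h1 := (h.smooth τ hT.1 hT.2).choose_spec.2 (t - τ) (sub_pos.2 hτt) (by linarith) y k δ
      hδ0 hδ1
    rw [sens, weight, dif_pos hT]
    refine h1.trans (le_of_eq ?_)
    rw [Real.mul_rpow (by positivity) (norm_nonneg _), Real.mul_rpow hκ (by positivity),
      ← Real.rpow_mul hτ.le, singKernel, if_pos hτt]
    ring_nf
  · have hs : t - τ ≤ 0 := by linarith
    simp only [h.eq_zero _ _ _ _ hs, h.sens_eq_zero hs, integral_zero, sub_zero, abs_zero]
    have := singKernel_nonneg η t τ
    have := h.M_nonneg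
    positivity

lemma aestronglyMeasurable_sens (h : D.PathKernel T κ γ η M Φ) {t : ℝ} (ht : t ≤ T)
    (y : D.PathSpace) (k : K) :
    AEStronglyMeasurable (fun τ => h.sens (t - τ) τ y k) (volume.restrict (Ioc 0 T)) := by
  refine aestronglyMeasurable_of_tendsto_ae (u := atTop)
    (f := fun (n : ℕ) τ => (1 / ((n : ℝ) + 1))⁻¹ *
      (∫ z, Φ (t - τ) τ (D.addPath y (D.C ((1 / ((n : ℝ) + 1)) • k))) z ∂(D.noise τ) -
        ∫ z, Φ (t - τ) τ y z ∂(D.noise τ))) (fun n => ?_) ?_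
  · have hm : ∀ y, AEStronglyMeasurable (fun τ => ∫ z, Φ (t - τ) τ y z ∂(D.noise τ))
        (volume.restrict (Ioc 0 T)) := fun y =>
      (h.stronglyMeasurable_mean.comp_measurable
        (g := fun τ : ℝ => (t - τ, τ, y)) (by fun_prop)).aestronglyMeasurable
    exact ((hm _).sub (hm _)).const_mul _
  · refine (ae_restrict_iff' measurableSet_Ioc).2 (Eventually.of_forall fun τ hτ => ?_)
    refine tendsto_nat_slope (δ := 1) (ψ := fun a =>
      ∫ z, Φ (t - τ) τ (D.addPath y (D.C (a • k))) z ∂(D.noise τ))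
      (A := 3 * M * κ ^ (1 + (1 : ℝ)) * ‖k‖ ^ (1 + (1 : ℝ)) *
        (τ ^ (-(γ * (1 + 1))) * singKernel η t τ)) one_pos fun a => ?_
    have h1 := h.abs_mean_sub_le ht hτ.1 y (a • k) zero_le_one le_rfl
    rw [h.sens_smul, norm_smul, Real.mul_rpow (norm_nonneg _) (norm_nonneg _),
      Real.norm_eq_abs] at h1
    exact h1.trans (le_of_eq (by ring))

lemma integrableOn_sens (h : D.PathKernel T κ γ η M Φ) {t : ℝ} (ht : t ∈ Ioc 0 T)
    (y : D.PathSpace) (k : K) :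
    IntegrableOn (fun τ => h.sens (t - τ) τ y k) (Ioc 0 T) := by
  have h1 := (integral_singKernel h.γ_lt_one h.η_lt_one ⟨ht.1.le, ht.2⟩ (Or.inl ht.1)).1
  refine Integrable.mono' (h1.const_mul (M * κ * ‖k‖)) (h.aestronglyMeasurable_sens ht.2 y k) ?_
  exact (ae_restrict_iff' measurableSet_Ioc).2 (Eventually.of_forall fun τ hτ =>
    h.abs_sens_le t hτ.1 y k)

/-- The bound on the derivative of the convolution at time `t`, before multiplication by `|k|`. -/
lemma abs_integral_sens_le (h : D.PathKernel T κ γ η M Φ) {t : ℝ} (ht : t ∈ Ioc 0 T)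
    (y : D.PathSpace) (k : K) :
    |∫ τ in Ioc 0 T, h.sens (t - τ) τ y k| ≤
      M * κ * (ProbabilityTheory.beta (1 - γ) (1 - η) * t ^ (1 - γ - η)) * ‖k‖ := by
  have h1 := integral_singKernel h.γ_lt_one h.η_lt_one ⟨ht.1.le, ht.2⟩ (Or.inl ht.1)
  have h2 := norm_integral_le_of_norm_le (f := fun τ => h.sens (t - τ) τ y k)
    (h1.1.const_mul (M * κ * ‖k‖))
    ((ae_restrict_iff' measurableSet_Ioc).2 (Eventually.of_forall fun τ hτ =>
      h.abs_sens_le t hτ.1 y k))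
  rw [integral_const_mul, h1.2] at h2
  exact h2.trans (le_of_eq (by ring))

/-- The convolution `∫_0^t ∫ Φ(t - τ, τ, y, z) N(0, Q_τ)(dz) dτ`; as `Φ` vanishes at nonpositive
times, the integral may be taken over `(0, T]`, `T ≥ t`. -/
def conv (_ : D.PathKernel T κ γ η M Φ) (t : ℝ) (y : D.PathSpace) : ℝ :=
  ∫ τ in Ioc 0 T, ∫ z, Φ (t - τ) τ y z ∂(D.noise τ)

open Classical in
/-- The derivative along `C` of the convolution at time `t`. -/
def grad (h : D.PathKernel T κ γ η M Φ) (t : ℝ) (y : D.PathSpace) : K →L[ℝ] ℝ :=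
  if ht : t ∈ Ioc 0 T then
    LinearMap.mkContinuous
      { toFun := fun k => ∫ τ in Ioc 0 T, h.sens (t - τ) τ y k
        map_add' := fun k k' => by
          rw [← integral_add (h.integrableOn_sens ht y k) (h.integrableOn_sens ht y k')]
          simp only [h.sens_add]
        map_smul' := fun a k => by
          rw [RingHom.id_apply, smul_eq_mul, ← integral_const_mul]
          simp only [h.sens_smul] }
      (M * κ * (ProbabilityTheory.beta (1 - γ) (1 - η) * t ^ (1 - γ - η)))
      fun k => h.abs_integral_sens_le ht y k
  else 0

lemma grad_apply (h : D.PathKernel T κ γ η M Φ) {t : ℝ} (ht : t ∈ Icc 0 T) (y : D.PathSpace)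
    (k : K) : h.grad t y k = ∫ τ in Ioc 0 T, h.sens (t - τ) τ y k := by
  rcases ht.1.eq_or_lt with h0 | h0
  · subst h0
    rw [grad, dif_neg (fun hh => lt_irrefl _ hh.1), _root_.zero_apply]
    refine (setIntegral_eq_zero_of_forall_eq_zero fun τ hτ => ?_).symm
    exact h.sens_eq_zero (by linarith [hτ.1]) _ _ _
  · rw [grad, dif_pos ⟨h0, ht.2⟩]
    rfl

lemma norm_grad_le (h : D.PathKernel T κ γ η M Φ) {t : ℝ} (ht : t ∈ Ioc 0 T) (y : D.PathSpace) :
    ‖h.grad t y‖ ≤ M * κ * (ProbabilityTheory.beta (1 - γ) (1 - η) * t ^ (1 - γ - η)) := by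
  have := h.M_nonneg
  have := h.κ_nonneg
  have := ProbabilityTheory.beta_pos (sub_pos.2 h.γ_lt_one) (sub_pos.2 h.η_lt_one)
  have := ht.1
  refine ContinuousLinearMap.opNorm_le_bound _ (by positivity) fun k => ?_
  rw [h.grad_apply ⟨ht.1.le, ht.2⟩]
  exact h.abs_integral_sens_le ht y k

/-- First order expansion of the convolution along `C`: the order `1 + δ` of the remainder is chosen
so close to `1` that the singularity `τ^{-γ(1+δ)}` remains integrable. -/
lemma exists_abs_conv_sub_le (h : D.PathKernel T κ γ η M Φ) {t : ℝ} (ht : t ∈ Icc 0 T) :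
    ∃ A δ : ℝ, 0 ≤ A ∧ 0 < δ ∧ ∀ (y : D.PathSpace) (k : K),
      |h.conv t (D.addPath y (D.C k)) - h.conv t y - h.grad t y k| ≤ A * ‖k‖ ^ (1 + δ) := by
  have hM := h.M_nonneg
  have hκ := h.κ_nonneg
  rcases ht.1.eq_or_lt with h0 | h0
  · subst h0
    refine ⟨0, 1, le_rfl, one_pos, fun y k => ?_⟩
    have hz : ∀ y, h.conv 0 y = 0 := fun y =>
      setIntegral_eq_zero_of_forall_eq_zero fun τ hτ => by
        simp only [h.eq_zero (0 - τ) τ _ _ (by linarith [hτ.1]), integral_zero]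
    rw [hz, hz, grad, dif_neg (fun hh => lt_irrefl _ hh.1)]
    simp
  set δ := 1 - γ with hδ
  have hδ0 : 0 < δ := sub_pos.2 h.γ_lt_one
  have hβ : γ * (1 + δ) < 1 := by nlinarith [sq_pos_of_pos hδ0]
  have hI := integral_singKernel hβ h.η_lt_one ht (Or.inl h0)
  set J := ∫ τ in Ioc 0 T, τ ^ (-(γ * (1 + δ))) * singKernel η t τ with hJ
  have hJ0 : 0 ≤ J := setIntegral_nonneg measurableSet_Ioc fun τ hτ =>
    mul_nonneg (Real.rpow_nonneg hτ.1.le _) (singKernel_nonneg _ _ _)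
  refine ⟨3 * M * κ ^ (1 + δ) * J, δ, by positivity, hδ0, fun y k => ?_⟩
  rw [h.grad_apply ht, conv, conv, ← integral_sub (h.integrableOn_mean ht _)
    (h.integrableOn_mean ht _)]
  have hd : IntegrableOn (fun τ =>
      ∫ z, Φ (t - τ) τ (D.addPath y (D.C k)) z ∂(D.noise τ) -
        ∫ z, Φ (t - τ) τ y z ∂(D.noise τ)) (Ioc 0 T) :=
    (h.integrableOn_mean ht _).sub (h.integrableOn_mean ht _)
  rw [← integral_sub hd (h.integrableOn_sens ⟨h0, ht.2⟩ y k)]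
  have h2 := norm_integral_le_of_norm_le
    (f := fun τ => ∫ z, Φ (t - τ) τ (D.addPath y (D.C k)) z ∂(D.noise τ) -
      ∫ z, Φ (t - τ) τ y z ∂(D.noise τ) - h.sens (t - τ) τ y k)
    (hI.1.const_mul (3 * M * κ ^ (1 + δ) * ‖k‖ ^ (1 + δ)))
    ((ae_restrict_iff' measurableSet_Ioc).2 (Eventually.of_forall fun τ hτ =>
      h.abs_mean_sub_le ht.2 hτ.1 y k hδ0.le (by linarith [h.γ_nonneg])))
  rw [integral_const_mul] at h2
  exact h2.trans (le_of_eq (by ring))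

lemma abs_conv_le (h : D.PathKernel T κ γ η M Φ) {t : ℝ} (ht : t ∈ Icc 0 T) (y : D.PathSpace) :
    |h.conv t y| ≤ M * (ProbabilityTheory.beta 1 (1 - η) * t ^ (1 - η)) := by
  have h1 := integral_singKernel (β := 0) (η := η) (T := T) (by norm_num) h.η_lt_one ht
    (Or.inr (by linarith [h.η_lt_one]))
  have h2 := norm_integral_le_of_norm_le (f := fun τ => ∫ z, Φ (t - τ) τ y z ∂(D.noise τ)) ((h.integrableOn_singKernel ht).const_mul M)
    (Eventually.of_forall fun τ => h.abs_mean_le t τ y)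
  rw [integral_const_mul] at h2
  simp only [neg_zero, Real.rpow_zero, one_mul, sub_zero] at h1
  rw [h1.2] at h2
  exact h2

lemma measurable_conv (h : D.PathKernel T κ γ η M Φ) :
    Measurable fun p : ℝ × D.PathSpace => h.conv p.1 p.2 := by
  have h1 : StronglyMeasurable fun q : (ℝ × D.PathSpace) × ℝ =>
      ∫ z, Φ (q.1.1 - q.2) q.2 q.1.2 z ∂(D.noise q.2) :=
    h.stronglyMeasurable_mean.comp_measurable
      (g := fun q : (ℝ × D.PathSpace) × ℝ => (q.1.1 - q.2, q.2, q.1.2)) (by fun_prop)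
  exact (h1.integral_prod_right' (ν := volume.restrict (Ioc 0 T))).measurable

lemma conv_congr (h : D.PathKernel T κ γ η M Φ) {t : ℝ} (ht : t ≤ T) {y y' : D.PathSpace}
    (hy : ∀ r : Ioi (0 : ℝ), (r : ℝ) ≤ t → y.1 r = y'.1 r) : h.conv t y = h.conv t y' := by
  refine setIntegral_congr_fun measurableSet_Ioc fun τ hτ => ?_
  have : Φ (t - τ) τ y = Φ (t - τ) τ y' := by
    rcases lt_or_ge τ t with h1 | h1
    · exact h.prog _ _ (sub_pos.2 h1) hτ.1 (by linarith) _ _ (by simpa using hy)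
    · funext z
      rw [h.eq_zero _ _ _ _ (by linarith), h.eq_zero _ _ _ _ (by linarith)]
  simp only [this]

lemma grad_congr (h : D.PathKernel T κ γ η M Φ) {t : ℝ} (ht : t ∈ Icc 0 T) {y y' : D.PathSpace}
    (hy : ∀ r : Ioi (0 : ℝ), (r : ℝ) ≤ t → y.1 r = y'.1 r) : h.grad t y = h.grad t y' := by
  ext k
  rw [h.grad_apply ht, h.grad_apply ht]
  refine setIntegral_congr_fun measurableSet_Ioc fun τ hτ => ?_
  have : Φ (t - τ) τ y = Φ (t - τ) τ y' := by
    rcases lt_or_ge τ t with h1 | h1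
    · exact h.prog _ _ (sub_pos.2 h1) hτ.1 (by linarith [ht.2]) _ _ (by simpa using hy)
    · funext z
      rw [h.eq_zero _ _ _ _ (by linarith), h.eq_zero _ _ _ _ (by linarith)]
  simp only [sens, this]

lemma measurable_grad_apply [CompleteSpace Hb] (h : D.PathKernel T κ γ η M Φ) (k : K) :
    Measurable fun p : Ioc (0 : ℝ) T × D.PathSpace => h.grad p.1 p.2 k := by
  have := D.secondCountable_extension
  refine measurable_of_tendsto_metrizable
    (f := fun (n : ℕ) (p : Ioc (0 : ℝ) T × D.PathSpace) => (1 / ((n : ℝ) + 1))⁻¹ *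
      (h.conv p.1 (D.addPath p.2 (D.C ((1 / ((n : ℝ) + 1)) • k))) - h.conv p.1 p.2))
    (fun n => ?_) ?_
  · have h1 : Measurable fun y : D.PathSpace => D.addPath y (D.C ((1 / ((n : ℝ) + 1)) • k)) :=
      (D.continuous_addPath.comp (continuous_id.prodMk continuous_const)).measurable
    refine Measurable.const_mul (Measurable.sub ?_ ?_) _
    · exact h.measurable_conv.comp
        ((measurable_subtype_coe.comp measurable_fst).prodMk (h1.comp measurable_snd))
    · exact h.measurable_conv.comp
        ((measurable_subtype_coe.comp measurable_fst).prodMk measurable_snd)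
  · rw [tendsto_pi_nhds]
    rintro ⟨t, y⟩
    obtain ⟨A, δ, -, hδ, hA⟩ := h.exists_abs_conv_sub_le ⟨t.2.1.le, t.2.2⟩
    refine tendsto_nat_slope (ψ := fun a => h.conv t (D.addPath y (D.C (a • k))))
      (A := A * ‖k‖ ^ (1 + δ)) hδ fun a => ?_
    have h1 := hA y (a • k)
    rw [map_smul (h.grad t y), norm_smul, Real.mul_rpow (norm_nonneg _) (norm_nonneg _),
      Real.norm_eq_abs a, smul_eq_mul] at h1
    exact h1.trans (le_of_eq (by ring))

end PathKernel

end OUSetting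

namespace OUSetting

variable {H Hb K Ξ : Type*}
  [NormedAddCommGroup H] [InnerProductSpace ℝ H] [CompleteSpace H] [SecondCountableTopology H]
  [MeasurableSpace H] [BorelSpace H]
  [NormedAddCommGroup Hb] [NormedSpace ℝ Hb]
  [NormedAddCommGroup K] [InnerProductSpace ℝ K]
  [NormedAddCommGroup Ξ] [InnerProductSpace ℝ Ξ] [CompleteSpace Ξ] [SecondCountableTopology Ξ]

namespace PathKernel

variable {D : OUSetting H Hb K Ξ} {T κ γ η M : ℝ} {Φ : ℝ → ℝ → D.PathSpace → H → ℝ}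

/-! ### Joint continuity of the convolution and of its derivative -/

/-- The `L²(N(0, Q_τ))`-distance between the values of the kernel at two times and paths, for the
same delay `τ`. -/
def gap (_ : D.PathKernel T κ γ η M Φ) (p q : ℝ × D.PathSpace) (τ : ℝ) : ℝ :=
  √(∫ z, (Φ (p.1 - τ) τ p.2 z - Φ (q.1 - τ) τ q.2 z) ^ 2 ∂(D.noise τ))

lemma gap_nonneg (h : D.PathKernel T κ γ η M Φ) (p q : ℝ × D.PathSpace) (τ : ℝ) :
    0 ≤ h.gap p q τ := Real.sqrt_nonneg _

lemma measurable_gap (h : D.PathKernel T κ γ η M Φ) (p q : ℝ × D.PathSpace) :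
    Measurable (h.gap p q) := by
  have hm : ∀ p : ℝ × D.PathSpace, Measurable fun w : ℝ × H => Φ (p.1 - w.1) w.1 p.2 w.2 :=
    fun p => h.measurable.comp (f := fun w : ℝ × H => ((p.1 - w.1, w.1, p.2), w.2)) (by fun_prop)
  have := MeasureTheory.StronglyMeasurable.integral_kernel_prod_right' (κ := D.noise)
    (((hm p).sub (hm q)).pow_const 2).stronglyMeasurable
  exact this.measurable.sqrt

lemma gap_le (h : D.PathKernel T κ γ η M Φ) (p q : ℝ × D.PathSpace) (τ : ℝ) :
    h.gap p q τ ≤ M * (singKernel η p.1 τ + singKernel η q.1 τ) := by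
  refine sqrt_integral_sq_le (mul_nonneg h.M_nonneg
    (add_nonneg (singKernel_nonneg _ _ _) (singKernel_nonneg _ _ _))) fun z => ?_
  refine (abs_sub _ _).trans ?_
  rw [mul_add]
  exact add_le_add (h.abs_le _ _ _ _) (h.abs_le _ _ _ _)

lemma abs_mean_sub_mean_le (h : D.PathKernel T κ γ η M Φ) (p q : ℝ × D.PathSpace) (τ : ℝ) :
    |∫ z, Φ (p.1 - τ) τ p.2 z ∂(D.noise τ) - ∫ z, Φ (q.1 - τ) τ q.2 z ∂(D.noise τ)| ≤
      h.gap p q τ := by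
  rw [← integral_sub (h.integrable _ _ _) (h.integrable _ _ _)]
  refine abs_integral_le_integral_abs.trans ?_
  exact integral_abs_le_sqrt ((h.memLp _ τ p.2 2).sub (h.memLp _ τ q.2 2))

lemma abs_sens_sub_sens_le (h : D.PathKernel T κ γ η M Φ) (p q : ℝ × D.PathSpace) {τ : ℝ}
    (hτ : 0 < τ) (k : K) :
    |h.sens (p.1 - τ) τ p.2 k - h.sens (q.1 - τ) τ q.2 k| ≤
      κ * ‖k‖ * (τ ^ (-γ) * h.gap p q τ) := by
  rw [sens, sens, ← integral_sub (h.integrable_mul_weight _ _ _ _)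
    (h.integrable_mul_weight _ _ _ _)]
  simp only [← sub_mul]
  refine (Lp.abs_integral_mul_le ((h.memLp _ τ p.2 2).sub (h.memLp _ τ q.2 2))
    (h.weight τ k)).trans ?_
  calc _ ≤ h.gap p q τ * (κ * τ ^ (-γ) * ‖k‖) :=
        mul_le_mul_of_nonneg_left (h.norm_weight_le hτ k) (Real.sqrt_nonneg _)
    _ = _ := by ring

/-- For a kernel that is continuous in time and path, the distance `gap` tends to zero, at every
delay except `τ = t₀`. -/
lemma tendsto_gap (h : D.PathKernel T κ γ η M Φ)
    (hc : ∀ τ, 0 < τ → τ < T → ∀ z,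
      ContinuousOn (fun p : ℝ × D.PathSpace => Φ p.1 τ p.2 z) (Ioc 0 T ×ˢ univ))
    {q : ℝ × D.PathSpace} (hq : q.1 ∈ Icc 0 T) {τ : ℝ} (hτ : 0 < τ) (hne : τ ≠ q.1) :
    Tendsto (fun p => h.gap p q τ) (𝓝[Icc 0 T ×ˢ univ] q) (𝓝 0) := by
  set l : Filter (ℝ × D.PathSpace) := 𝓝[Icc 0 T ×ˢ univ] q with hl
  have hfst : Tendsto (fun p : ℝ × D.PathSpace => p.1) l (𝓝 q.1) :=
    (continuous_fst.tendsto q).mono_left nhdsWithin_le_nhds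
  rcases lt_or_gt_of_ne hne with hlt | hgt
  · -- the noise law is fixed, so bounded convergence applies
    set r := (q.1 - τ) / 2 with hr
    have hr0 : 0 < r := half_pos (sub_pos.2 hlt)
    have hnear : ∀ᶠ p in l, r ≤ p.1 - τ := by
      filter_upwards [hfst.eventually (Ici_mem_nhds (show τ + r < q.1 by linarith))] with p hp
      have : τ + r ≤ p.1 := hp
      linarith
    set B := M * r ^ (-η) with hB
    have hB0 : 0 ≤ B := mul_nonneg h.M_nonneg (Real.rpow_nonneg hr0.le _)
    have hΦ : ∀ s y z, r ≤ s → |Φ s τ y z| ≤ B := fun s y z hs =>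
      (h.bound s τ y z (hr0.trans_le hs)).trans (mul_le_mul_of_nonneg_left
        (Real.rpow_le_rpow_of_nonpos hr0 hs (neg_nonpos.2 h.η_nonneg)) h.M_nonneg)
    have hlim : Tendsto (fun p : ℝ × D.PathSpace =>
        ∫ z, (Φ (p.1 - τ) τ p.2 z - Φ (q.1 - τ) τ q.2 z) ^ 2 ∂(D.noise τ)) l
        (𝓝 (∫ z, (0 : ℝ) ∂(D.noise τ))) := by
      refine tendsto_integral_filter_of_dominated_convergence (fun _ => (2 * B) ^ 2)
        (Eventually.of_forall fun p => ?_) ?_ (integrable_const _) ?_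
      · exact (((h.measurable_noise _ _ _).sub (h.measurable_noise _ _ _)).pow_const
          2).aestronglyMeasurable
      · filter_upwards [hnear] with p hp
        refine Eventually.of_forall fun z => ?_
        rw [Real.norm_eq_abs, abs_pow]
        refine pow_le_pow_left₀ (abs_nonneg _) ((abs_sub _ _).trans ?_) 2
        linarith [hΦ (p.1 - τ) p.2 z hp, hΦ (q.1 - τ) q.2 z (by linarith)]
      · refine Eventually.of_forall fun z => ?_
        have hcq : Tendsto (fun p : ℝ × D.PathSpace => Φ (p.1 - τ) τ p.2 z) l
            (𝓝 (Φ (q.1 - τ) τ q.2 z)) := by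
          have h1 := hc τ hτ (hlt.trans_le hq.2) z (q.1 - τ, q.2)
            ⟨⟨sub_pos.2 hlt, by linarith [hq.2]⟩, trivial⟩
          refine h1.tendsto.comp (f := fun p : ℝ × D.PathSpace => (p.1 - τ, p.2))
            (tendsto_nhdsWithin_iff.2 ⟨?_, ?_⟩)
          · exact ((by fun_prop : Continuous fun p : ℝ × D.PathSpace => (p.1 - τ, p.2)).tendsto
              q).mono_left nhdsWithin_le_nhds
          · filter_upwards [hnear, self_mem_nhdsWithin] with p hp hp'
            exact ⟨⟨by linarith, by linarith [hp'.1.2]⟩, trivial⟩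
        simpa using (hcq.sub_const (Φ (q.1 - τ) τ q.2 z)).pow 2
    rw [integral_zero] at hlim
    have := hlim.sqrt
    rwa [Real.sqrt_zero] at this
  · have h1 : ∀ᶠ p in l, 0 = h.gap p q τ := by
      filter_upwards [hfst.eventually (Iio_mem_nhds hgt)] with p hp
      have hp : p.1 < τ := hp
      rw [gap]
      simp only [h.eq_zero (p.1 - τ) τ _ _ (by linarith), h.eq_zero (q.1 - τ) τ _ _ (by linarith)]
      simp
    exact tendsto_const_nhds.congr' h1

lemma integrableOn_gap (h : D.PathKernel T κ γ η M Φ) {β : ℝ} (hβ : β < 1)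
    {p q : ℝ × D.PathSpace} (hp : p.1 ∈ Icc 0 T) (hq : q.1 ∈ Icc 0 T)
    (hp0 : 0 < p.1 ∨ β + η < 1) (hq0 : 0 < q.1 ∨ β + η < 1) :
    IntegrableOn (fun τ => τ ^ (-β) * h.gap p q τ) (Ioc 0 T) := by
  have h1 := (integral_singKernel hβ h.η_lt_one hp hp0).1
  have h2 := (integral_singKernel hβ h.η_lt_one hq hq0).1
  have hmβ : Measurable fun τ : ℝ => τ ^ (-β) := by fun_prop
  refine Integrable.mono' ((h1.add h2).const_mul M)
    (hmβ.mul (h.measurable_gap p q)).aestronglyMeasurable ?_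
  refine (ae_restrict_iff' measurableSet_Ioc).2 (Eventually.of_forall fun τ hτ => ?_)
  have h3 : 0 ≤ τ ^ (-β) := Real.rpow_nonneg hτ.1.le _
  rw [Real.norm_eq_abs, abs_of_nonneg (mul_nonneg h3 (h.gap_nonneg p q τ))]
  calc _ ≤ τ ^ (-β) * (M * (singKernel η p.1 τ + singKernel η q.1 τ)) :=
        mul_le_mul_of_nonneg_left (h.gap_le p q τ) h3
    _ = _ := by simp only [Pi.add_apply]; ring

lemma tendsto_integral_gap (h : D.PathKernel T κ γ η M Φ)
    (hc : ∀ τ, 0 < τ → τ < T → ∀ z,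
      ContinuousOn (fun p : ℝ × D.PathSpace => Φ p.1 τ p.2 z) (Ioc 0 T ×ˢ univ))
    {β : ℝ} (hβ : β < 1) {q : ℝ × D.PathSpace} (hq : q.1 ∈ Icc 0 T)
    (hq0 : 0 < q.1 ∨ β + η < 1) :
    Tendsto (fun p => ∫ τ in Ioc 0 T, τ ^ (-β) * h.gap p q τ) (𝓝[Icc 0 T ×ˢ univ] q) (𝓝 0) := by
  refine tendsto_integral_of_le_singKernel (t := fun p : ℝ × D.PathSpace => p.1) (t₀ := q.1)
    hβ h.η_lt_one h.M_nonneg hq hq0 ?_ ?_ (fun p => (h.measurable_gap p q).aestronglyMeasurable)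
    (fun p τ => h.gap_nonneg p q τ) (fun p τ _ => h.gap_le p q τ)
    (fun τ hτ hne => h.tendsto_gap hc hq hτ.1 hne)
  · filter_upwards [self_mem_nhdsWithin] with p hp using hp.1
  · exact (continuous_fst.tendsto q).mono_left nhdsWithin_le_nhds

lemma continuousOn_conv (h : D.PathKernel T κ γ η M Φ)
    (hc : ∀ τ, 0 < τ → τ < T → ∀ z,
      ContinuousOn (fun p : ℝ × D.PathSpace => Φ p.1 τ p.2 z) (Ioc 0 T ×ˢ univ)) :
    ContinuousOn (fun p : ℝ × D.PathSpace => h.conv p.1 p.2) (Icc 0 T ×ˢ univ) := by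
  rintro q ⟨hq, -⟩
  have hη : (0 : ℝ) + η < 1 := by linarith [h.η_lt_one]
  have hlim := h.tendsto_integral_gap hc one_pos hq (Or.inr hη)
  rw [ContinuousWithinAt, tendsto_iff_dist_tendsto_zero]
  refine squeeze_zero' (Eventually.of_forall fun _ => dist_nonneg) ?_ hlim
  filter_upwards [self_mem_nhdsWithin] with p hp
  rw [Real.dist_eq, conv, conv, ← integral_sub (h.integrableOn_mean hp.1 _)
    (h.integrableOn_mean hq _), ← Real.norm_eq_abs]
  refine norm_integral_le_of_norm_le
    (h.integrableOn_gap one_pos hp.1 hq (Or.inr hη) (Or.inr hη)) (Eventually.of_forall fun τ => ?_)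
  rw [neg_zero, Real.rpow_zero, one_mul]
  exact h.abs_mean_sub_mean_le p q τ

lemma continuousOn_grad (h : D.PathKernel T κ γ η M Φ)
    (hc : ∀ τ, 0 < τ → τ < T → ∀ z,
      ContinuousOn (fun p : ℝ × D.PathSpace => Φ p.1 τ p.2 z) (Ioc 0 T ×ˢ univ)) :
    ContinuousOn (fun p : ℝ × D.PathSpace => h.grad p.1 p.2) (Ioc 0 T ×ˢ univ) := by
  rintro q ⟨hq, -⟩
  have hq' : q.1 ∈ Icc 0 T := ⟨hq.1.le, hq.2⟩
  have hlim := ((h.tendsto_integral_gap hc h.γ_lt_one hq' (Or.inl hq.1)).const_mul κ).mono_left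
    (nhdsWithin_mono q (prod_mono_left Ioc_subset_Icc_self))
  rw [mul_zero] at hlim
  rw [ContinuousWithinAt, tendsto_iff_dist_tendsto_zero]
  refine squeeze_zero' (Eventually.of_forall fun _ => dist_nonneg) ?_ hlim
  filter_upwards [self_mem_nhdsWithin] with p hp
  have hp1 : p.1 ∈ Ioc 0 T := hp.1
  have hp' : p.1 ∈ Icc 0 T := ⟨hp1.1.le, hp1.2⟩
  have hI := h.integrableOn_gap h.γ_lt_one hp' hq' (Or.inl hp1.1) (Or.inl hq.1)
  rw [dist_eq_norm]
  refine ContinuousLinearMap.opNorm_le_bound _ (mul_nonneg h.κ_nonneg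
    (setIntegral_nonneg measurableSet_Ioc fun τ hτ =>
      mul_nonneg (Real.rpow_nonneg hτ.1.le _) (h.gap_nonneg p q τ))) fun k => ?_
  rw [_root_.sub_apply, h.grad_apply hp', h.grad_apply hq',
    ← integral_sub (h.integrableOn_sens hp1 _ _) (h.integrableOn_sens hq _ _)]
  refine (norm_integral_le_of_norm_le (hI.const_mul (κ * ‖k‖))
    ((ae_restrict_iff' measurableSet_Ioc).2 (Eventually.of_forall fun τ hτ => ?_))).trans ?_
  · exact h.abs_sens_sub_sens_le p q hτ.1 k
  · rw [integral_const_mul]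
    exact le_of_eq (by ring)

/-- A bound for `t^γ |∇^C g(t, ·)|`. -/
lemma rpow_mul_norm_grad_le (h : D.PathKernel T κ γ η M Φ) {t : ℝ} (ht : t ∈ Ioc 0 T)
    (y : D.PathSpace) :
    t ^ γ * ‖h.grad t y‖ ≤ M * κ * (ProbabilityTheory.beta (1 - γ) (1 - η) * T ^ (1 - η)) := by
  have hb := ProbabilityTheory.beta_pos (sub_pos.2 h.γ_lt_one) (sub_pos.2 h.η_lt_one)
  have hM := h.M_nonneg
  have hκ := h.κ_nonneg
  have h1 : t ^ γ * t ^ (1 - γ - η) = t ^ (1 - η) := by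
    rw [← Real.rpow_add ht.1]
    ring_nf
  calc t ^ γ * ‖h.grad t y‖
      ≤ t ^ γ * (M * κ * (ProbabilityTheory.beta (1 - γ) (1 - η) * t ^ (1 - γ - η))) :=
        mul_le_mul_of_nonneg_left (h.norm_grad_le ht y) (Real.rpow_nonneg ht.1.le _)
    _ = M * κ * (ProbabilityTheory.beta (1 - γ) (1 - η) * (t ^ γ * t ^ (1 - γ - η))) := by ring
    _ ≤ _ := by
      rw [h1]
      have := Real.rpow_le_rpow ht.1.le ht.2 (sub_nonneg.2 h.η_lt_one.le)
      gcongr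

lemma abs_conv_le_const (h : D.PathKernel T κ γ η M Φ) {t : ℝ} (ht : t ∈ Icc 0 T)
    (y : D.PathSpace) : |h.conv t y| ≤ M * (ProbabilityTheory.beta 1 (1 - η) * T ^ (1 - η)) := by
  have hb := ProbabilityTheory.beta_pos one_pos (sub_pos.2 h.η_lt_one)
  have hM := h.M_nonneg
  refine (h.abs_conv_le ht y).trans ?_
  have := Real.rpow_le_rpow ht.1 ht.2 (sub_nonneg.2 h.η_lt_one.le)
  gcongr

/-- The convolution as an integral over the time `s = t - τ`. -/
lemma conv_eq_intervalIntegral (h : D.PathKernel T κ γ η M Φ) {t : ℝ} (ht : t ∈ Icc 0 T)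
    (y : D.PathSpace) :
    IntervalIntegrable (fun s => ∫ z, Φ s (t - s) y z ∂(D.noise (t - s))) volume 0 t ∧
    h.conv t y = ∫ s in (0 : ℝ)..t, ∫ z, Φ s (t - s) y z ∂(D.noise (t - s)) := by
  have hI := h.integrableOn_mean ht y
  have h1 : IntervalIntegrable (fun τ => ∫ z, Φ (t - τ) τ y z ∂(D.noise τ)) volume 0 t :=
    (intervalIntegrable_iff_integrableOn_Ioc_of_le ht.1).2
      (hI.mono_set (Ioc_subset_Ioc_right ht.2))
  have h2 := h1.comp_sub_left t
  simp only [sub_sub_cancel, sub_zero, sub_self] at h2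
  refine ⟨h2.symm, ?_⟩
  have h3 := intervalIntegral.integral_comp_sub_left (a := 0) (b := t)
    (fun τ => ∫ z, Φ (t - τ) τ y z ∂(D.noise τ)) t
  simp only [sub_sub_cancel, sub_zero, sub_self] at h3
  rw [h3, intervalIntegral.integral_of_le ht.1, conv]
  refine (setIntegral_eq_of_subset_of_forall_sdiff_eq_zero measurableSet_Ioc
    (Ioc_subset_Ioc_right ht.2) fun τ hτ => ?_)
  have hτt : t < τ := by
    by_contra hh
    exact hτ.2 ⟨hτ.1.1, not_lt.1 hh⟩
  simp only [h.eq_zero (t - τ) τ _ _ (by linarith), integral_zero]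

/-- The derivative of the convolution as an integral over the time `s = t - τ`. -/
lemma grad_eq_intervalIntegral (h : D.PathKernel T κ γ η M Φ) {t : ℝ} (ht : t ∈ Icc 0 T)
    (y : D.PathSpace) (k : K) :
    IntervalIntegrable (fun s => h.sens s (t - s) y k) volume 0 t ∧
    h.grad t y k = ∫ s in (0 : ℝ)..t, h.sens s (t - s) y k := by
  rcases ht.1.eq_or_lt with h0 | h0
  · subst h0
    refine ⟨IntervalIntegrable.refl, ?_⟩
    rw [grad, dif_neg (fun hh => lt_irrefl _ hh.1)]
    simp
  have hI := h.integrableOn_sens ⟨h0, ht.2⟩ y k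
  have h1 : IntervalIntegrable (fun τ => h.sens (t - τ) τ y k) volume 0 t :=
    (intervalIntegrable_iff_integrableOn_Ioc_of_le ht.1).2
      (hI.mono_set (Ioc_subset_Ioc_right ht.2))
  have h2 := h1.comp_sub_left t
  simp only [sub_sub_cancel, sub_zero, sub_self] at h2
  refine ⟨h2.symm, ?_⟩
  have h3 := intervalIntegral.integral_comp_sub_left (a := 0) (b := t)
    (fun τ => h.sens (t - τ) τ y k) t
  simp only [sub_sub_cancel, sub_zero, sub_self] at h3
  rw [h3, intervalIntegral.integral_of_le ht.1, h.grad_apply ht]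
  refine (setIntegral_eq_of_subset_of_forall_sdiff_eq_zero measurableSet_Ioc
    (Ioc_subset_Ioc_right ht.2) fun τ hτ => ?_)
  have hτt : t < τ := by
    by_contra hh
    exact hτ.2 ⟨hτ.1.1, not_lt.1 hh⟩
  exact h.sens_eq_zero (by linarith) _ _ _

/-! ### Consequences for functions on the large space -/

variable [CompleteSpace Hb] [CompleteSpace K] [SecondCountableTopology K] {g : ℝ → Hb → ℝ}

lemma hasCFrechetDerivAt (h : D.PathKernel T κ γ η M Φ)
    (hg : ∀ t ∈ Icc 0 T, ∀ x, g t x = h.conv t (D.toPath x)) {t : ℝ} (ht : t ∈ Icc 0 T) (x : Hb) :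
    HasCFrechetDerivAt D.C (g t) (h.grad t (D.toPath x)) x := by
  obtain ⟨A, δ, hA0, hδ, hA⟩ := h.exists_abs_conv_sub_le ht
  refine hasCFrechetDerivAt_of_le hA0 hδ fun k => ?_
  rw [hg t ht, hg t ht, ← D.addPath_toPath]
  exact hA _ k

lemma cDeriv_eq (h : D.PathKernel T κ γ η M Φ)
    (hg : ∀ t ∈ Icc 0 T, ∀ x, g t x = h.conv t (D.toPath x)) {t : ℝ} (ht : t ∈ Icc 0 T) (x : Hb) :
    cDeriv D.C (g t) x = h.grad t (D.toPath x) :=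
  (h.hasCFrechetDerivAt hg ht x).cDeriv_eq

lemma cGrad_eq (h : D.PathKernel T κ γ η M Φ)
    (hg : ∀ t ∈ Icc 0 T, ∀ x, g t x = h.conv t (D.toPath x)) {t : ℝ} (ht : t ∈ Icc 0 T) (x : Hb) :
    cGrad D.C (g t) x = (InnerProductSpace.toDual ℝ K).symm (h.grad t (D.toPath x)) := by
  rw [cGrad, h.cDeriv_eq hg ht]

lemma measurable_riesz_grad (h : D.PathKernel T κ γ η M Φ) :
    @Measurable _ _ (borel _) (borel K) fun p : Ioc (0 : ℝ) T × D.PathSpace =>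
      (InnerProductSpace.toDual ℝ K).symm (h.grad p.1 p.2) := by
  let _ : MeasurableSpace K := borel K
  have : BorelSpace K := ⟨rfl⟩
  rw [← BorelSpace.measurable_eq (α := Ioc (0 : ℝ) T × D.PathSpace)]
  refine measurable_of_inner fun k => ?_
  have h1 : ∀ p : Ioc (0 : ℝ) T × D.PathSpace,
      ⟪k, (InnerProductSpace.toDual ℝ K).symm (h.grad p.1 p.2)⟫_ℝ = h.grad p.1 p.2 k := fun p => by
    rw [real_inner_comm, InnerProductSpace.toDual_symm_apply]
  simp only [h1]
  exact h.measurable_grad_apply k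

lemma sProg_cGrad (h : D.PathKernel T κ γ η M Φ)
    (hg : ∀ t ∈ Icc 0 T, ∀ x, g t x = h.conv t (D.toPath x)) :
    D.SProg T γ (fun t x => cGrad D.C (g t) x) := by
  refine ⟨fun p => (InnerProductSpace.toDual ℝ K).symm (h.grad p.1 p.2),
    ⟨h.measurable_riesz_grad,
      ⟨M * κ * (ProbabilityTheory.beta (1 - γ) (1 - η) * T ^ (1 - η)), fun p => ?_⟩, fun t x => ?_⟩, fun t y y' hy => ?_⟩
  · rw [norm_smul, LinearIsometryEquiv.norm_map, Real.norm_eq_abs,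
      abs_of_nonneg (Real.rpow_nonneg p.1.2.1.le _)]
    exact h.rpow_mul_norm_grad_le p.1.2 p.2
  · exact h.cGrad_eq hg ⟨t.2.1.le, t.2.2⟩ x
  · simp only
    rw [h.grad_congr ⟨t.2.1.le, t.2.2⟩ ((D.stopped_eq_iff t y y').1 hy)]

lemma sProg_rpow_smul_cGrad (h : D.PathKernel T κ γ η M Φ)
    (hg : ∀ t ∈ Icc 0 T, ∀ x, g t x = h.conv t (D.toPath x)) :
    D.SProg T 0 (fun t x => t ^ γ • cGrad D.C (g t) x) := by
  refine ⟨fun p => (p.1 : ℝ) ^ γ • (InnerProductSpace.toDual ℝ K).symm (h.grad p.1 p.2),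
    ⟨?_, ⟨M * κ * (ProbabilityTheory.beta (1 - γ) (1 - η) * T ^ (1 - η)), fun p => ?_⟩,
      fun t x => ?_⟩, fun t y y' hy => ?_⟩
  · have h1 := h.measurable_riesz_grad
    let _ : MeasurableSpace K := borel K
    have : BorelSpace K := ⟨rfl⟩
    rw [← BorelSpace.measurable_eq (α := Ioc (0 : ℝ) T × D.PathSpace)] at h1 ⊢
    exact ((measurable_subtype_coe.comp measurable_fst).pow_const γ).smul h1
  · rw [Real.rpow_zero, one_smul, norm_smul, LinearIsometryEquiv.norm_map, Real.norm_eq_abs,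
      abs_of_nonneg (Real.rpow_nonneg p.1.2.1.le _)]
    exact h.rpow_mul_norm_grad_le p.1.2 p.2
  · simp only
    rw [h.cGrad_eq hg ⟨t.2.1.le, t.2.2⟩ x]
  · simp only
    rw [h.grad_congr ⟨t.2.1.le, t.2.2⟩ ((D.stopped_eq_iff t y y').1 hy)]

lemma sProg_conv (h : D.PathKernel T κ γ η M Φ)
    (hg : ∀ t ∈ Icc 0 T, ∀ x, g t x = h.conv t (D.toPath x)) : D.SProg T 0 g := by
  refine ⟨fun p => h.conv p.1 p.2, ⟨?_,
    ⟨M * (ProbabilityTheory.beta 1 (1 - η) * T ^ (1 - η)), fun p => ?_⟩,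
      fun t x => ?_⟩, fun t y y' hy => ?_⟩
  · rw [← BorelSpace.measurable_eq (α := Ioc (0 : ℝ) T × D.PathSpace),
      ← BorelSpace.measurable_eq (α := ℝ)]
    exact h.measurable_conv.comp
      ((measurable_subtype_coe.comp measurable_fst).prodMk measurable_snd)
  · rw [Real.rpow_zero, one_smul]
    exact h.abs_conv_le_const ⟨p.1.2.1.le, p.1.2.2⟩ p.2
  · exact hg t ⟨t.2.1.le, t.2.2⟩ x
  · exact h.conv_congr t.2.2 ((D.stopped_eq_iff t y y').1 hy)

lemma continuousOn_of_conv (h : D.PathKernel T κ γ η M Φ)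
    (hg : ∀ t ∈ Icc 0 T, ∀ x, g t x = h.conv t (D.toPath x))
    (hc : ∀ τ, 0 < τ → τ < T → ∀ z,
      ContinuousOn (fun p : ℝ × D.PathSpace => Φ p.1 τ p.2 z) (Ioc 0 T ×ˢ univ)) :
    ContinuousOn (fun p : ℝ × Hb => g p.1 p.2) (Icc 0 T ×ˢ univ) := by
  have h1 : ContinuousOn (fun p : ℝ × Hb => h.conv p.1 (D.toPath p.2)) (Icc 0 T ×ˢ univ) :=
    (h.continuousOn_conv hc).comp (f := fun p : ℝ × Hb => (p.1, D.toPath p.2))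
      (continuous_fst.prodMk (D.continuous_toPath.comp continuous_snd)).continuousOn
      fun p hp => ⟨hp.1, trivial⟩
  exact h1.congr fun p hp => hg p.1 hp.1 p.2

lemma continuousOn_cDeriv (h : D.PathKernel T κ γ η M Φ)
    (hg : ∀ t ∈ Icc 0 T, ∀ x, g t x = h.conv t (D.toPath x))
    (hc : ∀ τ, 0 < τ → τ < T → ∀ z,
      ContinuousOn (fun p : ℝ × D.PathSpace => Φ p.1 τ p.2 z) (Ioc 0 T ×ˢ univ)) :
    ContinuousOn (fun p : ℝ × Hb => cDeriv D.C (g p.1) p.2) (Ioc 0 T ×ˢ univ) := by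
  have h1 : ContinuousOn (fun p : ℝ × Hb => h.grad p.1 (D.toPath p.2)) (Ioc 0 T ×ˢ univ) :=
    (h.continuousOn_grad hc).comp (f := fun p : ℝ × Hb => (p.1, D.toPath p.2))
      (continuous_fst.prodMk (D.continuous_toPath.comp continuous_snd)).continuousOn
      fun p hp => ⟨hp.1, trivial⟩
  exact h1.congr fun p hp => h.cDeriv_eq hg ⟨hp.1.1.le, hp.1.2⟩ p.2

lemma continuousOn_cGrad (h : D.PathKernel T κ γ η M Φ)
    (hg : ∀ t ∈ Icc 0 T, ∀ x, g t x = h.conv t (D.toPath x))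
    (hc : ∀ τ, 0 < τ → τ < T → ∀ z,
      ContinuousOn (fun p : ℝ × D.PathSpace => Φ p.1 τ p.2 z) (Ioc 0 T ×ˢ univ)) :
    ContinuousOn (fun p : ℝ × Hb => cGrad D.C (g p.1) p.2) (Ioc 0 T ×ˢ univ) :=
  (InnerProductSpace.toDual ℝ K).symm.continuous.comp_continuousOn (h.continuousOn_cDeriv hg hc)

lemma s1Prog (h : D.PathKernel T κ γ η M Φ)
    (hg : ∀ t ∈ Icc 0 T, ∀ x, g t x = h.conv t (D.toPath x))
    (hc : ∀ τ, 0 < τ → τ < T → ∀ z,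
      ContinuousOn (fun p : ℝ × D.PathSpace => Φ p.1 τ p.2 z) (Ioc 0 T ×ˢ univ)) :
    D.S1Prog T γ g := by
  have hcg := h.continuousOn_of_conv hg hc
  have hcd := h.continuousOn_cDeriv hg hc
  have hbd : ∀ t ∈ Icc 0 T, ∀ x, |g t x| ≤
      M * (ProbabilityTheory.beta 1 (1 - η) * T ^ (1 - η)) := fun t ht x => by
    rw [hg t ht]
    exact h.abs_conv_le_const ht _
  refine ⟨h.sProg_conv hg, ⟨?_, ⟨_, fun t ht x => hbd t ht (D.ι x)⟩, ?_,
    ⟨_, fun t ht x => hbd t ⟨ht.1.le, ht.2⟩ x⟩, ?_, ?_, ?_, ?_⟩, h.sProg_rpow_smul_cGrad hg⟩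
  · exact hcg.comp (f := fun p : ℝ × H => (p.1, D.ι p.2)) (by fun_prop) fun p hp => ⟨hp.1, trivial⟩
  · exact hcg.mono (prod_mono_left Ioc_subset_Icc_self)
  · exact fun t ht x => ⟨_, h.hasCFrechetDerivAt hg ⟨ht.1.le, ht.2⟩ x⟩
  · refine fun t ht => ⟨?_,
      ⟨M * κ * (ProbabilityTheory.beta (1 - γ) (1 - η) * t ^ (1 - γ - η)), fun x => ?_⟩⟩
    · exact hcd.comp_continuous (f := fun x : Hb => (t, x)) (by fun_prop) fun x => ⟨ht, trivial⟩
    · rw [h.cDeriv_eq hg ⟨ht.1.le, ht.2⟩]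
      exact h.norm_grad_le ht _
  · have hr : ContinuousOn (fun p : ℝ × Hb => p.1 ^ γ) (Ioc 0 T ×ˢ univ) :=
      ContinuousOn.rpow_const (by fun_prop) fun p hp => Or.inl hp.1.1.ne'
    exact hr.smul hcd
  · refine ⟨M * κ * (ProbabilityTheory.beta (1 - γ) (1 - η) * T ^ (1 - η)), fun t ht x => ?_⟩
    rw [h.cDeriv_eq hg ⟨ht.1.le, ht.2⟩, norm_smul, Real.norm_eq_abs,
      abs_of_nonneg (Real.rpow_nonneg ht.1.le _)]
    exact h.rpow_mul_norm_grad_le ht _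

end PathKernel

end OUSetting

instance instSecondCountableTopologyL2Path (H : Type*) [NormedAddCommGroup H]
    [SecondCountableTopology H] (s : ℝ) : SecondCountableTopology (L2Path H s) := by
  have : Fact ((2 : ENNReal) ≠ ⊤) := ⟨by norm_num⟩
  exact Lp.SecondCountableTopology

lemma integral_mul_weight_smul {Ω K : Type*} [MeasurableSpace Ω] {μ : Measure Ω}
    [NormedAddCommGroup K] [NormedSpace ℝ K] (W : K →L[ℝ] Lp ℝ 2 μ) (φ : Ω → ℝ) (a : ℝ) (k : K) :
    ∫ z, φ z * W (a • k) z ∂μ = a * ∫ z, φ z * W k z ∂μ := by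
  rw [← integral_const_mul, map_smul]
  refine integral_congr_ae ?_
  filter_upwards [Lp.coeFn_smul a (W k)] with z hz
  rw [hz, Pi.smul_apply, smul_eq_mul]
  ring

/-- The weighted supremum `sup |t^η f(t, x)|` over `(0, T] × X`. -/
def weightedSup {X : Type*} (T η : ℝ) (f : ℝ → X → ℝ) : ℝ :=
  ⨆ p : Ioc (0 : ℝ) T × X, |(p.1 : ℝ) ^ η * f p.1 p.2|

lemma weightedSup_nonneg {X : Type*} (T η : ℝ) (f : ℝ → X → ℝ) : 0 ≤ weightedSup T η f :=
  Real.iSup_nonneg fun _ => abs_nonneg _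

namespace OUSetting

variable {H Hb K Ξ : Type*}
  [NormedAddCommGroup H] [InnerProductSpace ℝ H] [CompleteSpace H] [SecondCountableTopology H]
  [MeasurableSpace H] [BorelSpace H]
  [NormedAddCommGroup Hb] [NormedSpace ℝ Hb] [CompleteSpace Hb]
  [NormedAddCommGroup K] [InnerProductSpace ℝ K]
  [NormedAddCommGroup Ξ] [InnerProductSpace ℝ Ξ] [CompleteSpace Ξ] [SecondCountableTopology Ξ]
  {D : OUSetting H Hb K Ξ} {T η : ℝ} {f : ℝ → Hb → ℝ}
  {fhat : Ioc (0 : ℝ) T × D.PathSpace → ℝ}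

/-! ### Path dependent data as a kernel -/

lemma IsPathRep.abs_le (hf : D.IsPathRep T η f fhat) {s : ℝ} (hs : s ∈ Ioc 0 T) (x : Hb) :
    |f s x| ≤ weightedSup T η f * s ^ (-η) := by
  obtain ⟨-, ⟨M, hM⟩, hrep⟩ := hf
  have hbdd : BddAbove (range fun p : Ioc (0 : ℝ) T × Hb => |(p.1 : ℝ) ^ η * f p.1 p.2|) := by
    refine ⟨M, ?_⟩
    rintro _ ⟨p, rfl⟩
    have := hM (p.1, D.toPath p.2)
    rwa [← hrep, smul_eq_mul, Real.norm_eq_abs] at this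
  have h1 : |s ^ η * f s x| ≤ weightedSup T η f := le_ciSup hbdd (⟨s, hs⟩, x)
  have hpos : 0 < s ^ η := Real.rpow_pos_of_pos hs.1 _
  rw [abs_mul, abs_of_pos hpos] at h1
  rw [Real.rpow_neg hs.1.le, ← div_eq_mul_inv, le_div_iff₀ hpos, mul_comm]
  exact h1

open Classical in
/-- The kernel of the convolution of a path dependent datum: the value of `fhat(s, ·)`, extended by
`0` to all times `s`, on the path of `e^{τA} x + z`, where `y` is the path of `x`. -/
def pathKernel (D : OUSetting H Hb K Ξ) {T : ℝ} (fhat : Ioc (0 : ℝ) T × D.PathSpace → ℝ)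
    (s τ : ℝ) (y : D.PathSpace) (z : H) : ℝ :=
  if hs : s ∈ Ioc 0 T then fhat (⟨s, hs⟩, D.addPath (D.shiftPath τ y) (D.ι z)) else 0

lemma IsPathRep.pathKernel_toPath (hf : D.IsPathRep T η f fhat) {s τ : ℝ} (hs : s ∈ Ioc 0 T)
    (hτ : 0 ≤ τ) (x : Hb) (z : H) :
    D.pathKernel fhat s τ (D.toPath x) z = f s (D.ι z + D.Sb.op τ x) := by
  rw [pathKernel, dif_pos hs, D.shiftPath_toPath hτ, D.addPath_toPath, add_comm]
  exact (hf.2.2 ⟨s, hs⟩ _).symm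

lemma IsPathRep.measurable (hf : D.IsPathRep T η f fhat) : Measurable fhat := by
  have := hf.1
  rwa [← BorelSpace.measurable_eq (α := Ioc (0 : ℝ) T × D.PathSpace),
    ← BorelSpace.measurable_eq (α := ℝ)] at this

lemma IsPathRep.measurable_pathKernel (hf : D.IsPathRep T η f fhat) :
    Measurable fun p : (ℝ × ℝ × D.PathSpace) × H =>
      D.pathKernel fhat p.1.1 p.1.2.1 p.1.2.2 p.2 := by
  classical
  have hc : Continuous fun p : (ℝ × ℝ × D.PathSpace) × H =>
      D.addPath (D.shiftPath p.1.2.1 p.1.2.2) (D.ι p.2) :=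
    D.continuous_addPath.comp
      ((D.continuous_shiftPath.comp (continuous_snd.comp continuous_fst)).prodMk
        (D.ι.continuous.comp continuous_snd))
  let A : Set ((ℝ × ℝ × D.PathSpace) × H) := {p | p.1.1 ∈ Ioc 0 T}
  have hA : MeasurableSet A :=
    (measurable_fst.comp measurable_fst) (measurableSet_Ioc (a := (0 : ℝ)) (b := T))
  have hg : Measurable fun p : A =>
      fhat (⟨p.1.1.1, p.2⟩, D.addPath (D.shiftPath p.1.1.2.1 p.1.1.2.2) (D.ι p.1.2)) := by
    refine hf.measurable.comp (Measurable.prodMk (Measurable.subtype_mk ?_) ?_)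
    · exact (measurable_fst.comp measurable_fst).comp measurable_subtype_coe
    · exact hc.measurable.comp measurable_subtype_coe
  exact Measurable.dite (g := fun _ => (0 : ℝ)) hg measurable_const hA

/-- The extension of `f(s, ·)` from the image of `Υ_{s'}` to `L²(0, s'; H)`, for `s ≤ s'`. -/
lemma IsProgRep.measurable_extend (hf : D.IsProgRep T η f fhat) {s s' : ℝ} (hs : s ∈ Ioc 0 T)
    (hss : s ≤ s') : Measurable (Function.extend (D.Upsilon s') (f s) 0) := by
  have := D.secondCountable_extension
  let _ : MeasurableSpace Hb := borel Hb
  have : BorelSpace Hb := ⟨rfl⟩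
  refine (D.Upsilon s').measurable_extend_of_factor ?_ fun x x' h =>
    hf.eq_of_Upsilon_eq ⟨s, hs⟩ hss h
  have h1 : f s = fun x => fhat (⟨s, hs⟩, D.toPath x) := funext fun x => hf.1.2.2 ⟨s, hs⟩ x
  rw [h1]
  exact hf.1.measurable.comp (measurable_const.prodMk D.continuous_toPath.measurable)

lemma IsProgRep.extend_Upsilon (hf : D.IsProgRep T η f fhat) {s s' : ℝ} (hs : s ∈ Ioc 0 T)
    (hss : s ≤ s') (x : Hb) :
    Function.extend (D.Upsilon s') (f s) 0 (D.Upsilon s' x) = f s x :=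
  Function.FactorsThrough.extend_apply
    (fun _ _ h => hf.eq_of_Upsilon_eq ⟨s, hs⟩ hss h) _ _

lemma IsProgRep.abs_extend_le (hf : D.IsProgRep T η f fhat) {s s' : ℝ} (hs : s ∈ Ioc 0 T)
    (hss : s ≤ s') (u : L2Path H s') :
    |Function.extend (D.Upsilon s') (f s) 0 u| ≤ weightedSup T η f * s ^ (-η) := by
  by_cases hu : ∃ x, D.Upsilon s' x = u
  · obtain ⟨x, rfl⟩ := hu
    rw [hf.extend_Upsilon hs hss]
    exact hf.1.abs_le hs x
  · rw [Function.extend_apply' _ _ _ hu, Pi.zero_apply, abs_zero]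
    exact mul_nonneg (weightedSup_nonneg T η f) (Real.rpow_nonneg hs.1.le _)

/-- Smoothing by the noise over a delay `τ`, observed through the paths on `(0, s']`. The same
weight serves all the times `s ≤ s'`, as a progressive `f(s, ·)` factors through `Υ_{s'}`. -/
lemma IsProgRep.exists_weight (hf : D.IsProgRep T η f fhat) {T₁ κ γ : ℝ}
    (hL : D.LiftedControllability T₁ κ γ) {s' τ : ℝ} (hs' : 0 < s') (hτ : 0 < τ)
    (hT₁ : s' + τ ≤ T₁) :
    ∃ W : K →L[ℝ] Lp ℝ 2 (D.noise τ),
      (∀ k, ‖W k‖ ≤ κ * τ ^ (-γ) * ‖k‖) ∧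
      (∀ k, (W k : H → ℝ) =ᵐ[D.noise τ] fun z =>
        gaussianFunctional (D.liftedCov s' τ) (D.liftedLambda s' τ k) (D.Upsilon s' (D.ι z))) ∧
      ∀ s ∈ Ioc 0 T, s ≤ s' → ∀ (y : D.PathSpace) (k : K) (δ : ℝ), 0 ≤ δ → δ ≤ 1 →
        |∫ z, D.pathKernel fhat s τ (D.addPath y (D.C k)) z ∂(D.noise τ) -
          ∫ z, D.pathKernel fhat s τ y z ∂(D.noise τ) -
          ∫ z, D.pathKernel fhat s τ y z * W k z ∂(D.noise τ)| ≤
            3 * (weightedSup T η f * s ^ (-η)) * (κ * τ ^ (-γ) * ‖k‖) ^ (1 + δ) := by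
  rw [D.noise_apply hτ.le]
  have hc : 0 ≤ κ * τ ^ (-γ) := mul_nonneg hL.κ_pos.le (Real.rpow_nonneg hτ.le _)
  obtain ⟨W, hW1, hW2, hW3⟩ := exists_gaussianWeight (D.Q_isPositive hτ.le)
    (D.isCentredGaussian_Q hτ.le) (D.Upsilon s' ∘L D.ι) (D.Upsilon s' ∘L D.Sb.op τ ∘L D.C) hc
    (fun k => by
      have := hL.mem_range s' (s' + τ) hs' (by linarith) hT₁ k
      rwa [add_sub_cancel_left] at this)
    (fun k => by
      have := hL.bound s' (s' + τ) hs' (by linarith) hT₁ k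
      rwa [add_sub_cancel_left] at this)
  refine ⟨W, hW1, hW2, fun s hs hss y k δ hδ0 hδ1 => ?_⟩
  obtain ⟨x, rfl⟩ := D.toPath_surjective y
  set E := Function.extend (D.Upsilon s') (f s) 0 with hE
  have h1 := hW3 (fun u => E (u + D.Upsilon s' (D.Sb.op τ x))) (weightedSup T η f * s ^ (-η))
    ((hf.measurable_extend hs hss).comp (measurable_id.add_const _))
    (fun u => hf.abs_extend_le hs hss _) k δ hδ0 hδ1
  have h2 : ∀ z, E ((D.Upsilon s' ∘L D.ι) z + (D.Upsilon s' ∘L D.Sb.op τ ∘L D.C) k +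
      D.Upsilon s' (D.Sb.op τ x)) =
      D.pathKernel fhat s τ (D.addPath (D.toPath x) (D.C k)) z := fun z => by
    rw [D.addPath_toPath, hf.1.pathKernel_toPath hs hτ.le, ← hf.extend_Upsilon hs hss]
    simp only [ContinuousLinearMap.comp_apply, map_add, hE]
    congr 1
    abel
  have h3 : ∀ z, E ((D.Upsilon s' ∘L D.ι) z + D.Upsilon s' (D.Sb.op τ x)) =
      D.pathKernel fhat s τ (D.toPath x) z := fun z => by
    rw [hf.1.pathKernel_toPath hs hτ.le, ← hf.extend_Upsilon hs hss]
    simp only [ContinuousLinearMap.comp_apply, map_add, hE]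
  simp only [h2, h3] at h1
  exact h1

lemma IsProgRep.isPathKernel (hf : D.IsProgRep T η f fhat) {T₁ κ γ : ℝ}
    (hL : D.LiftedControllability T₁ κ γ) (hT : 0 < T) (hTT : T ≤ T₁) (hη0 : 0 ≤ η) (hη1 : η < 1) :
    D.PathKernel T κ γ η (weightedSup T η f) (D.pathKernel fhat) where
  T_pos := hT
  κ_nonneg := hL.κ_pos.le
  γ_nonneg := hL.γ_pos.le
  γ_lt_one := hL.γ_lt_one
  η_nonneg := hη0
  η_lt_one := hη1
  M_nonneg := weightedSup_nonneg T η f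
  measurable := hf.1.measurable_pathKernel
  eq_zero := fun s τ y z hs => by
    rw [pathKernel, dif_neg fun h => absurd h.1 (not_lt.2 hs)]
  bound := fun s τ y z hs => by
    rw [pathKernel]
    split_ifs with h
    · obtain ⟨x, hx⟩ := D.toPath_surjective (D.addPath (D.shiftPath τ y) (D.ι z))
      rw [← hx, ← hf.1.2.2]
      exact hf.1.abs_le h x
    · rw [abs_zero]
      exact mul_nonneg (weightedSup_nonneg T η f) (Real.rpow_nonneg hs.le _)
  prog := fun s τ hs hτ hsT y y' hy => by
    have hs' : s ∈ Ioc 0 T := ⟨hs, by linarith⟩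
    funext z
    rw [pathKernel, pathKernel, dif_pos hs', dif_pos hs']
    refine hf.congr ⟨s, hs'⟩ fun r hr => ?_
    have hr' : (r : ℝ) ≤ s := hr
    have h1 := hy (timeShift τ r) (by
      change (r : ℝ) + max τ 0 ≤ s + τ
      rw [max_eq_left hτ.le]
      linarith)
    exact congrArg (· + D.path (D.ι z) r) h1
  smooth := fun τ hτ hτT => by
    obtain ⟨W, h1, -, h3⟩ := hf.exists_weight hL (s' := T - τ) (sub_pos.2 hτT) hτ (by linarith)
    exact ⟨W, h1, fun s hs hsT => h3 s ⟨hs, by linarith⟩ (by linarith)⟩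

section Formula

variable {T₁ κ γ : ℝ}

lemma IsProgRep.R_eq (hf : D.IsProgRep T η f fhat) {s t : ℝ} (hs : s ∈ Ioc 0 t) (ht : t ≤ T)
    (x : Hb) : D.R (t - s) (f s) x =
      ∫ z, D.pathKernel fhat s (t - s) (D.toPath x) z ∂(D.noise (t - s)) := by
  rw [R, D.noise_apply (sub_nonneg.2 hs.2)]
  simp only [hf.1.pathKernel_toPath ⟨hs.1, hs.2.trans ht⟩ (sub_nonneg.2 hs.2)]

lemma IsProgRep.conv_eq (hf : D.IsProgRep T η f fhat)
    (hK : D.PathKernel T κ γ η (weightedSup T η f) (D.pathKernel fhat)) {t : ℝ} (ht : t ∈ Icc 0 T)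
    (x : Hb) : D.conv f t x = hK.conv t (D.toPath x) := by
  rw [(hK.conv_eq_intervalIntegral ht _).2, conv]
  refine intervalIntegral.integral_congr_ae (Eventually.of_forall fun s hs => ?_)
  rw [uIoc_of_le ht.1] at hs
  exact hf.R_eq hs ht.2 x

lemma IsProgRep.convWellDefined (hf : D.IsProgRep T η f fhat)
    (hK : D.PathKernel T κ γ η (weightedSup T η f) (D.pathKernel fhat)) {t : ℝ} (ht : t ∈ Icc 0 T)
    (x : Hb) : D.ConvWellDefined f t x := by
  refine ⟨fun s hs => ?_, ?_⟩
  · have h1 := hK.integrable s (t - s) (D.toPath x)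
    rw [D.noise_apply (sub_nonneg.2 hs.2.le)] at h1
    refine h1.congr (Eventually.of_forall fun z => ?_)
    exact hf.1.pathKernel_toPath ⟨hs.1, hs.2.le.trans ht.2⟩ (sub_nonneg.2 hs.2.le) x z
  · refine IntervalIntegrable.congr (fun s hs => ?_) (hK.conv_eq_intervalIntegral ht (D.toPath x)).1
    rw [uIoc_of_le ht.1] at hs
    exact (hf.R_eq hs ht.2 x).symm

/-- The derivative of the mean at delay `t - s` in terms of the measurable linear functional on
`L²(0, s; H)`. The weight of the kernel is built on a longer time interval; the two agree because
both give the first order term of the same function. -/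
lemma IsProgRep.sens_eq (hf : D.IsProgRep T η f fhat) (hL : D.LiftedControllability T₁ κ γ)
    (hTT : T ≤ T₁) (hK : D.PathKernel T κ γ η (weightedSup T η f) (D.pathKernel fhat)) {s t : ℝ}
    (hs : s ∈ Ioo 0 t) (ht : t ≤ T) (x : Hb) (k : K) :
    Integrable (D.derivIntegrand fhat t x k s) (gaussian (D.liftedCov s (t - s))) ∧
    hK.sens s (t - s) (D.toPath x) k =
      ∫ z, D.derivIntegrand fhat t x k s z ∂(gaussian (D.liftedCov s (t - s))) := by
  have hτ : 0 < t - s := sub_pos.2 hs.2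
  have hsT : s ∈ Ioc 0 T := ⟨hs.1, hs.2.le.trans ht⟩
  set τ := t - s with hτdef
  obtain ⟨W, -, hW2, hW3⟩ := hf.exists_weight hL hs.1 hτ (by linarith)
  have hQ := D.isCentredGaussian_Q hτ.le
  have hmp : MeasurePreserving (D.Upsilon s ∘L D.ι) (gaussian (D.Q τ))
      (gaussian (D.liftedCov s τ)) := measurePreserving_gaussian hQ (D.Upsilon s ∘L D.ι)
  have hS : (D.liftedCov s τ).IsPositive := isPositive_conj (D.Q_isPositive hτ.le) (D.Upsilon s ∘L D.ι)
  have hν : IsCentredGaussian (D.liftedCov s τ) (gaussian (D.liftedCov s τ)) :=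
    gaussian_spec ⟨_, hQ.map (D.Upsilon s ∘L D.ι)⟩
  have hν' : IsProbabilityMeasure (gaussian (D.liftedCov s τ)) := hν.1
  have hmem := hL.mem_range s t hs.1 hs.2 (ht.trans hTT) k
  have hgf := (isGaussianFunctional_gaussianFunctional hS hν (pinv_spec _ hmem).1).1
  have hon : D.onL2 fhat s = Function.extend (D.Upsilon s) (f s) 0 :=
    onL2_eq_extend hf ⟨s, hsT⟩
  have hint : Integrable (D.derivIntegrand fhat t x k s) (gaussian (D.liftedCov s τ)) := by
    refine integrable_mul_of_bounded (M := weightedSup T η f * s ^ (-η)) ?_ (fun z => ?_)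
      (hgf.integrable one_le_two)
    · rw [hon]
      exact ((hf.measurable_extend hsT le_rfl).comp
        (measurable_id.add_const _)).aestronglyMeasurable
    · rw [hon]
      exact hf.abs_extend_le hsT le_rfl _
  refine ⟨hint, ?_⟩
  have h1 : ∫ z, D.derivIntegrand fhat t x k s z ∂(gaussian (D.liftedCov s τ)) =
      ∫ z, D.pathKernel fhat s τ (D.toPath x) z * W k z ∂(D.noise τ) := by
    have h2 := hint.aestronglyMeasurable
    rw [← hmp.map_eq] at h2 ⊢
    rw [integral_map hmp.measurable.aemeasurable h2, ← D.noise_apply hτ.le]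
    refine integral_congr_ae ?_
    filter_upwards [hW2 k] with z hz
    rw [hz, derivIntegrand, hon, hf.1.pathKernel_toPath hsT hτ.le,
      ← hf.extend_Upsilon hsT le_rfl, map_add]
    rfl
  rw [h1]
  -- both sides are the limit of the same difference quotients
  set A := 3 * (weightedSup T η f * s ^ (-η)) * (κ * τ ^ (-γ) * ‖k‖) ^ (1 + (1 : ℝ)) with hA
  have hκτ : 0 ≤ κ * τ ^ (-γ) * ‖k‖ :=
    mul_nonneg (mul_nonneg hL.κ_pos.le (Real.rpow_nonneg hτ.le _)) (norm_nonneg _)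
  have h3 : ∀ a : ℝ, 3 * (weightedSup T η f * s ^ (-η)) * (κ * τ ^ (-γ) * ‖a • k‖) ^ (1 + (1 : ℝ)) =
      A * |a| ^ (1 + (1 : ℝ)) := fun a => by
    rw [norm_smul, Real.norm_eq_abs, hA, show κ * τ ^ (-γ) * (|a| * ‖k‖) =
      (κ * τ ^ (-γ) * ‖k‖) * |a| by ring, Real.mul_rpow hκτ (abs_nonneg a)]
    ring
  refine tendsto_nhds_unique
    (tendsto_nat_slope (δ := 1) (A := 3 * weightedSup T η f * κ ^ (1 + (1 : ℝ)) * ‖k‖ ^ (1 + (1 : ℝ)) *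
        (τ ^ (-(γ * (1 + 1))) * singKernel η t τ)) (ψ := fun a =>
      ∫ z, D.pathKernel fhat s τ (D.addPath (D.toPath x) (D.C (a • k))) z ∂(D.noise τ))
      one_pos fun a => ?_)
    (tendsto_nat_slope (δ := 1) (A := A) (ψ := fun a =>
      ∫ z, D.pathKernel fhat s τ (D.addPath (D.toPath x) (D.C (a • k))) z ∂(D.noise τ))
      (v := ∫ z, D.pathKernel fhat s τ (D.toPath x) z ∂(D.noise τ)) one_pos fun a => ?_)
  · have h4 := hK.abs_mean_sub_le ht hτ (D.toPath x) (a • k) zero_le_one le_rfl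
    rw [hK.sens_smul, norm_smul, Real.mul_rpow (norm_nonneg _) (norm_nonneg _),
      Real.norm_eq_abs a, show t - τ = s by rw [hτdef]; ring] at h4
    exact h4.trans (le_of_eq (by ring))
  · have h4 := hW3 s hsT le_rfl (D.toPath x) (a • k) 1 zero_le_one le_rfl
    rw [h3, integral_mul_weight_smul] at h4
    exact h4

lemma IsProgRep.grad_formula (hf : D.IsProgRep T η f fhat) (hL : D.LiftedControllability T₁ κ γ)
    (hTT : T ≤ T₁) (hK : D.PathKernel T κ γ η (weightedSup T η f) (D.pathKernel fhat)) {t : ℝ}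
    (ht : t ∈ Icc 0 T) (x : Hb) (k : K) :
    IntervalIntegrable (fun s => ∫ z, D.derivIntegrand fhat t x k s z
      ∂(gaussian (D.liftedCov s (t - s)))) volume 0 t ∧
    hK.grad t (D.toPath x) k = ∫ s in (0 : ℝ)..t, ∫ z, D.derivIntegrand fhat t x k s z
      ∂(gaussian (D.liftedCov s (t - s))) := by
  obtain ⟨h1, h2⟩ := hK.grad_eq_intervalIntegral ht (D.toPath x) k
  have h3 : ∀ s ∈ Ioo 0 t, hK.sens s (t - s) (D.toPath x) k =
      ∫ z, D.derivIntegrand fhat t x k s z ∂(gaussian (D.liftedCov s (t - s))) := fun s hs =>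
    (hf.sens_eq hL hTT hK hs ht.2 x k).2
  refine ⟨h1.congr_uIoo fun s hs => ?_, ?_⟩
  · rw [uIoo_of_le ht.1] at hs
    exact h3 s hs
  · rw [h2]
    refine intervalIntegral.integral_congr_ae ?_
    have hne : ∀ᵐ s : ℝ, s ≠ t := by simp [ae_iff]
    filter_upwards [hne] with s hs hs'
    rw [uIoc_of_le ht.1] at hs'
    exact h3 s ⟨hs'.1, lt_of_le_of_ne hs'.2 hs⟩

/-- A continuous path dependent datum gives a kernel that is continuous in time and path. -/
lemma continuousOn_pathKernel (hc : Continuous fhat) (τ : ℝ) (z : H) :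
    ContinuousOn (fun p : ℝ × D.PathSpace => D.pathKernel fhat p.1 τ p.2 z) (Ioc 0 T ×ˢ univ) := by
  rw [continuousOn_iff_continuous_domRestrict]
  have hs : Continuous fun y : D.PathSpace => D.addPath (D.shiftPath τ y) (D.ι z) :=
    D.continuous_addPath.comp
      ((D.continuous_shiftPath.comp (continuous_const.prodMk continuous_id)).prodMk
        continuous_const)
  have h1 : Continuous fun p : (Ioc (0 : ℝ) T ×ˢ univ : Set (ℝ × D.PathSpace)) =>
      fhat (⟨p.1.1, p.2.1⟩, D.addPath (D.shiftPath τ p.1.2) (D.ι z)) := by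
    refine hc.comp (Continuous.prodMk (Continuous.subtype_mk ?_ _) ?_)
    · exact continuous_fst.comp continuous_subtype_val
    · exact hs.comp (continuous_snd.comp continuous_subtype_val)
  refine h1.congr fun p => ?_
  have hp : p.1.1 ∈ Ioc 0 T := p.2.1
  rw [domRestrict_apply, pathKernel, dif_pos hp]

end Formula

end OUSetting

namespace OUSetting

variable {H Hb K Ξ : Type*}
  [NormedAddCommGroup H] [InnerProductSpace ℝ H] [CompleteSpace H] [SecondCountableTopology H]
  [NormedAddCommGroup Hb] [NormedSpace ℝ Hb]
  [NormedAddCommGroup K] [InnerProductSpace ℝ K]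
  [NormedAddCommGroup Ξ] [InnerProductSpace ℝ Ξ] [CompleteSpace Ξ]

/-! ### Data depending on `P x` as a kernel -/

open Classical in
/-- The kernel of the convolution of a datum `s^{-η} ψ(s, P x)`. Only the value at time `τ` of the
path `y` of `x` enters, since `P (z + e^{τA} x) = P z + y(τ)`. -/
def valueKernel (D : OUSetting H Hb K Ξ) (T η : ℝ) (ψ : ℝ → H → ℝ) (s τ : ℝ) (y : D.PathSpace)
    (z : H) : ℝ :=
  if h : s ∈ Ioc 0 T ∧ 0 < τ then s ^ (-η) * ψ s (D.P z + y.1 ⟨τ, h.2⟩) else 0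

variable {D : OUSetting H Hb K Ξ} {T η M : ℝ} {ψ : ℝ → H → ℝ}

lemma valueKernel_toPath {s τ : ℝ} (hs : s ∈ Ioc 0 T) (hτ : 0 < τ) (x : Hb) (z : H) :
    D.valueKernel T η ψ s τ (D.toPath x) z = s ^ (-η) * ψ s (D.P z + D.PE τ x) := by
  rw [valueKernel, dif_pos ⟨hs, hτ⟩]
  rfl

lemma P_add_mem_range {τ : ℝ} (hP : ∀ t : ℝ, 0 < t → ∀ x : Hb, D.PE t x ∈ range D.P) (hτ : 0 < τ)
    (y : D.PathSpace) (z : H) : D.P z + y.1 ⟨τ, hτ⟩ ∈ range D.P := by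
  obtain ⟨x, rfl⟩ := D.toPath_surjective y
  obtain ⟨w, hw⟩ := hP τ hτ x
  exact ⟨z + w, by rw [map_add, hw]; rfl⟩

/-- The kernel is jointly continuous where it is not set to `0`. -/
lemma continuous_valueKernel (hP : ∀ t : ℝ, 0 < t → ∀ x : Hb, D.PE t x ∈ range D.P)
    (hψ : ContinuousOn (fun p : ℝ × H => ψ p.1 p.2) (Ioc 0 T ×ˢ range D.P)) :
    Continuous fun p : {p : (ℝ × ℝ × D.PathSpace) × H // p.1.1 ∈ Ioc 0 T ∧ 0 < p.1.2.1} =>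
      p.1.1.1 ^ (-η) * ψ p.1.1.1 (D.P p.1.2 + p.1.1.2.2.1 ⟨p.1.1.2.1, p.2.2⟩) := by
  refine Continuous.mul ?_ ?_
  · exact Continuous.rpow_const (by fun_prop) fun p => Or.inl p.2.1.1.ne'
  · have hτ : Continuous fun p : {p : (ℝ × ℝ × D.PathSpace) × H //
        p.1.1 ∈ Ioc 0 T ∧ 0 < p.1.2.1} => (⟨p.1.1.2.1, p.2.2⟩ : Ioi (0 : ℝ)) :=
      Continuous.subtype_mk (by fun_prop) _
    have hev : Continuous fun p : {p : (ℝ × ℝ × D.PathSpace) × H //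
        p.1.1 ∈ Ioc 0 T ∧ 0 < p.1.2.1} => p.1.1.2.2.1 ⟨p.1.1.2.1, p.2.2⟩ :=
      continuous_eval.comp ((show Continuous fun p : {p : (ℝ × ℝ × D.PathSpace) × H //
        p.1.1 ∈ Ioc 0 T ∧ 0 < p.1.2.1} => p.1.1.2.2.1 by fun_prop).prodMk hτ)
    exact hψ.comp_continuous (f := fun p : {p : (ℝ × ℝ × D.PathSpace) × H //
        p.1.1 ∈ Ioc 0 T ∧ 0 < p.1.2.1} =>
        (p.1.1.1, D.P p.1.2 + p.1.1.2.2.1 ⟨p.1.1.2.1, p.2.2⟩))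
      ((by fun_prop : Continuous fun p : {p : (ℝ × ℝ × D.PathSpace) × H //
        p.1.1 ∈ Ioc 0 T ∧ 0 < p.1.2.1} => p.1.1.1).prodMk
        ((D.P.continuous.comp (by fun_prop)).add hev))
      fun p => ⟨p.2.1, P_add_mem_range hP p.2.2 _ _⟩

lemma continuousOn_valueKernel (hP : ∀ t : ℝ, 0 < t → ∀ x : Hb, D.PE t x ∈ range D.P)
    (hψ : ContinuousOn (fun p : ℝ × H => ψ p.1 p.2) (Ioc 0 T ×ˢ range D.P)) {τ : ℝ} (hτ : 0 < τ)
    (z : H) :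
    ContinuousOn (fun p : ℝ × D.PathSpace => D.valueKernel T η ψ p.1 τ p.2 z)
      (Ioc 0 T ×ˢ univ) := by
  rw [continuousOn_iff_continuous_domRestrict]
  have h1 := (continuous_valueKernel (η := η) hP hψ).comp
    (f := fun p : (Ioc (0 : ℝ) T ×ˢ univ : Set (ℝ × D.PathSpace)) =>
      ⟨((p.1.1, τ, p.1.2), z), p.2.1, hτ⟩) (Continuous.subtype_mk (by fun_prop) _)
  refine h1.congr fun p => ?_
  have hp : p.1.1 ∈ Ioc 0 T := p.2.1
  rw [domRestrict_apply, valueKernel, dif_pos ⟨hp, hτ⟩]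
  rfl

variable [MeasurableSpace H] [BorelSpace H]

lemma measurable_valueKernel (hP : ∀ t : ℝ, 0 < t → ∀ x : Hb, D.PE t x ∈ range D.P)
    (hψ : ContinuousOn (fun p : ℝ × H => ψ p.1 p.2) (Ioc 0 T ×ˢ range D.P)) :
    Measurable fun p : (ℝ × ℝ × D.PathSpace) × H =>
      D.valueKernel T η ψ p.1.1 p.1.2.1 p.1.2.2 p.2 := by
  classical
  let A : Set ((ℝ × ℝ × D.PathSpace) × H) := {p | p.1.1 ∈ Ioc 0 T ∧ 0 < p.1.2.1}
  have hA : MeasurableSet A := by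
    refine MeasurableSet.inter ?_ ?_
    · exact (measurable_fst.comp measurable_fst) (measurableSet_Ioc (a := (0 : ℝ)) (b := T))
    · exact (measurable_fst.comp (measurable_snd.comp measurable_fst))
        (measurableSet_Ioi (a := (0 : ℝ)))
  exact Measurable.dite (s := A) (g := fun _ => (0 : ℝ))
    (continuous_valueKernel (η := η) hP hψ).measurable measurable_const hA

variable [CompleteSpace Hb] [SecondCountableTopology Ξ]

lemma isPathKernel_valueKernel (hP : ∀ t : ℝ, 0 < t → ∀ x : Hb, D.PE t x ∈ range D.P)
    {κ γ : ℝ} (hT : 0 < T) (hC : D.Controllability T κ γ) (hη0 : 0 ≤ η) (hη1 : η < 1)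
    (hψ : ContinuousOn (fun p : ℝ × H => ψ p.1 p.2) (Ioc 0 T ×ˢ range D.P))
    (hM : ∀ t ∈ Ioc 0 T, ∀ y ∈ range D.P, |ψ t y| ≤ M) :
    D.PathKernel T (κ * max 1 (T ^ γ)) γ η M (D.valueKernel T η ψ) where
  T_pos := hT
  κ_nonneg := mul_nonneg hC.κ_pos.le (zero_le_one.trans (le_max_left _ _))
  γ_nonneg := hC.γ_pos.le
  γ_lt_one := hC.γ_lt_one
  η_nonneg := hη0
  η_lt_one := hη1
  M_nonneg := (abs_nonneg _).trans (hM T ⟨hT, le_rfl⟩ 0 ⟨0, map_zero _⟩)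
  measurable := measurable_valueKernel hP hψ
  eq_zero := fun s τ y z hs => by
    rw [valueKernel, dif_neg fun h => absurd h.1.1 (not_lt.2 hs)]
  bound := fun s τ y z hs => by
    have hM0 : 0 ≤ M := (abs_nonneg _).trans (hM T ⟨hT, le_rfl⟩ 0 ⟨0, map_zero _⟩)
    have hr : 0 ≤ s ^ (-η) := Real.rpow_nonneg hs.le _
    rw [valueKernel]
    split_ifs with h
    · rw [abs_mul, abs_of_nonneg hr, mul_comm]
      exact mul_le_mul_of_nonneg_right (hM s h.1 _ (P_add_mem_range hP h.2 y z)) hr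
    · rw [abs_zero]
      positivity
  prog := fun s τ hs hτ hsT y y' hy => by
    funext z
    have hs' : s ∈ Ioc 0 T := ⟨hs, by linarith⟩
    rw [valueKernel, valueKernel, dif_pos ⟨hs', hτ⟩, dif_pos ⟨hs', hτ⟩,
      hy ⟨τ, hτ⟩ (by change τ ≤ s + τ; linarith)]
  smooth := fun τ hτ hτT => by
    have hκ := hC.κ_pos
    have hτγ : 0 < τ ^ (-γ) := Real.rpow_pos_of_pos hτ _
    have hle : max (τ ^ (-γ)) 1 ≤ max 1 (T ^ γ) * τ ^ (-γ) := by
      refine max_le (le_mul_of_one_le_left hτγ.le (le_max_left _ _)) ?_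
      have h1 : 1 ≤ T ^ γ * τ ^ (-γ) := by
        rw [Real.rpow_neg hτ.le, ← div_eq_mul_inv, one_le_div (Real.rpow_pos_of_pos hτ _)]
        exact Real.rpow_le_rpow hτ.le hτT.le hC.γ_pos.le
      exact h1.trans (mul_le_mul_of_nonneg_right (le_max_right _ _) hτγ.le)
    rw [D.noise_apply hτ.le]
    obtain ⟨W, hW1, -, hW3⟩ := exists_gaussianWeight (c := κ * max 1 (T ^ γ) * τ ^ (-γ))
      (D.Q_isPositive hτ.le) (D.isCentredGaussian_Q hτ.le) D.P (D.PE τ ∘L D.C) (by positivity)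
      (fun k => hC.mem_range τ hτ k)
      (fun k => (hC.bound τ ⟨hτ, hτT.le⟩ k).trans (by
        rw [mul_assoc κ (max 1 (T ^ γ))]
        exact mul_le_mul_of_nonneg_right (mul_le_mul_of_nonneg_left hle hκ.le) (norm_nonneg k)))
    refine ⟨W, hW1, fun s hs hsT y k δ hδ0 hδ1 => ?_⟩
    have hs' : s ∈ Ioc 0 T := ⟨hs, by linarith⟩
    have hr : 0 ≤ s ^ (-η) := Real.rpow_nonneg hs.le _
    have hM0 : 0 ≤ M := (abs_nonneg _).trans (hM T ⟨hT, le_rfl⟩ 0 ⟨0, map_zero _⟩)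
    obtain ⟨x, rfl⟩ := D.toPath_surjective y
    have hψs : Continuous fun w : H => ψ s (D.P w) :=
      hψ.comp_continuous (f := fun w : H => (s, D.P w))
        (continuous_const.prodMk D.P.continuous) fun w => ⟨hs', w, rfl⟩
    have hfac : ∀ w w', D.P w = D.P w' → ψ s (D.P w) = ψ s (D.P w') := fun w w' h => by rw [h]
    set E := Function.extend D.P (fun w => ψ s (D.P w)) 0 with hE
    have hEm : Measurable E := D.P.measurable_extend_of_factor hψs.measurable hfac
    have hEr : ∀ u ∈ range D.P, E u = ψ s u := by
      rintro _ ⟨w, rfl⟩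
      exact Function.FactorsThrough.extend_apply (fun a b h => hfac a b h) _ _
    have hEb : ∀ u, |E u| ≤ M := fun u => by
      by_cases hu : u ∈ range D.P
      · rw [hEr u hu]
        exact hM s hs' u hu
      · rw [hE, Function.extend_apply' _ _ _ hu, Pi.zero_apply, abs_zero]
        exact hM0
    have h1 := hW3 (fun u => s ^ (-η) * E (u + D.PE τ x)) (M * s ^ (-η))
      ((hEm.comp (measurable_id.add_const _)).const_mul _)
      (fun u => by
        rw [abs_mul, abs_of_nonneg hr, mul_comm]
        exact mul_le_mul_of_nonneg_right (hEb _) hr) k δ hδ0 hδ1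
    have h2 : ∀ v z, s ^ (-η) * E (D.P z + D.PE τ v) =
        D.valueKernel T η ψ s τ (D.toPath v) z := fun v z => by
      have hv : D.P z + D.PE τ v ∈ range D.P := P_add_mem_range hP hτ (D.toPath v) z
      rw [valueKernel_toPath hs' hτ, hEr _ hv]
    have h3 : ∀ z, s ^ (-η) * E (D.P z + (D.PE τ ∘L D.C) k + D.PE τ x) =
        D.valueKernel T η ψ s τ (D.addPath (D.toPath x) (D.C k)) z := fun z => by
      rw [D.addPath_toPath, ← h2, map_add (D.PE τ), ContinuousLinearMap.comp_apply, add_assoc,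
        add_comm (D.PE τ (D.C k))]
    simp only [h2, h3] at h1
    exact h1

lemma factorP_eq {f : ℝ → H → ℝ} (hf : ∀ t ∈ Ioc 0 T, ∀ x : H, t ^ η * f t x = ψ t (D.P x))
    {s : ℝ} (hs : s ∈ Ioc 0 T) {y : H} (hy : y ∈ range D.P) :
    D.factorP (f s) y = s ^ (-η) * ψ s y := by
  have hy' : ∃ x : H, D.P x = y := hy
  have h1 := hf s hs hy'.choose
  rw [hy'.choose_spec] at h1
  rw [factorP, dif_pos hy', ← h1, ← mul_assoc, ← Real.rpow_add hs.1, neg_add_cancel,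
    Real.rpow_zero, one_mul]

lemma factorP_eq_valueKernel (hP : ∀ t : ℝ, 0 < t → ∀ x : Hb, D.PE t x ∈ range D.P)
    {f : ℝ → H → ℝ} (hf : ∀ t ∈ Ioc 0 T, ∀ x : H, t ^ η * f t x = ψ t (D.P x)) {s τ : ℝ}
    (hs : s ∈ Ioc 0 T) (hτ : 0 < τ) (x : Hb) (z : H) :
    D.factorP (f s) (D.P z + D.PE τ x) = D.valueKernel T η ψ s τ (D.toPath x) z := by
  rw [valueKernel_toPath hs hτ]
  exact factorP_eq hf hs (P_add_mem_range hP hτ (D.toPath x) z)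

lemma RP_eq (hP : ∀ t : ℝ, 0 < t → ∀ x : Hb, D.PE t x ∈ range D.P)
    {f : ℝ → H → ℝ} (hf : ∀ t ∈ Ioc 0 T, ∀ x : H, t ^ η * f t x = ψ t (D.P x)) {s t : ℝ}
    (hs : s ∈ Ioo 0 t) (ht : t ≤ T) (x : Hb) :
    ∫ z, D.valueKernel T η ψ s (t - s) (D.toPath x) z ∂(D.noise (t - s)) =
      D.RP (t - s) (f s) x := by
  have hτ : 0 < t - s := sub_pos.2 hs.2
  rw [RP, D.noise_apply hτ.le]
  simp only [factorP_eq_valueKernel hP hf ⟨hs.1, hs.2.le.trans ht⟩ hτ x]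

lemma PathKernel.convP_eq {κ γ : ℝ} (hK : D.PathKernel T κ γ η M (D.valueKernel T η ψ))
    (hP : ∀ t : ℝ, 0 < t → ∀ x : Hb, D.PE t x ∈ range D.P)
    {f : ℝ → H → ℝ} (hf : ∀ t ∈ Ioc 0 T, ∀ x : H, t ^ η * f t x = ψ t (D.P x)) {t : ℝ}
    (ht : t ∈ Icc 0 T) (x : Hb) : D.convP f t x = hK.conv t (D.toPath x) := by
  rw [(hK.conv_eq_intervalIntegral ht _).2, convP]
  refine intervalIntegral.integral_congr_ae ?_
  have hne : ∀ᵐ s : ℝ, s ≠ t := by simp [ae_iff]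
  filter_upwards [hne] with s hs hs'
  rw [uIoc_of_le ht.1] at hs'
  exact (RP_eq hP hf ⟨hs'.1, lt_of_le_of_ne hs'.2 hs⟩ ht.2 x).symm

lemma PathKernel.convPWellDefined {κ γ : ℝ}
    (hK : D.PathKernel T κ γ η M (D.valueKernel T η ψ))
    (hP : ∀ t : ℝ, 0 < t → ∀ x : Hb, D.PE t x ∈ range D.P)
    {f : ℝ → H → ℝ} (hf : ∀ t ∈ Ioc 0 T, ∀ x : H, t ^ η * f t x = ψ t (D.P x)) {t : ℝ}
    (ht : t ∈ Icc 0 T) (x : Hb) : D.ConvPWellDefined f t x := by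
  refine ⟨fun s hs => ?_, ?_⟩
  · have hτ : 0 < t - s := sub_pos.2 hs.2
    have h1 := hK.integrable s (t - s) (D.toPath x)
    rw [D.noise_apply hτ.le] at h1
    exact h1.congr (Eventually.of_forall fun z =>
      (factorP_eq_valueKernel hP hf ⟨hs.1, hs.2.le.trans ht.2⟩ hτ x z).symm)
  · refine (hK.conv_eq_intervalIntegral ht (D.toPath x)).1.congr_uIoo fun s hs => ?_
    rw [uIoo_of_le ht.1] at hs
    exact RP_eq hP hf hs ht.2 x

end OUSetting

end

/-! ### The regularity theorem -/

theorem proposition2p15 {H Hb K Ξ : Type*}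
    [NormedAddCommGroup H] [InnerProductSpace ℝ H] [CompleteSpace H] [SecondCountableTopology H]
    [MeasurableSpace H] [BorelSpace H]
    [NormedAddCommGroup Hb] [NormedSpace ℝ Hb] [CompleteSpace Hb]
    [NormedAddCommGroup K] [InnerProductSpace ℝ K] [CompleteSpace K] [SecondCountableTopology K]
    [NormedAddCommGroup Ξ] [InnerProductSpace ℝ Ξ] [CompleteSpace Ξ] [SecondCountableTopology Ξ]
    (D : OUSetting H Hb K Ξ) :
    -- path dependent data, under the lifted controllability hypothesis
    (∀ T₁ κ γ : ℝ, D.LiftedControllability T₁ κ γ →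
      ∀ T : ℝ, 0 < T → T ≤ T₁ → ∀ η : ℝ, 0 ≤ η → η < 1 →
      ∀ (f : ℝ → Hb → ℝ) (fhat : Ioc (0 : ℝ) T × D.PathSpace → ℝ), D.IsProgRep T η f fhat →
        -- the convolution is well defined and `C`-Fréchet differentiable
        (∀ t ∈ Icc 0 T, ∀ x : Hb, D.ConvWellDefined f t x ∧
          CFrechetDifferentiableAt D.C (D.conv f t) x) ∧
        D.SProg T γ (fun t x => cGrad D.C (D.conv f t) x) ∧
        -- the formula for the derivative
        (∀ t ∈ Icc 0 T, ∀ (x : Hb) (k : K),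
          (∀ s ∈ Ioo 0 t,
            Integrable (D.derivIntegrand fhat t x k s) (gaussian (D.liftedCov s (t - s)))) ∧
          IntervalIntegrable (fun s => ∫ z, D.derivIntegrand fhat t x k s z
            ∂(gaussian (D.liftedCov s (t - s)))) volume 0 t ∧
          cDeriv D.C (D.conv f t) x k =
            ∫ s in (0 : ℝ)..t, ∫ z, D.derivIntegrand fhat t x k s z
              ∂(gaussian (D.liftedCov s (t - s)))) ∧
        -- the estimates
        (∀ t ∈ Ioc 0 T, ∀ (x : Hb) (k : K),
          |⟪cGrad D.C (D.conv f t) x, k⟫_ℝ| ≤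
            (⨆ p : Ioc (0 : ℝ) T × Hb, |(p.1 : ℝ) ^ η * f p.1 p.2|) * ‖k‖ *
              ∫ s in (0 : ℝ)..t, κ * s ^ (-η) * (t - s) ^ (-γ)) ∧
        (∀ t ∈ Ioc 0 T,
          IntervalIntegrable (fun s : ℝ => κ * s ^ (-η) * (t - s) ^ (-γ)) volume 0 t ∧
          ∫ s in (0 : ℝ)..t, κ * s ^ (-η) * (t - s) ^ (-γ) =
            κ * ProbabilityTheory.beta (1 - η) (1 - γ) * t ^ (1 - η - γ) ∧
          κ * ProbabilityTheory.beta (1 - η) (1 - γ) * t ^ (1 - η - γ) ≤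
            κ * ProbabilityTheory.beta (1 - η) (1 - γ) * T ^ (1 - η) * t ^ (-γ)) ∧
        -- continuous data
        (Continuous fhat →
          ContinuousOn (fun p : ℝ × Hb => D.conv f p.1 p.2) (Icc 0 T ×ˢ univ) ∧
          ContinuousOn (fun p : ℝ × Hb => cGrad D.C (D.conv f p.1) p.2) (Ioc 0 T ×ˢ univ) ∧
          D.S1Prog T γ (D.conv f))) ∧
    -- data depending on `P x`, under the controllability hypothesis on `P`
    ((∀ t : ℝ, 0 < t → ∀ x : Hb, D.PE t x ∈ range D.P) →
      ∀ T κ γ : ℝ, 0 < T → D.Controllability T κ γ → ∀ η : ℝ, 0 ≤ η → η < 1 →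
      ∀ f : ℝ → H → ℝ, D.IsCbP T η f →
        (∀ t ∈ Icc 0 T, ∀ x : Hb, D.ConvPWellDefined f t x ∧
          CFrechetDifferentiableAt D.C (D.convP f t) x) ∧
        ContinuousOn (fun p : ℝ × Hb => D.convP f p.1 p.2) (Icc 0 T ×ˢ univ) ∧
        ContinuousOn (fun p : ℝ × Hb => cGrad D.C (D.convP f p.1) p.2) (Ioc 0 T ×ˢ univ) ∧
        D.S1Prog T γ (D.convP f)) := by
  refine ⟨?_, ?_⟩
  · intro T₁ κ γ hL T hT hTT η hη0 hη1 f fhat hf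
    have hK := hf.isPathKernel hL hT hTT hη0 hη1
    have hg : ∀ t ∈ Icc 0 T, ∀ x, D.conv f t x = hK.conv t (D.toPath x) :=
      fun t ht x => hf.conv_eq hK ht x
    have hbeta : ∀ t ∈ Ioc 0 T,
        IntervalIntegrable (fun s : ℝ => κ * s ^ (-η) * (t - s) ^ (-γ)) volume 0 t ∧
        ∫ s in (0 : ℝ)..t, κ * s ^ (-η) * (t - s) ^ (-γ) =
          κ * ProbabilityTheory.beta (1 - η) (1 - γ) * t ^ (1 - η - γ) := fun t ht => by
      have h1 := (intervalIntegrable_rpow_mul_sub_rpow hη1 hL.γ_lt_one ht.1).const_mul κ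
      have h2 := integral_rpow_mul_sub_rpow hη1 hL.γ_lt_one ht.1
      simp only [← mul_assoc] at h1
      refine ⟨h1, ?_⟩
      simp only [mul_assoc]
      rw [intervalIntegral.integral_const_mul, h2]
    refine ⟨fun t ht x => ⟨hf.convWellDefined hK ht x, _, hK.hasCFrechetDerivAt hg ht x⟩,
      hK.sProg_cGrad hg, fun t ht x k => ⟨fun s hs => (hf.sens_eq hL hTT hK hs ht.2 x k).1, ?_⟩,
      fun t ht x k => ?_, fun t ht => ⟨(hbeta t ht).1, (hbeta t ht).2, ?_⟩, fun hc => ?_⟩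
    · rw [hK.cDeriv_eq hg ht]
      exact hf.grad_formula hL hTT hK ht x k
    · have ht' : t ∈ Icc 0 T := ⟨ht.1.le, ht.2⟩
      rw [hK.cGrad_eq hg ht', InnerProductSpace.toDual_symm_apply, hK.grad_apply ht',
        (hbeta t ht).2]
      refine (hK.abs_integral_sens_le ht _ k).trans (le_of_eq ?_)
      -- the beta function is symmetric
      have hsymm : ProbabilityTheory.beta (1 - γ) (1 - η) =
          ProbabilityTheory.beta (1 - η) (1 - γ) := by
        rw [ProbabilityTheory.beta, ProbabilityTheory.beta, mul_comm (Real.Gamma (1 - γ)),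
          add_comm (1 - γ)]
      rw [hsymm, show (1 : ℝ) - γ - η = 1 - η - γ by ring, weightedSup]
      ring
    · have hB := ProbabilityTheory.beta_pos (sub_pos.2 hη1) (sub_pos.2 hL.γ_lt_one)
      have hκ := hL.κ_pos
      rw [sub_eq_add_neg (1 - η) γ, Real.rpow_add ht.1, ← mul_assoc]
      have h1 := Real.rpow_le_rpow ht.1.le ht.2 (sub_nonneg.2 hη1.le)
      have h2 := Real.rpow_nonneg ht.1.le (-γ)
      gcongr
    · have hcont : ∀ τ, 0 < τ → τ < T → ∀ z, ContinuousOn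
          (fun p : ℝ × D.PathSpace => D.pathKernel fhat p.1 τ p.2 z) (Ioc 0 T ×ˢ univ) :=
        fun τ _ _ z => OUSetting.continuousOn_pathKernel hc τ z
      exact ⟨hK.continuousOn_of_conv hg hcont, hK.continuousOn_cGrad hg hcont,
        hK.s1Prog hg hcont⟩
  · rintro hP T κ γ hT hC η hη0 hη1 f ⟨ψ, hψ, ⟨M, hM⟩, hf⟩
    have hK := OUSetting.isPathKernel_valueKernel hP hT hC hη0 hη1 hψ hM
    have hg : ∀ t ∈ Icc 0 T, ∀ x, D.convP f t x = hK.conv t (D.toPath x) :=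
      fun t ht x => hK.convP_eq hP hf ht x
    have hcont : ∀ τ, 0 < τ → τ < T → ∀ z, ContinuousOn
        (fun p : ℝ × D.PathSpace => D.valueKernel T η ψ p.1 τ p.2 z) (Ioc 0 T ×ˢ univ) :=
      fun τ hτ _ z => OUSetting.continuousOn_valueKernel hP hψ hτ z
    exact ⟨fun t ht x => ⟨hK.convPWellDefined hP hf ht x, _, hK.hasCFrechetDerivAt hg ht x⟩,
      hK.continuousOn_of_conv hg hcont, hK.continuousOn_cGrad hg hcont, hK.s1Prog hg hcont⟩
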